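/- A mixed graph $G=(V,D,B)$ has a finite node set $V=\{1,\dots,m\}$, directed edges $v\to w$ ($(v,w)\in D$) and bidirected edges $v\leftrightarrow w$ ($(v,w)\in B$, $B$ symmetric), without self-loops. Write $\mathrm{pa}(v)=\{w: w\to v\in D\}$ and $\mathrm{sib}(v)=\{w: w\leftrightarrow v\in B\}$. A half-trek from $y$ to $x_n$ is a path $x_0\to x_1\to\cdots\to x_n$ ($n\ge 0$) with $x_0=y$, or a path $y\leftrightarrow x_0\to x_1\to\cdots\to x_n$; its left side is $\{y\}$ and its right side is $\{x_0,\dots,x_n\}$ (nodes may repeat). Let $\mathrm{htr}(v)$ be the set of nodes outside $\{v\}\cup\mathrm{sib}(v)$ that are the target of a half-trek from $v$. A set $Y\subseteq V$ satisfies the half-trek criterion with respect to $v$ if $|Y|=|\mathrm{pa}(v)|$, $Y\cap(\{v\}\cup\mathrm{sib}(v))=\varnothing$, and there is a set of half-treks with pairwise distinct sources forming $Y$, pairwise distinct targets forming $\mathrm{pa}(v)$, pairwise disjoint left sides and pairwise disjoint right sides. $G$ is HTC-identifiable if there are sets $Y_v$ $(v\in V)$, each satisfying the half-trek criterion with respect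 to $v$, and a strict total order $\prec$ on $V$ with $w\prec v$ whenever $w\in Y_v\cap\mathrm{htr}(v)$. For $v\in V$ and $A\subseteq V\setminus(\{v\}\cup\mathrm{sib}(v))$ let $G_{\mathrm{flow}}(v,A)$ be the flow network with nodes $s$, $t$, $L(a)$ $(a\in A)$ and $R(w)$ $(w\in V)$, and edges $s\to L(a)$ and $L(a)\to R(a)$ for $a\in A$, $L(a)\to R(w)$ for $a\in A$, $a\leftrightarrow w\in B$, $R(w)\to R(u)$ for $w\to u\in D$, and $R(w)\to t$ for $w\in\mathrm{pa}(v)$; the edges and $s$, $t$ have capacity $\infty$, all other nodes have capacity $1$. Consider the following algorithm with input $G$. Set $S\leftarrow\{v:\mathrm{pa}(v)=\varnothing\}$. Repeat: for $v=1,\dots,m$, if $v\notin S$, let $A=(S\cup(V\setminus\mathrm{htr}(v)))\setminus(\{v\}\cup\mathrm{sib}(v))$, and if the maximum flow size of $G_{\mathrm{flow}}(v,A)$ from $s$ to $t$ equals $|\mathrm{pa}(v)|$, set $S\leftarrow S\cup\{v\}$; until $S=V$ or no change has occurred in the last iteration. Return "yes" if $S=V$, and "no" otherwise. **Theorem.**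 The algorithm always halts, and it returns "yes" if and only if $G$ is HTC-identifiable. Furthermore, with a maximum flow subroutine that takes $\mathcal{O}((n+q)^3)$ steps on the networks $G_{\mathrm{flow}}(v,A)$, where $n$ is the number of nodes and $q$ the number of reciprocal edge pairs of the network (such a subroutine exists), the algorithm takes at most $\mathcal{O}(|V|^2(|V|+r)^3)$ elementary steps on a unit-cost random access machine, where $r\le|D|/2$ is the number of reciprocal edge pairs $\{v\to w,\ w\to v\}$, $v\ne w$, in $D$. -/

import Mathlib

open scoped NNReal ENNReal

/-! ## Mixed graphs and the half-trek criterion -/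

/-- A mixed graph on the node set `V`: directed edges `dir v w` (`v → w`) and bidirected edges
`bi v w` (`v ↔ w`), without self-loops. -/
structure MixedGraph (V : Type*) where
  dir : V → V → Prop
  bi : V → V → Prop
  dir_irrefl : ∀ v, ¬ dir v v
  bi_irrefl : ∀ v, ¬ bi v v
  bi_symm : ∀ v w, bi v w → bi w v

/-- The number of reciprocal edge pairs `v → w`, `w → v` (`v ≠ w`) of a directed graph. -/
noncomputable def reciprocalPairs {V : Type*} (E : V → V → Prop) : ℕ :=
  Set.ncard {e : Sym2 V | ∃ v w, e = s(v, w) ∧ v ≠ w ∧ E v w ∧ E w v}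

namespace MixedGraph

variable {V : Type*} (G : MixedGraph V)

/-- The parents of `v`. -/
def pa (v : V) : Set V := {w | G.dir w v}

/-- The siblings of `v`. -/
def sib (v : V) : Set V := {w | G.bi w v}

/-- A half-trek: a trek whose left-hand side is the single node `source`. Its right-hand side is
the directed path `head → ⋯` (nodes may repeat), which either starts at `source` itself (then
`source` is the top node, and belongs to both sides) or is joined to `source` by a bidirected
edge. -/
structure HalfTrek where
  source : V
  head : V
  tail : List V
  start : head = source ∨ G.bi source head
  path : List.IsChain G.dir (head :: tail)

namespace HalfTrek

variable {G}

/-- The last node of a half-trek. -/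
def target (π : G.HalfTrek) : V := (π.head :: π.tail).getLast (List.cons_ne_nil _ _)

/-- The left-hand side. -/
def left (π : G.HalfTrek) : Set V := {π.source}

/-- The right-hand side. -/
def right (π : G.HalfTrek) : Set V := {w | w ∈ π.head :: π.tail}

end HalfTrek

/-- `htr(v)`: the nodes other than `v` and its siblings that are reachable from `v` by a
half-trek. -/
def htr (v : V) : Set V :=
  {w | w ∉ insert v (G.sib v) ∧ ∃ π : G.HalfTrek, π.source = v ∧ π.target = w}

/-- `S` is a system of half-treks from `X` to `Y`: distinct sources, forming `X`, and distinct
targets, forming `Y`. -/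
def IsHalfTrekSystem (S : Set G.HalfTrek) (X Y : Set V) : Prop :=
  Set.BijOn HalfTrek.source S X ∧ Set.BijOn HalfTrek.target S Y

/-- A set of half-treks without sided intersection. -/
def NoSidedIntersection (S : Set G.HalfTrek) : Prop :=
  ∀ π ∈ S, ∀ ρ ∈ S, π ≠ ρ → π.left ∩ ρ.left = ∅ ∧ π.right ∩ ρ.right = ∅

/-- The half-trek criterion for `Y` with respect to `v`. -/
def HalfTrekCriterion (Y : Set V) (v : V) : Prop :=
  Y.ncard = (G.pa v).ncard ∧
  Y ∩ insert v (G.sib v) = ∅ ∧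
  ∃ S : Set G.HalfTrek, G.IsHalfTrekSystem S Y (G.pa v) ∧ G.NoSidedIntersection S

/-- HTC-identifiability. -/
def HTCIdentifiable : Prop :=
  ∃ Y : V → Set V, (∀ v, G.HalfTrekCriterion (Y v) v) ∧
    ∃ prec : V → V → Prop, IsStrictTotalOrder V prec ∧
      ∀ v w, w ∈ Y v ∩ G.htr v → prec w v

end MixedGraph

/-! ## Maximum flow -/

/-- A directed graph with a source, a sink, node capacities and edge capacities. -/
structure FlowNetwork (ν : Type*) where
  edge : ν → ν → Prop
  source : ν
  sink : ν
  nodeCap : ν → ℝ≥0∞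
  edgeCap : ν → ν → ℝ≥0∞

namespace FlowNetwork

variable {ν : Type*} [Fintype ν] (N : FlowNetwork ν)

/-- A flow; it is extended by `0` to pairs that are not edges. -/
def IsFlow (f : ν → ν → ℝ≥0) : Prop :=
  (∀ u v, ¬ N.edge u v → f u v = 0) ∧
  (∀ v, v ≠ N.source → v ≠ N.sink →
    ∑ u, f u v = ∑ w, f v w ∧ ((∑ w, f v w : ℝ≥0) : ℝ≥0∞) ≤ N.nodeCap v) ∧
  (∀ u v, N.edge u v → (f u v : ℝ≥0∞) ≤ N.edgeCap u v)

/-- The size of a flow. -/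
def flowSize (f : ν → ν → ℝ≥0) : ℝ≥0 := ∑ w, f N.source w

/-- `k` is the maximal size of a flow. -/
def IsMaxFlow (k : ℝ≥0) : Prop := IsGreatest {x | ∃ f, N.IsFlow f ∧ N.flowSize f = x} k

end FlowNetwork

/-- The nodes of the network `G_flow(v, A)`: source, sink, a left-hand copy `L(a)` of every
`a ∈ A`, and a right-hand copy `R(w)` of every node `w`. -/
inductive FlowNode {V : Type*} (A : Set V) : Type _
  | source : FlowNode A
  | sink : FlowNode A
  | left (a : A) : FlowNode A
  | right (w : V) : FlowNode A

/-- `FlowNode A` is the disjoint union of two points, `A` and `V`. -/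
def FlowNode.equivSum {V : Type*} (A : Set V) : Bool ⊕ (A ⊕ V) ≃ FlowNode A where
  toFun
    | .inl true => .source
    | .inl false => .sink
    | .inr (.inl a) => .left a
    | .inr (.inr w) => .right w
  invFun
    | .source => .inl true
    | .sink => .inl false
    | .left a => .inr (.inl a)
    | .right w => .inr (.inr w)
  left_inv := by rintro ((_ | _) | (_ | _)) <;> rfl
  right_inv := by rintro (_ | _ | _ | _) <;> rfl

noncomputable instance {V : Type*} [Finite V] (A : Set V) : Fintype (FlowNode A) :=
  haveI : Finite (FlowNode A) := Finite.of_equiv _ (FlowNode.equivSum A)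
  Fintype.ofFinite _

namespace MixedGraph

variable {V : Type*} (G : MixedGraph V)

/-- The edges of `G_flow(v, A)`. -/
inductive FlowEdge (v : V) (A : Set V) : FlowNode A → FlowNode A → Prop
  | source_left (a : A) : FlowEdge v A .source (.left a)
  | left_right (a : A) : FlowEdge v A (.left a) (.right a)
  | left_sibling (a : A) (w : V) : G.bi a w → FlowEdge v A (.left a) (.right w)
  | right_right (w u : V) : G.dir w u → FlowEdge v A (.right w) (.right u)
  | right_sink (w : V) : w ∈ G.pa v → FlowEdge v A (.right w) .sink

/-- The network `G_flow(v, A)`: edges, source and sink have capacity `∞`, all other nodes have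
capacity `1`. -/
def flowNetwork (v : V) (A : Set V) : FlowNetwork (FlowNode A) where
  edge := G.FlowEdge v A
  source := .source
  sink := .sink
  nodeCap
    | .source => ⊤
    | .sink => ⊤
    | .left _ => 1
    | .right _ => 1
  edgeCap _ _ := ⊤

end MixedGraph

/-! ## A random access machine with unit costs

A memory consists of registers and two-dimensional arrays (both named by natural numbers) that
hold natural numbers. Every elementary operation (reading a constant or a register, an array
access, an addition, a truncated subtraction, a comparison, an assignment, a branching) costs one
step. There is no multiplication. -/

namespace RAM

/-- A memory state. -/
structure Memory where
  reg : ℕ → ℕ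
  arr : ℕ → ℕ → ℕ → ℕ

/-- Expressions; comparisons have the value `1` (true) or `0` (false). -/
inductive Expr : Type
  | lit (n : ℕ) : Expr
  | reg (x : ℕ) : Expr
  | get (a : ℕ) (i j : Expr) : Expr
  | add (e e' : Expr) : Expr
  | sub (e e' : Expr) : Expr
  | eq (e e' : Expr) : Expr
  | lt (e e' : Expr) : Expr

/-- The value of an expression. -/
def Expr.eval (σ : Memory) : Expr → ℕ
  | lit n => n
  | reg x => σ.reg x
  | get a i j => σ.arr a (i.eval σ) (j.eval σ)
  | add e e' => e.eval σ + e'.eval σ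
  | sub e e' => e.eval σ - e'.eval σ
  | eq e e' => if e.eval σ = e'.eval σ then 1 else 0
  | lt e e' => if e.eval σ < e'.eval σ then 1 else 0

/-- The number of steps that the evaluation of an expression takes. -/
def Expr.cost : Expr → ℕ
  | lit _ => 1
  | reg _ => 1
  | get _ i j => 1 + i.cost + j.cost
  | add e e' => 1 + e.cost + e'.cost
  | sub e e' => 1 + e.cost + e'.cost
  | eq e e' => 1 + e.cost + e'.cost
  | lt e e' => 1 + e.cost + e'.cost

/-- Programs. A condition holds if its value is not `0`. -/
inductive Cmd : Type
  | skip : Cmd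
  | assign (x : ℕ) (e : Expr) : Cmd
  | put (a : ℕ) (i j e : Expr) : Cmd
  | seq (c c' : Cmd) : Cmd
  | cond (b : Expr) (c c' : Cmd) : Cmd
  | loop (b : Expr) (c : Cmd) : Cmd

/-- `Exec c σ t τ`: the program `c`, started in the memory `σ`, halts after exactly `t` steps with
the memory `τ`. -/
inductive Exec : Cmd → Memory → ℕ → Memory → Prop
  | skip (σ : Memory) : Exec .skip σ 1 σ
  | assign (x : ℕ) (e : Expr) (σ : Memory) :
      Exec (.assign x e) σ (1 + e.cost) ⟨Function.update σ.reg x (e.eval σ), σ.arr⟩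
  | put (a : ℕ) (i j e : Expr) (σ : Memory) :
      Exec (.put a i j e) σ (1 + i.cost + j.cost + e.cost)
        ⟨σ.reg, fun b k l =>
          if b = a ∧ k = i.eval σ ∧ l = j.eval σ then e.eval σ else σ.arr b k l⟩
  | seq {c c' : Cmd} {σ τ ρ : Memory} {t t' : ℕ} :
      Exec c σ t τ → Exec c' τ t' ρ → Exec (.seq c c') σ (t + t') ρ
  | cond_true {b : Expr} {c c' : Cmd} {σ τ : Memory} {t : ℕ} :
      b.eval σ ≠ 0 → Exec c σ t τ → Exec (.cond b c c') σ (1 + b.cost + t) τ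
  | cond_false {b : Expr} {c c' : Cmd} {σ τ : Memory} {t : ℕ} :
      b.eval σ = 0 → Exec c' σ t τ → Exec (.cond b c c') σ (1 + b.cost + t) τ
  | loop_false {b : Expr} {c : Cmd} {σ : Memory} :
      b.eval σ = 0 → Exec (.loop b c) σ (1 + b.cost) σ
  | loop_true {b : Expr} {c : Cmd} {σ τ ρ : Memory} {t t' : ℕ} :
      b.eval σ ≠ 0 → Exec c σ t τ → Exec (.loop b c) τ t' ρ →
        Exec (.loop b c) σ (1 + b.cost + t + t') ρ

/-- Execution is deterministic, so the running time and the result of a program are well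
defined. -/
theorem Exec.deterministic {c : Cmd} {σ τ : Memory} {t : ℕ} (h : Exec c σ t τ) :
    ∀ {t' : ℕ} {τ' : Memory}, Exec c σ t' τ' → t' = t ∧ τ' = τ := by
  induction h with
  | skip | assign | put => intro t' τ' h'; cases h'; exact ⟨rfl, rfl⟩
  | seq _ _ ih₁ ih₂ =>
    intro t' τ' h'
    cases h' with
    | seq k₁ k₂ =>
      obtain ⟨rfl, rfl⟩ := ih₁ k₁
      obtain ⟨rfl, rfl⟩ := ih₂ k₂
      exact ⟨rfl, rfl⟩
  | cond_true hb _ ih =>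
    intro t' τ' h'
    cases h' with
    | cond_true _ k => obtain ⟨rfl, rfl⟩ := ih k; exact ⟨rfl, rfl⟩
    | cond_false hb' _ => exact absurd hb' hb
  | cond_false hb _ ih =>
    intro t' τ' h'
    cases h' with
    | cond_true hb' _ => exact absurd hb hb'
    | cond_false _ k => obtain ⟨rfl, rfl⟩ := ih k; exact ⟨rfl, rfl⟩
  | loop_false hb =>
    intro t' τ' h'
    cases h' with
    | loop_false _ => exact ⟨rfl, rfl⟩
    | loop_true hb' _ _ => exact absurd hb hb'
  | loop_true hb _ _ ih₁ ih₂ =>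
    intro t' τ' h'
    cases h' with
    | loop_false hb' => exact absurd hb' hb
    | loop_true _ k₁ k₂ =>
      obtain ⟨rfl, rfl⟩ := ih₁ k₁
      obtain ⟨rfl, rfl⟩ := ih₂ k₂
      exact ⟨rfl, rfl⟩

/-- Sequential composition of a list of programs. -/
def Cmd.block : List Cmd → Cmd
  | [] => .skip
  | c :: l => .seq c (block l)

/-- `if b then c`. -/
def Cmd.when (b : Expr) (c : Cmd) : Cmd := .cond b c .skip

/-- `for x = 0, …, n - 1 do c`, where `n` is the content of the register `bound`. -/
def Cmd.forBelow (x bound : ℕ) (c : Cmd) : Cmd :=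
  .block [.assign x (.lit 0),
    .loop (.lt (.reg x) (.reg bound)) (.block [c, .assign x (.add (.reg x) (.lit 1))])]

/-- `repeat c until b`. -/
def Cmd.repeatUntil (c : Cmd) (b : Expr) : Cmd := .seq c (.loop (.eq b (.lit 0)) c)

end RAM

/-! ## The algorithm -/

namespace HTCAlgorithm

open RAM RAM.Cmd

/-! Names of registers. The graph has the nodes `0, …, m - 1`. -/

/-- The number of nodes of the graph (input). -/
abbrev rM : ℕ := 0
/-- The output: `1` for "yes", `0` for "no". -/
abbrev rAnswer : ℕ := 1
/-- The node under consideration. -/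
abbrev rV : ℕ := 2
/-- Whether a change has occurred in the current iteration. -/
abbrev rChanged : ℕ := 3
/-- The value returned by the maximum flow procedure. -/
abbrev rFlow : ℕ := 4
/-- The number of rows and columns of the adjacency matrix of the flow network. -/
abbrev rSize : ℕ := 5
/-- The row of the source of the flow network. -/
abbrev rSource : ℕ := 6
/-- The row of the sink of the flow network. -/
abbrev rSink : ℕ := 7
/-- The number of parents of the node under consideration. -/
abbrev rParents : ℕ := 8
/-- Counters. -/
abbrev rI : ℕ := 9
/-- Counters. -/
abbrev rJ : ℕ := 10
/-- Counters. -/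
abbrev rK : ℕ := 11

/-! Names of arrays. A set of nodes is stored as the row `0` of an array, with entries `0`, `1`. -/

/-- The adjacency matrix of the directed part (input). -/
abbrev aDir : ℕ := 0
/-- The adjacency matrix of the bidirected part (input). -/
abbrev aBi : ℕ := 1
/-- `SolvedNodes`. -/
abbrev aSolved : ℕ := 2
/-- `htr(v)`. -/
abbrev aHtr : ℕ := 3
/-- The set `A` of allowed nodes. -/
abbrev aAllowed : ℕ := 4
/-- The adjacency matrix of the flow network. -/
abbrev aNet : ℕ := 5

/-- Membership of the node in register `x` in the set stored in `a`. -/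
abbrev mem (a x : ℕ) : Expr := .get a (.lit 0) (.reg x)

/-- Set the membership of the node in register `x` in the set stored in `a` to `e`. -/
abbrev setMem (a x : ℕ) (e : Expr) : Cmd := .put a (.lit 0) (.reg x) e

/-- Negation. -/
abbrev not (e : Expr) : Expr := .eq e (.lit 0)

/-- `rParents := |pa(v)|`. -/
def countParents : Cmd :=
  .block [.assign rParents (.lit 0),
    .forBelow rI rM (.when (.get aDir (.reg rI) (.reg rV))
      (.assign rParents (.add (.reg rParents) (.lit 1))))]

/-- The node in register `x` is `v` or a sibling of `v`. -/
abbrev isSelfOrSib (x : ℕ) : Expr := .add (.eq (.reg x) (.reg rV)) (.get aBi (.reg rV) (.reg x))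

/-- `aHtr := htr(v)`: start from `v` and its siblings, close `m` times under children, and remove
`v` and its siblings again. -/
def computeHtr : Cmd :=
  .block [
    .forBelow rI rM
      (.cond (isSelfOrSib rI) (setMem aHtr rI (.lit 1)) (setMem aHtr rI (.lit 0))),
    .forBelow rK rM (.forBelow rI rM (.forBelow rJ rM
      (.when (mem aHtr rI) (.when (.get aDir (.reg rI) (.reg rJ))
        (setMem aHtr rJ (.lit 1)))))),
    .forBelow rI rM (.when (isSelfOrSib rI) (setMem aHtr rI (.lit 0)))]

/-- `A := (SolvedNodes ∪ (V \ htr(v))) \ ({v} ∪ sib(v))`. -/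
def computeAllowed : Cmd :=
  .forBelow rI rM
    (.cond (isSelfOrSib rI) (setMem aAllowed rI (.lit 0))
      (.cond (.add (mem aSolved rI) (not (mem aHtr rI)))
        (setMem aAllowed rI (.lit 1)) (setMem aAllowed rI (.lit 0))))

/-- Write down the network `G_flow(v, A)`: the node `L(a)` has the row `a`, the node `R(w)` has
the row `m + w`, the source has the row `2m`, the sink has the row `2m + 1`. -/
def buildNetwork : Cmd :=
  .block [
    .assign rSource (.add (.reg rM) (.reg rM)),
    .assign rSink (.add (.reg rSource) (.lit 1)),
    .assign rSize (.add (.reg rSink) (.lit 1)),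
    .forBelow rI rSize (.forBelow rJ rSize (.put aNet (.reg rI) (.reg rJ) (.lit 0))),
    .forBelow rI rM (.when (mem aAllowed rI) (.block [
      .put aNet (.reg rSource) (.reg rI) (.lit 1),
      .put aNet (.reg rI) (.add (.reg rM) (.reg rI)) (.lit 1),
      .forBelow rJ rM (.when (.get aBi (.reg rI) (.reg rJ))
        (.put aNet (.reg rI) (.add (.reg rM) (.reg rJ)) (.lit 1)))])),
    .forBelow rI rM (.forBelow rJ rM (.when (.get aDir (.reg rI) (.reg rJ))
      (.put aNet (.add (.reg rM) (.reg rI)) (.add (.reg rM) (.reg rJ)) (.lit 1)))),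
    .forBelow rI rM (.when (.get aDir (.reg rI) (.reg rV))
      (.put aNet (.add (.reg rM) (.reg rI)) (.reg rSink) (.lit 1)))]

/-- `rAnswer := 1` if `SolvedNodes = V`, and `rAnswer := 0` otherwise. -/
def checkAllSolved : Cmd :=
  .block [.assign rAnswer (.lit 1),
    .forBelow rI rM (.when (not (mem aSolved rI)) (.assign rAnswer (.lit 0)))]

/-- The algorithm that tests HTC-identifiability, with the procedure `maxFlow` as its maximum flow
subroutine. -/
def testHTC (maxFlow : Cmd) : Cmd :=
  .block [
    -- initialize `SolvedNodes` as the set of nodes without parents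
    .forBelow rV rM (.block [countParents, setMem aSolved rV (not (.reg rParents))]),
    .repeatUntil
      (.block [
        .assign rChanged (.lit 0),
        .forBelow rV rM (.when (not (mem aSolved rV)) (.block [
          computeHtr,
          computeAllowed,
          buildNetwork,
          maxFlow,
          countParents,
          .when (.eq (.reg rFlow) (.reg rParents)) (.block [
            setMem aSolved rV (.lit 1),
            .assign rChanged (.lit 1)])])),
        checkAllSolved])
      -- until `SolvedNodes = V` or no change has occurred in the last iteration
      (.add (.reg rAnswer) (not (.reg rChanged)))]

open Classical in
/-- The matrix (with entries `0`, `1`) of a relation between natural numbers. -/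
noncomputable def matrixOf (R : ℕ → ℕ → Prop) : ℕ → ℕ → ℕ := fun i j => if R i j then 1 else 0

/-- The initial memory: the number of nodes and the two adjacency matrices, and `0` everywhere
else. -/
noncomputable def input {m : ℕ} (G : MixedGraph (Fin m)) : Memory where
  reg := Function.update (fun _ => 0) rM m
  arr := fun a =>
    if a = aDir then matrixOf fun i j => ∃ v w : Fin m, i = v ∧ j = w ∧ G.dir v w
    else if a = aBi then matrixOf fun i j => ∃ v w : Fin m, i = v ∧ j = w ∧ G.bi v w
    else fun _ _ => 0

/-- The row of a node of `G_flow(v, A)` in the adjacency matrix of the network. -/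
def row {m : ℕ} {A : Set (Fin m)} : FlowNode A → ℕ
  | .left a => (a : Fin m)
  | .right w => m + w
  | .source => 2 * m
  | .sink => 2 * m + 1

/-- The memory `σ` holds the network `G_flow(v, A)`. -/
def HoldsNetwork {m : ℕ} (G : MixedGraph (Fin m)) (v : Fin m) (A : Set (Fin m)) (σ : Memory) :
    Prop :=
  σ.reg rSize = 2 * m + 2 ∧
  σ.reg rSource = row (A := A) .source ∧
  σ.reg rSink = row (A := A) .sink ∧
  ∀ i < 2 * m + 2, ∀ j < 2 * m + 2, σ.arr aNet i j =
    matrixOf (fun i j => ∃ x y : FlowNode A,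
      i = row x ∧ j = row y ∧ (G.flowNetwork v A).edge x y) i j

/-- The program `P` is a maximum flow procedure for the networks `G_flow(v, A)`: started in any
memory that holds such a network, it halts with the maximal size of a flow in `rFlow`, and all
other data of the calling program (registers below `12`, arrays below `5`) are unchanged. -/
def IsMaxFlowProcedure (P : Cmd) : Prop :=
  ∀ (m : ℕ) (G : MixedGraph (Fin m)) (v : Fin m) (A : Set (Fin m)),
    A ⊆ (insert v (G.sib v))ᶜ → ∀ σ : Memory, HoldsNetwork G v A σ →
      ∃ (t : ℕ) (τ : Memory), Exec P σ t τ ∧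
        (G.flowNetwork v A).IsMaxFlow (τ.reg rFlow : ℝ≥0) ∧
        (∀ x < 12, x ≠ rFlow → τ.reg x = σ.reg x) ∧
        (∀ a < 5, τ.arr a = σ.arr a)

/-- On a network `G_flow(v, A)` with `n` nodes and `s` reciprocal edge pairs, the program `P` takes
`O((n + s)^3)` steps. -/
def RunsInCubicTime (P : Cmd) : Prop :=
  ∃ K : ℕ, ∀ (m : ℕ) (G : MixedGraph (Fin m)) (v : Fin m) (A : Set (Fin m)),
    A ⊆ (insert v (G.sib v))ᶜ → ∀ σ : Memory, HoldsNetwork G v A σ →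
      ∀ (t : ℕ) (τ : Memory), Exec P σ t τ →
        t ≤ K * (Fintype.card (FlowNode A) + reciprocalPairs (G.flowNetwork v A).edge) ^ 3

end HTCAlgorithm

/-! The combinatorial core is a min-cut argument for vertex-disjoint paths. Such a path system is
encoded by its predecessor map `M` (`IsLinking`). If a set `X` contains the source, avoids the sink
and is closed under alternating steps (`IsAlternatingClosed`), then `X \ M '' X` is a cut with
exactly as many nodes as the linking has paths (`card_sdiff_image`). Every flow is bounded by this
cut, real-valued ones included, so the maximum flow size is the number of paths
(`isMaxFlow_of_isAlternatingClosed`). Each half-trek of a system for the half-trek criterion meets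
the cut as well, and disjointness of sides makes the meeting nodes distinct. Conversely, walking
back along a linking with `|pa(v)|` paths produces half-treks without sided intersection. Hence the
flow test succeeds exactly if some `Y ⊆ A` satisfies the criterion (`linkingSize_eq_iff`,
`eq_ncard_pa_iff`).

The greedy choice is sound because a newly solved node can be ranked above all earlier ones
(`Solvable.insert`). It is complete because, if the algorithm is stuck at `S ≠ V`, the least node
outside `S` in a witnessing order could still be solved (`HTCIdentifiable.eq_univ`).

Programs are treated by a calculus of total correctness, `wp`, that records running times. Since
execution is deterministic, a bound for one execution bounds them all. Time bounds in the outer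
loops are conditional on a proposition `B`, so one proof serves both an arbitrary correct flow
procedure and a cubic one. All iterations but the last add a node, so there are `O(m)` of them, each
with at most `m` flow calls; reciprocal pairs of the network come only from those of `G`. A cubic
flow procedure is obtained from breadth-first search for augmenting paths (`wp_unitMaxFlow`): at
most `N` searches find one, and each takes `O(N ^ 2)` steps. -/

/-! ### Program logic: total correctness with running times. -/

namespace RAM

/-- `c`, started in `σ`, halts, and the running time and the final memory satisfy `Q`. -/
def wp (c : Cmd) (σ : Memory) (Q : ℕ → Memory → Prop) : Prop := ∃ t τ, Exec c σ t τ ∧ Q t τ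

theorem wp.mono {c : Cmd} {σ : Memory} {Q Q' : ℕ → Memory → Prop} (h : wp c σ Q)
    (hQ : ∀ t τ, Q t τ → Q' t τ) : wp c σ Q' := by
  obtain ⟨t, τ, h₁, h₂⟩ := h
  exact ⟨t, τ, h₁, hQ _ _ h₂⟩

@[simp] theorem wp_skip {σ : Memory} {Q : ℕ → Memory → Prop} : wp .skip σ Q ↔ Q 1 σ := by
  constructor
  · rintro ⟨t, τ, h, hQ⟩
    cases h
    exact hQ
  · exact fun h => ⟨_, _, .skip σ, h⟩

@[simp] theorem wp_assign {x : ℕ} {e : Expr} {σ : Memory} {Q : ℕ → Memory → Prop} :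
    wp (.assign x e) σ Q ↔ Q (1 + e.cost) ⟨Function.update σ.reg x (e.eval σ), σ.arr⟩ := by
  constructor
  · rintro ⟨t, τ, h, hQ⟩
    cases h
    exact hQ
  · exact fun h => ⟨_, _, .assign x e σ, h⟩

@[simp] theorem wp_put {a : ℕ} {i j e : Expr} {σ : Memory} {Q : ℕ → Memory → Prop} :
    wp (.put a i j e) σ Q ↔ Q (1 + i.cost + j.cost + e.cost)
      ⟨σ.reg, fun b k l =>
        if b = a ∧ k = i.eval σ ∧ l = j.eval σ then e.eval σ else σ.arr b k l⟩ := by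
  constructor
  · rintro ⟨t, τ, h, hQ⟩
    cases h
    exact hQ
  · exact fun h => ⟨_, _, .put a i j e σ, h⟩

@[simp] theorem wp_seq {c c' : Cmd} {σ : Memory} {Q : ℕ → Memory → Prop} :
    wp (.seq c c') σ Q ↔ wp c σ fun t τ => wp c' τ fun t' ρ => Q (t + t') ρ := by
  constructor
  · rintro ⟨t, τ, h, hQ⟩
    cases h with
    | seq h₁ h₂ => exact ⟨_, _, h₁, _, _, h₂, hQ⟩
  · rintro ⟨t, τ, h₁, t', ρ, h₂, hQ⟩
    exact ⟨_, _, .seq h₁ h₂, hQ⟩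

theorem wp_cond {b : Expr} {c c' : Cmd} {σ : Memory} {Q : ℕ → Memory → Prop} :
    wp (.cond b c c') σ Q ↔
      (b.eval σ ≠ 0 → wp c σ fun t τ => Q (1 + b.cost + t) τ) ∧
      (b.eval σ = 0 → wp c' σ fun t τ => Q (1 + b.cost + t) τ) := by
  constructor
  · rintro ⟨t, τ, h, hQ⟩
    cases h with
    | cond_true hb h => exact ⟨fun _ => ⟨_, _, h, hQ⟩, fun h' => absurd h' hb⟩
    | cond_false hb h => exact ⟨fun h' => absurd hb h', fun _ => ⟨_, _, h, hQ⟩⟩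
  · rintro ⟨h₁, h₂⟩
    by_cases hb : b.eval σ = 0
    · obtain ⟨t, τ, h, hQ⟩ := h₂ hb
      exact ⟨_, _, .cond_false hb h, hQ⟩
    · obtain ⟨t, τ, h, hQ⟩ := h₁ hb
      exact ⟨_, _, .cond_true hb h, hQ⟩

@[simp] theorem wp_when {b : Expr} {c : Cmd} {σ : Memory} {Q : ℕ → Memory → Prop} :
    wp (.when b c) σ Q ↔
      (b.eval σ ≠ 0 → wp c σ fun t τ => Q (1 + b.cost + t) τ) ∧
      (b.eval σ = 0 → Q (1 + b.cost + 1) σ) := by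
  simp [Cmd.when, wp_cond]

@[simp] theorem wp_block_nil {σ : Memory} {Q : ℕ → Memory → Prop} :
    wp (.block []) σ Q ↔ Q 1 σ := wp_skip

@[simp] theorem wp_block_cons {c : Cmd} {l : List Cmd} {σ : Memory} {Q : ℕ → Memory → Prop} :
    wp (.block (c :: l)) σ Q ↔ wp c σ fun t τ => wp (.block l) τ fun t' ρ => Q (t + t') ρ :=
  wp_seq

/-- Rule for `while` loops with a variant. The running time is bounded under the condition `B`. -/
theorem wp_loop {B : Prop} {b : Expr} {c : Cmd} (I : ℕ → Memory → Prop) (T : ℕ)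
    (hstep : ∀ n σ, I n σ → b.eval σ ≠ 0 →
      wp c σ fun t τ => (B → t ≤ T) ∧ ∃ n' < n, I n' τ) :
    ∀ n σ, I n σ → wp (.loop b c) σ fun t τ =>
      (B → t ≤ n * (1 + b.cost + T) + (1 + b.cost)) ∧ (∃ n' ≤ n, I n' τ) ∧ b.eval τ = 0 := by
  intro n
  induction n using Nat.strong_induction_on with
  | _ n ih =>
    intro σ hI
    by_cases hb : b.eval σ = 0
    · exact ⟨_, _, .loop_false hb, fun _ => Nat.le_add_left _ _, ⟨n, le_rfl, hI⟩, hb⟩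
    · obtain ⟨t, τ, h, ht, n', hn', hI'⟩ := hstep n σ hI hb
      obtain ⟨t', ρ, h', ht', ⟨n'', hn'', hI''⟩, hb'⟩ := ih n' hn' τ hI'
      refine ⟨_, _, .loop_true hb h h', fun hB => ?_, ⟨n'', by omega, hI''⟩, hb'⟩
      have h₁ := ht hB
      have h₂ := ht' hB
      have h₃ : (n' + 1) * (1 + b.cost + T) ≤ n * (1 + b.cost + T) :=
        Nat.mul_le_mul_right _ hn'
      rw [Nat.succ_mul] at h₃
      omega

/-- Rule for `for` loops. -/
theorem wp_forBelow {B : Prop} {x bound : ℕ} {c : Cmd} {σ : Memory} (n T : ℕ)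
    (I : ℕ → Memory → Prop) (hx : bound ≠ x) (hn : σ.reg bound = n)
    (h0 : I 0 ⟨Function.update σ.reg x 0, σ.arr⟩)
    (hstep : ∀ k < n, ∀ τ, τ.reg x = k → τ.reg bound = n → I k τ →
      wp c τ fun t ρ => (B → t ≤ T) ∧ ρ.reg x = k ∧ ρ.reg bound = n ∧
        I (k + 1) ⟨Function.update ρ.reg x (k + 1), ρ.arr⟩) :
    wp (.forBelow x bound c) σ fun t τ => (B → t ≤ n * (T + 9) + 7) ∧ τ.reg x = n ∧
      τ.reg bound = n ∧ I n τ := by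
  have key := wp_loop (B := B) (b := .lt (.reg x) (.reg bound))
    (c := .block [c, .assign x (.add (.reg x) (.lit 1))])
    -- The variant `j` is the number of rounds left. The increment and the closing `skip` cost `5`
    -- and the test costs `4`, hence `T + 9` per round; the first assignment, the last test and the
    -- outer `skip` make up the final `7`.
    (fun j τ => ∃ k, k + j = n ∧ τ.reg x = k ∧ τ.reg bound = n ∧ I k τ) (T + 5) (by
      rintro j τ ⟨k, hk, h₁, h₂, hI⟩ hb
      have hkn : k < n := by
        by_contra hlt
        simp [Expr.eval, h₁, h₂, hlt] at hb
      simp only [wp_block_cons, wp_block_nil, wp_assign, Expr.cost, Expr.eval]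
      refine (hstep k hkn τ h₁ h₂ hI).mono ?_
      rintro t ρ ⟨ht, h₃, h₄, hI'⟩
      refine ⟨fun hB => by have := ht hB; omega, j - 1, by omega, k + 1, by omega, ?_, ?_, ?_⟩
      · simp [h₃]
      · simp [Function.update_of_ne hx, h₄]
      · rw [h₃]
        exact hI')
  simp only [Cmd.forBelow, wp_block_cons, wp_block_nil, wp_assign, Expr.cost, Expr.eval]
  refine (key n _ ⟨0, by simp, by simp, by simp [Function.update_of_ne hx, hn], h0⟩).mono ?_
  rintro t τ ⟨ht, ⟨j, hj, k, hk, h₁, h₂, hI⟩, hb⟩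
  have hkn : k = n := by
    by_contra hne
    have : k < n := by omega
    simp [Expr.eval, h₁, h₂, this] at hb
  subst hkn
  refine ⟨fun hB => ?_, h₁, h₂, hI⟩
  have := ht hB
  simp only [Expr.cost] at this
  have e : k * (1 + (1 + 1 + 1) + (T + 5)) = k * (T + 9) := by congr 1; omega
  rw [e] at this
  omega

/-- The program may change the register `r`. -/
def Cmd.writesReg : Cmd → ℕ → Bool
  | skip, _ => false
  | assign x _, r => r == x
  | put _ _ _ _, _ => false
  | seq c c', r => c.writesReg r || c'.writesReg r
  | cond _ c c', r => c.writesReg r || c'.writesReg r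
  | loop _ c, r => c.writesReg r

/-- The program may change the array `a`. -/
def Cmd.writesArr : Cmd → ℕ → Bool
  | skip, _ => false
  | assign _ _, _ => false
  | put b _ _ _, a => a == b
  | seq c c', r => c.writesArr r || c'.writesArr r
  | cond _ c c', r => c.writesArr r || c'.writesArr r
  | loop _ c, r => c.writesArr r

/-- The check is syntactic and Boolean, so for a concrete program and register its hypothesis is
closed by `rfl`. -/
theorem Exec.reg_eq {c : Cmd} {σ τ : Memory} {t : ℕ} (h : Exec c σ t τ) {r : ℕ}
    (hr : c.writesReg r = false) : τ.reg r = σ.reg r := by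
  induction h with
  | skip | put | loop_false => rfl
  | assign x e σ =>
    have : r ≠ x := by simpa [Cmd.writesReg] using hr
    simp [Function.update_of_ne this]
  | seq _ _ ih₁ ih₂ =>
    simp only [Cmd.writesReg, Bool.or_eq_false_iff] at hr
    rw [ih₂ hr.2, ih₁ hr.1]
  | cond_true _ _ ih =>
    simp only [Cmd.writesReg, Bool.or_eq_false_iff] at hr
    exact ih hr.1
  | cond_false _ _ ih =>
    simp only [Cmd.writesReg, Bool.or_eq_false_iff] at hr
    exact ih hr.2
  | loop_true _ _ _ ih₁ ih₂ => rw [ih₂ hr, ih₁ hr]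

theorem Exec.arr_eq {c : Cmd} {σ τ : Memory} {t : ℕ} (h : Exec c σ t τ) {a : ℕ}
    (ha : c.writesArr a = false) : τ.arr a = σ.arr a := by
  induction h with
  | skip | assign | loop_false => rfl
  | put b i j e σ =>
    have : a ≠ b := by simpa [Cmd.writesArr] using ha
    simp [this]
  | seq _ _ ih₁ ih₂ =>
    simp only [Cmd.writesArr, Bool.or_eq_false_iff] at ha
    rw [ih₂ ha.2, ih₁ ha.1]
  | cond_true _ _ ih =>
    simp only [Cmd.writesArr, Bool.or_eq_false_iff] at ha
    exact ih ha.1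
  | cond_false _ _ ih =>
    simp only [Cmd.writesArr, Bool.or_eq_false_iff] at ha
    exact ih ha.2
  | loop_true _ _ _ ih₁ ih₂ => rw [ih₂ ha, ih₁ ha]

/-- The memories agree on everything that `c` does not change. -/
def Frame (c : Cmd) (σ τ : Memory) : Prop :=
  (∀ r, c.writesReg r = false → τ.reg r = σ.reg r) ∧
    ∀ a, c.writesArr a = false → τ.arr a = σ.arr a

theorem wp.frame {c : Cmd} {σ : Memory} {Q : ℕ → Memory → Prop} (h : wp c σ Q) :
    wp c σ fun t τ => Q t τ ∧ Frame c σ τ := by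
  obtain ⟨t, τ, h, hQ⟩ := h
  exact ⟨t, τ, h, hQ, fun _ => h.reg_eq, fun _ => h.arr_eq⟩

/-- Rule for `for` loops whose body changes neither the counter nor the bound. -/
theorem wp_forBelow_frame {x bound : ℕ} {c : Cmd} {σ : Memory} (n T : ℕ)
    (I : ℕ → Memory → Prop) (hx : bound ≠ x) (hcx : c.writesReg x = false)
    (hcb : c.writesReg bound = false) (hn : σ.reg bound = n)
    (h0 : I 0 ⟨Function.update σ.reg x 0, σ.arr⟩)
    (hstep : ∀ k < n, ∀ τ, τ.reg x = k → Frame (.forBelow x bound c) σ τ → I k τ →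
      wp c τ fun t ρ => t ≤ T ∧ I (k + 1) ⟨Function.update ρ.reg x (k + 1), ρ.arr⟩) :
    wp (.forBelow x bound c) σ fun t τ => t ≤ n * (T + 9) + 7 ∧ I n τ ∧
      Frame (.forBelow x bound c) σ τ := by
  have hw : ∀ r, (Cmd.forBelow x bound c).writesReg r = false →
      c.writesReg r = false ∧ r ≠ x := by
    intro r
    simp [Cmd.forBelow, Cmd.block, Cmd.writesReg]
  have hw' : ∀ r, (Cmd.forBelow x bound c).writesArr r = false → c.writesArr r = false := by
    intro r
    simp [Cmd.forBelow, Cmd.block, Cmd.writesArr]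
  have := wp_forBelow (B := True) (x := x) (bound := bound) (c := c) (σ := σ) n T
    (fun k τ => I k τ ∧ Frame (.forBelow x bound c) σ τ) hx hn
    ⟨h0, fun r hr => Function.update_of_ne (hw r hr).2 _ _, fun a _ => rfl⟩ (by
      rintro k hk τ h₁ h₂ ⟨hI, hF⟩
      refine (hstep k hk τ h₁ hF hI).frame.mono ?_
      rintro t ρ ⟨⟨ht, hI'⟩, hF'⟩
      refine ⟨fun _ => ht, by rw [hF'.1 _ hcx, h₁], by rw [hF'.1 _ hcb, h₂], hI', ?_, ?_⟩
      · intro r hr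
        simp only
        rw [Function.update_of_ne (hw r hr).2, hF'.1 _ (hw r hr).1, hF.1 _ hr]
      · intro a ha
        simp only
        rw [hF'.2 _ (hw' a ha), hF.2 _ ha])
  refine this.mono ?_
  rintro t τ ⟨ht, _, _, hI, hF⟩
  exact ⟨ht trivial, hI, hF⟩

end RAM

/-! ## Linkings

A system of disjoint paths from `s` to `t` is stored as the map that sends every inner node of a
path to its predecessor, and all other nodes to themselves. -/

/-- `M` is the predecessor map of a system of paths from `s` to `t` (and perhaps some cycles)
without common inner nodes. -/
structure IsLinking {ν : Type*} (E : ν → ν → Prop) (s t : ν) (M : ν → ν) : Prop where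
  source : M s = s
  sink : M t = t
  step : ∀ x, M x = x ∨ E (M x) x
  inj : ∀ x y, M x = M y → M x ≠ s → x = y
  exit : ∀ u, (∀ x, M x ≠ u) → E u t

/-- A set of nodes that shows that a linking has the maximal size: it contains all nodes that can
be reached by alternating paths. -/
structure IsAlternatingClosed {ν : Type*} (E : ν → ν → Prop) (s t : ν) (M : ν → ν) (X : Set ν) :
    Prop where
  source : s ∈ X
  sink : t ∉ X
  edge : ∀ x ∈ X, ∀ y, E (M x) y → y ∈ X
  mate : ∀ x ∈ X, M x ∈ X

/-- The number of paths of a linking. -/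
noncomputable def linkingSize {ν : Type*} (s : ν) (M : ν → ν) : ℕ :=
  Set.ncard {x | x ≠ s ∧ M x = s}

namespace IsLinking

variable {ν : Type*} {E : ν → ν → Prop} {s t : ν} {M : ν → ν}

/-- Off the fibre over `s` the map is injective, so passing from `X` to its image loses one element
less than this fibre has. The fibre consists of `s` itself and the first nodes of the paths. With
`X` everything this counts the last nodes of the paths; with `X` alternating closed it gives the
size of the cut. -/
theorem card_sdiff_image [Fintype ν] [DecidableEq ν] (h : IsLinking E s t M) (X : Finset ν)
    (hX : ∀ x, M x = s → x ∈ X) (hM : ∀ x ∈ X, M x ∈ X) :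
    (X \ X.image M).card = linkingSize s M := by
  classical
  have hs : s ∈ X := hX s h.source
  have hsub : X.image M ⊆ X := by
    intro y hy
    obtain ⟨x, hx, rfl⟩ := Finset.mem_image.1 hy
    exact hM x hx
  have h₁ : (X.image M).erase s = (X.filter (M · ≠ s)).image M := by
    ext y
    simp only [Finset.mem_erase, Finset.mem_image, Finset.mem_filter]
    constructor
    · rintro ⟨hy, x, hx, rfl⟩
      exact ⟨x, ⟨hx, hy⟩, rfl⟩
    · rintro ⟨x, ⟨hx, hy⟩, rfl⟩
      exact ⟨hy, x, hx, rfl⟩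
  have h₂ : ((X.image M).erase s).card = (X.filter (M · ≠ s)).card := by
    rw [h₁]
    refine Finset.card_image_of_injOn fun x hx y hy hxy => h.inj x y hxy ?_
    exact (Finset.mem_filter.1 hx).2
  have h₃ : s ∈ X.image M := Finset.mem_image.2 ⟨s, hs, h.source⟩
  have h₄ : (X.filter (M · = s)).card = linkingSize s M + 1 := by
    have e : linkingSize s M = ((X.filter (M · = s)).erase s).card := by
      rw [linkingSize, ← Set.ncard_coe_finset]
      congr 1
      ext x
      simp only [Set.mem_ofPred_eq, Finset.coe_erase, Finset.coe_filter, Set.mem_sdiff,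
        Set.mem_singleton_iff]
      exact ⟨fun hx => ⟨⟨hX x hx.2, hx.2⟩, hx.1⟩, fun hx => ⟨hx.2, hx.1.2⟩⟩
    rw [e, Finset.card_erase_add_one]
    exact Finset.mem_filter.2 ⟨hs, h.source⟩
  have h₅ := Finset.card_filter_add_card_filter_not (s := X) (M · = s)
  have h₆ := Finset.card_erase_add_one h₃
  have h₇ := Finset.card_sdiff_add_card_eq_card hsub
  simp only [ne_eq] at h₂
  omega

/-- The number of paths is the number of their last inner nodes. -/
theorem card_exits [Fintype ν] (h : IsLinking E s t M) :
    Set.ncard {u | ∀ x, M x ≠ u} = linkingSize s M := by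
  classical
  rw [← h.card_sdiff_image Finset.univ (by simp) (by simp), ← Set.ncard_coe_finset]
  congr 1
  ext u
  simp

/-- As `s` is fixed, an iterate that differs from `s` has only predecessors that differ from `s`,
and injectivity applies at every stage. -/
theorem iterate_inj (h : IsLinking E s t M) {n : ℕ} {x y : ν} (hxy : M^[n] x = M^[n] y)
    (hs : M^[n] x ≠ s) : x = y := by
  induction n with
  | zero => exact hxy
  | succ n ih =>
    rw [Function.iterate_succ_apply', Function.iterate_succ_apply'] at hxy
    rw [Function.iterate_succ_apply'] at hs
    refine ih (h.inj _ _ hxy hs) fun h' => hs ?_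
    rw [h', h.source]

/-- If the walk back avoided `s`, two iterates would coincide by finiteness. Cancelling the common
steps would put `u` on a cycle, hence into the range of `M`. -/
theorem exists_iterate_eq_source [Finite ν] (h : IsLinking E s t M) {u : ν}
    (hu : ∀ x, M x ≠ u) : ∃ n, M^[n] u = s := by
  by_contra! hne
  obtain ⟨i, j, hij, heq⟩ := Finite.exists_ne_map_eq_of_infinite fun n => M^[n] u
  wlog hlt : i < j generalizing i j
  · exact this j i hij.symm heq.symm (by omega)
  obtain ⟨d, rfl⟩ : ∃ d, j = i + (d + 1) := ⟨j - i - 1, by omega⟩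
  simp only [Function.iterate_add_apply] at heq
  have := h.iterate_inj heq (hne i)
  rw [Function.iterate_one, ← Function.iterate_succ_apply, Function.iterate_succ_apply'] at this
  exact hu _ this.symm

/-- After cancelling the common number of steps, any steps left over would exhibit one of the two
end nodes as a value of `M`. So the walks back from distinct end nodes meet only in `s`. -/
theorem eq_of_iterate_eq (h : IsLinking E s t M) {u v : ν} (hu : ∀ x, M x ≠ u)
    (hv : ∀ x, M x ≠ v) {i j : ℕ} (hij : M^[i] u = M^[j] v) (hs : M^[i] u ≠ s) : u = v := by
  wlog hle : i ≤ j generalizing i j u v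
  · exact (this hv hu hij.symm (hij ▸ hs) (by omega)).symm
  obtain ⟨d, rfl⟩ := Nat.exists_eq_add_of_le hle
  rw [Function.iterate_add_apply] at hij
  have := h.iterate_inj hij hs
  rcases d with _ | d
  · exact this
  · rw [Function.iterate_succ_apply'] at this
    exact absurd this.symm (hu _)

end IsLinking

/-! ### Flows with unit node capacities and linkings. -/

namespace FlowNetwork

variable {ν : Type*} [Fintype ν] {N : FlowNetwork ν}

/-- A network whose inner nodes have capacity `1`, without edges into the source or out of the
sink. -/
structure IsUnit (N : FlowNetwork ν) : Prop where
  nodeCap : ∀ v, v ≠ N.source → v ≠ N.sink → N.nodeCap v = 1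
  edgeCap : ∀ u v, N.edgeCap u v = ⊤
  not_edge_source : ∀ v, ¬ N.edge v N.source
  not_edge_sink : ∀ v, ¬ N.edge N.sink v

/-- Send one unit along each nontrivial predecessor edge, and one from each node outside the range
of `M` to the sink. An inner node fixed by `M` carries nothing, as injectivity forbids it to precede
another node. Cycles of `M` carry a unit too, but they avoid the source and do not affect the size.
-/
theorem exists_flow_of_isLinking (hN : N.IsUnit) {M : ν → ν}
    (hM : IsLinking N.edge N.source N.sink M) :
    ∃ f, N.IsFlow f ∧ N.flowSize f = linkingSize N.source M := by
  classical
  refine ⟨fun u w => if (u ≠ w ∧ M w = u) ∨ (w = N.sink ∧ ∀ x, M x ≠ u) then 1 else 0,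
    ⟨?_, ?_, ?_⟩, ?_⟩
  · intro u v huv
    refine if_neg ?_
    rintro (⟨h₁, h₂⟩ | ⟨rfl, h⟩)
    · rcases hM.step v with h | h
      · exact h₁ (h₂.symm.trans h)
      · exact huv (h₂ ▸ h)
    · exact huv (hM.exit u h)
  · intro v hs ht
    have hin : (∑ u, if (u ≠ v ∧ M v = u) ∨ (v = N.sink ∧ ∀ x, M x ≠ u) then (1 : ℝ≥0) else 0)
        = if M v = v then 0 else 1 := by
      simp only [ht, false_and, or_false]
      by_cases hv : M v = v
      · rw [if_pos hv]
        refine Finset.sum_eq_zero fun u _ => if_neg ?_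
        rintro ⟨h₁, h₂⟩
        exact h₁ (h₂.symm.trans hv)
      · rw [if_neg hv, Finset.sum_eq_single (M v)]
        · exact if_pos ⟨hv, rfl⟩
        · intro b _ hb
          exact if_neg fun h => hb h.2.symm
        · simp
    have hout : (∑ w, if (v ≠ w ∧ M w = v) ∨ (w = N.sink ∧ ∀ x, M x ≠ v) then (1 : ℝ≥0) else 0)
        = if M v = v then 0 else 1 := by
      by_cases hv : M v = v
      · rw [if_pos hv]
        refine Finset.sum_eq_zero fun w _ => if_neg ?_
        rintro (⟨h₁, h₂⟩ | ⟨_, h⟩)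
        · exact h₁ (hM.inj v w (hv.trans h₂.symm) (by rwa [hv]))
        · exact h v hv
      · rw [if_neg hv]
        by_cases hr : ∃ x, M x = v
        · obtain ⟨x, hx⟩ := hr
          rw [Finset.sum_eq_single x]
          · refine if_pos (Or.inl ⟨?_, hx⟩)
            rintro rfl
            exact hv hx
          · intro w _ hw
            refine if_neg ?_
            rintro (⟨_, h⟩ | ⟨_, h⟩)
            · exact hw (hM.inj w x (h.trans hx.symm) (by rwa [h]))
            · exact h x hx
          · simp
        · push Not at hr
          rw [Finset.sum_eq_single N.sink]
          · exact if_pos (Or.inr ⟨rfl, hr⟩)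
          · intro w _ hw
            refine if_neg ?_
            rintro (⟨_, h⟩ | ⟨h, _⟩)
            · exact hr w h
            · exact hw h
          · simp
    refine ⟨hin.trans hout.symm, ?_⟩
    rw [hout, hN.nodeCap v hs ht]
    split_ifs <;> simp
  · intro u v _
    rw [hN.edgeCap]
    exact le_top
  · have : ∀ w, ((N.source ≠ w ∧ M w = N.source) ∨ (w = N.sink ∧ ∀ x, M x ≠ N.source)) ↔
        (w ≠ N.source ∧ M w = N.source) := by
      intro w
      constructor
      · rintro (⟨h₁, h₂⟩ | ⟨_, h⟩)
        · exact ⟨h₁.symm, h₂⟩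
        · exact absurd hM.source (h _)
      · rintro ⟨h₁, h₂⟩
        exact Or.inl ⟨h₁.symm, h₂⟩
    simp only [flowSize, this, Finset.sum_boole, linkingSize]
    rw [← Set.ncard_coe_finset]
    simp

/-- Put `O = M(X)`, a subset of `X`. Edges that leave `O` end in `X` without the source, so the
outflow of `O` is at most the inflow of `X` without the source, which by conservation is its
outflow. Cancelling the outflow of `O` without the source leaves the flow size on one side, and on
the other the outflow of `X \ O`, at most one unit per node. -/
theorem flowSize_le_of_isAlternatingClosed (hN : N.IsUnit) {M : ν → ν}
    (hM : IsLinking N.edge N.source N.sink M) {X : Set ν}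
    (hX : IsAlternatingClosed N.edge N.source N.sink M X) {f : ν → ν → ℝ≥0} (hf : N.IsFlow f) :
    N.flowSize f ≤ linkingSize N.source M := by
  classical
  obtain ⟨X, rfl⟩ : ∃ Y : Finset ν, X = Y := ⟨X.toFinset, by simp⟩
  obtain ⟨hXs, hXt, hXe, hXm⟩ := hX
  simp only [Finset.mem_coe] at hXs hXt hXe hXm
  have hsrc : ∀ x, M x = N.source → x ∈ X := by
    intro x hx
    rcases hM.step x with h | h
    · rwa [← h, hx]
    · exact hXe _ hXs _ (by rwa [hM.source, ← hx])
  rw [← hM.card_sdiff_image X hsrc hXm]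
  set O := X.image M with hO
  have hOX : O ⊆ X := by
    intro y hy
    obtain ⟨x, hx, rfl⟩ := Finset.mem_image.1 hy
    exact hXm x hx
  have hsO : N.source ∈ O := Finset.mem_image.2 ⟨_, hXs, hM.source⟩
  have h₁ : ∑ u ∈ O, ∑ w, f u w ≤ ∑ w ∈ X.erase N.source, ∑ w', f w w' := by
    calc ∑ u ∈ O, ∑ w, f u w = ∑ u ∈ O, ∑ w ∈ X.erase N.source, f u w := by
          refine Finset.sum_congr rfl fun u hu => (Finset.sum_subset (Finset.subset_univ _) ?_).symm
          intro w _ hw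
          refine hf.1 u w fun he => hw ?_
          obtain ⟨x, hx, rfl⟩ := Finset.mem_image.1 hu
          refine Finset.mem_erase.2 ⟨?_, hXe x hx w he⟩
          rintro rfl
          exact hN.not_edge_source _ he
      _ ≤ ∑ u, ∑ w ∈ X.erase N.source, f u w :=
          Finset.sum_le_sum_of_subset (Finset.subset_univ _)
      _ = ∑ w ∈ X.erase N.source, ∑ u, f u w := Finset.sum_comm
      _ = ∑ w ∈ X.erase N.source, ∑ w', f w w' := by
          refine Finset.sum_congr rfl fun w hw => (hf.2.1 w (Finset.ne_of_mem_erase hw) ?_).1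
          rintro rfl
          exact hXt (Finset.mem_of_mem_erase hw)
  have h₂ : X.erase N.source = O.erase N.source ∪ X \ O := by
    ext x
    have := @hOX x
    simp only [Finset.mem_erase, Finset.mem_union, Finset.mem_sdiff]
    constructor
    · rintro ⟨h, h'⟩
      by_cases hx : x ∈ O
      · exact Or.inl ⟨h, hx⟩
      · exact Or.inr ⟨h', hx⟩
    · rintro (⟨h, h'⟩ | ⟨h, h'⟩)
      · exact ⟨h, this h'⟩
      · exact ⟨fun e => h' (e ▸ hsO), h⟩
  have h₃ : Disjoint (O.erase N.source) (X \ O) :=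
    Finset.disjoint_sdiff.mono_left (Finset.erase_subset _ _)
  rw [h₂, Finset.sum_union h₃, ← Finset.add_sum_erase _ _ hsO, add_comm] at h₁
  refine (le_of_add_le_add_left h₁).trans ?_
  refine (Finset.sum_le_card_nsmul _ _ 1 fun u hu => ?_).trans (by simp)
  obtain ⟨hu, hu'⟩ := Finset.mem_sdiff.1 hu
  have hus : u ≠ N.source := fun e => hu' (e ▸ hsO)
  have hut : u ≠ N.sink := fun e => hXt (e ▸ hu)
  have := (hf.2.1 u hus hut).2
  rw [hN.nodeCap u hus hut] at this
  exact_mod_cast this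

/-- A linking without augmenting path describes a maximum flow. -/
theorem isMaxFlow_of_isAlternatingClosed (hN : N.IsUnit) {M : ν → ν}
    (hM : IsLinking N.edge N.source N.sink M) {X : Set ν}
    (hX : IsAlternatingClosed N.edge N.source N.sink M X) :
    N.IsMaxFlow (linkingSize N.source M) := by
  refine ⟨exists_flow_of_isLinking hN hM, ?_⟩
  rintro _ ⟨f, hf, rfl⟩
  exact flowSize_le_of_isAlternatingClosed hN hM hX hf

end FlowNetwork

/-! ### Half-treks versus linkings of the flow network. -/

namespace MixedGraph

variable {V : Type*} {G : MixedGraph V} {v : V} {A : Set V}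

theorem isUnit_flowNetwork [Finite V] : (G.flowNetwork v A).IsUnit where
  nodeCap := by
    rintro (_ | _ | _ | _) h₁ h₂
    · exact absurd rfl h₁
    · exact absurd rfl h₂
    · rfl
    · rfl
  edgeCap _ _ := rfl
  not_edge_source _ h := nomatch h
  not_edge_sink _ h := nomatch h

/-- Following a linking backwards from a parent of `v` gives a half-trek. -/
theorem exists_halfTrek_of_isLinking [Finite V] {M : FlowNode A → FlowNode A}
    (hM : IsLinking (G.FlowEdge v A) .source .sink M) {p : V}
    (hp : ∀ x, M x ≠ .right p) :
    ∃ π : G.HalfTrek, π.target = p ∧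
      (∃ h : π.source ∈ A, ∃ n, M^[n] (.right p) = .left ⟨π.source, h⟩) ∧
      ∀ w ∈ π.right, ∃ n, M^[n] (.right p) = .right w := by
  by_contra hne
  -- The first step back to a left-hand copy would complete a half-trek. If there is none, the walk
  -- stays among right-hand copies forever, although it must reach the source.
  have key : ∀ j : ℕ, ∃ (h : V) (l : List V), List.IsChain G.dir (h :: l) ∧
      (h :: l).getLast (List.cons_ne_nil _ _) = p ∧
      (∀ w ∈ h :: l, ∃ n, M^[n] (.right p) = .right w) ∧ M^[j] (.right p) = .right h := by
    intro j
    induction j with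
    | zero => exact ⟨p, [], by simp, rfl, by simpa using ⟨0, rfl⟩, rfl⟩
    | succ j ih =>
      obtain ⟨h, l, hl, hlast, hmem, hj⟩ := ih
      rcases hM.step (.right h) with hs | hs
      · exact ⟨h, l, hl, hlast, hmem, by rw [Function.iterate_succ_apply', hj, hs]⟩
      · have hj' : M^[j + 1] (.right p) = M (.right h) := by
          rw [Function.iterate_succ_apply', hj]
        revert hs hj'
        generalize M (.right h) = y
        intro hs hj'
        cases hs with
        | left_right a =>
          exact absurd ⟨⟨a, a, l, Or.inl rfl, hl⟩, hlast, ⟨a.2, _, hj'⟩, hmem⟩ hne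
        | left_sibling a _ hb =>
          exact absurd ⟨⟨a, h, l, Or.inr hb, hl⟩, hlast, ⟨a.2, _, hj'⟩, hmem⟩ hne
        | right_right u _ hd =>
          refine ⟨u, h :: l, List.isChain_cons_cons.2 ⟨hd, hl⟩, by simpa using hlast, ?_, hj'⟩
          intro w hw
          rcases List.mem_cons.1 hw with rfl | hw
          · exact ⟨_, hj'⟩
          · exact hmem w hw
  obtain ⟨n, hn⟩ := hM.exists_iterate_eq_source hp
  obtain ⟨h, _, _, _, _, h'⟩ := key n
  exact nomatch hn.symm.trans h'

/-- A linking of size `|pa(v)|` gives a set that satisfies the half-trek criterion. -/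
theorem halfTrekCriterion_of_isLinking [Finite V] (hA : A ⊆ (insert v (G.sib v))ᶜ)
    {M : FlowNode A → FlowNode A} (hM : IsLinking (G.FlowEdge v A) .source .sink M)
    (hk : linkingSize .source M = (G.pa v).ncard) : ∃ Y ⊆ A, G.HalfTrekCriterion Y v := by
  have hsub : {u | ∀ x, M x ≠ u} ⊆ FlowNode.right '' G.pa v := by
    intro u hu
    have := hM.exit u hu
    cases this with
    | right_sink w hw => exact ⟨w, hw, rfl⟩
  have hinj : Function.Injective (FlowNode.right : V → FlowNode A) := fun x y h => by
    cases h; rfl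
  -- The last nodes of the paths are copies of parents and there are `|pa(v)|` of them, so every
  -- parent ends a path.
  have heq : {u | ∀ x, M x ≠ u} = FlowNode.right '' G.pa v := by
    refine Set.eq_of_subset_of_ncard_le hsub ?_ (Set.toFinite _)
    rw [Set.ncard_image_of_injective _ hinj, hM.card_exits, hk]
  have hex : ∀ p ∈ G.pa v, ∀ x, M x ≠ .right p := by
    intro p hp
    have : FlowNode.right p ∈ {u | ∀ x, M x ≠ u} := heq ▸ ⟨p, hp, rfl⟩
    exact this
  -- A default value for `choose!`, which picks half-treks only for parents.
  have : Nonempty G.HalfTrek := ⟨⟨v, v, [], Or.inl rfl, by simp⟩⟩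
  choose! π htgt hsrc hright using fun p hp => exists_halfTrek_of_isLinking hM (hex p hp)
  have hdisj : ∀ p ∈ G.pa v, ∀ q ∈ G.pa v, ∀ {i j : ℕ} {y : FlowNode A}, y ≠ .source →
      M^[i] (.right p) = y → M^[j] (.right q) = y → p = q := by
    intro p hp q hq i j y hy h₁ h₂
    exact hinj (hM.eq_of_iterate_eq (hex p hp) (hex q hq) (h₁.trans h₂.symm) (by rwa [h₁]))
  have hsinj : Set.InjOn (fun p => (π p).source) (G.pa v) := by
    intro p hp q hq hpq
    obtain ⟨h₁, i, hi⟩ := hsrc p hp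
    obtain ⟨h₂, j, hj⟩ := hsrc q hq
    refine hdisj p hp q hq (by simp) hi (hj.trans ?_)
    congr 2
    exact hpq.symm
  refine ⟨(fun p => (π p).source) '' G.pa v, ?_, ?_, ?_, π '' G.pa v, ⟨⟨?_, ?_, ?_⟩, ?_, ?_, ?_⟩, ?_⟩
  · rintro _ ⟨p, hp, rfl⟩
    exact (hsrc p hp).1
  · exact Set.InjOn.ncard_image hsinj
  · rw [← Set.disjoint_iff_inter_eq_empty, Set.disjoint_left]
    rintro _ ⟨p, hp, rfl⟩
    exact hA (hsrc p hp).1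
  · rintro _ ⟨p, hp, rfl⟩
    exact ⟨p, hp, rfl⟩
  · rintro _ ⟨p, hp, rfl⟩ _ ⟨q, hq, rfl⟩ h
    rw [hsinj hp hq h]
  · rintro _ ⟨p, hp, rfl⟩
    exact ⟨_, ⟨p, hp, rfl⟩, rfl⟩
  · rintro _ ⟨p, hp, rfl⟩
    rw [htgt p hp]
    exact hp
  · rintro _ ⟨p, hp, rfl⟩ _ ⟨q, hq, rfl⟩ h
    rw [htgt p hp, htgt q hq] at h
    rw [h]
  · intro p hp
    exact ⟨_, ⟨p, hp, rfl⟩, htgt p hp⟩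
  · rintro _ ⟨p, hp, rfl⟩ _ ⟨q, hq, rfl⟩ hne
    have hpq : p ≠ q := fun h => hne (h ▸ rfl)
    simp only [← Set.disjoint_iff_inter_eq_empty, Set.disjoint_left]
    constructor
    · intro w hw hw'
      exact hpq (hsinj hp hq ((Eq.symm hw).trans hw'))
    · intro w hw hw'
      obtain ⟨i, hi⟩ := hright p hp w hw
      obtain ⟨j, hj⟩ := hright q hq w hw'
      exact hpq (hdisj p hp q hq (by simp) hi hj)

/-- The right-hand side of a half-trek that starts in an alternating closed set leaves it. -/
theorem exists_exit_of_isChain {M : FlowNode A → FlowNode A} {X : Set (FlowNode A)}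
    (hX : IsAlternatingClosed (G.FlowEdge v A) .source .sink M X) (l : List V) :
    ∀ h : V, List.IsChain G.dir (h :: l) →
      (h :: l).getLast (List.cons_ne_nil _ _) ∈ G.pa v → FlowNode.right h ∈ X →
      ∃ w ∈ h :: l, FlowNode.right w ∈ X \ M '' X := by
  induction l with
  | nil =>
    intro h _ hlast hh
    refine ⟨h, by simp, hh, ?_⟩
    rintro ⟨x, hx, hxh⟩
    -- If the last node were still in the image of `X`, its edge to the sink would bring the sink
    -- into `X`.
    exact hX.sink (hX.edge x hx _ (hxh ▸ .right_sink h hlast))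
  | cons u l ih =>
    intro h hl hlast hh
    obtain ⟨hd, hl⟩ := List.isChain_cons_cons.1 hl
    by_cases hm : FlowNode.right h ∈ M '' X
    · obtain ⟨x, hx, hxh⟩ := hm
      obtain ⟨w, hw, hw'⟩ := ih u hl (by simpa using hlast)
        (hX.edge x hx _ (hxh ▸ .right_right h u hd))
      exact ⟨w, List.mem_cons_of_mem _ hw, hw'⟩
    · exact ⟨h, by simp, hh, hm⟩

/-- Every half-trek meets the cut `X \ M '' X`, either in the left-hand copy of its source or in the
right-hand copy of a node of its right side. The two kinds of copies are different nodes, so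
disjointness of left sides and of right sides is exactly what makes the chosen nodes distinct. -/
theorem ncard_pa_le_of_isAlternatingClosed [Finite V] {M : FlowNode A → FlowNode A}
    (hM : IsLinking (G.FlowEdge v A) .source .sink M) {X : Set (FlowNode A)}
    (hX : IsAlternatingClosed (G.FlowEdge v A) .source .sink M X) {Y : Set V} (hY : Y ⊆ A)
    (hv : G.HalfTrekCriterion Y v) : (G.pa v).ncard ≤ linkingSize .source M := by
  classical
  obtain ⟨_, _, S, ⟨hs, ht⟩, hns⟩ := hv
  have hcross : ∀ π ∈ S, ∃ u ∈ X \ M '' X, (∃ a : A, (a : V) ∈ π.left ∧ u = .left a) ∨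
      ∃ w ∈ π.right, u = .right w := by
    intro π hπ
    have hsA : π.source ∈ A := hY (hs.mapsTo hπ)
    have hLX : FlowNode.left ⟨π.source, hsA⟩ ∈ X := by
      refine hX.edge _ hX.source _ ?_
      rw [hM.source]
      exact .source_left _
    -- The source's copy lies in `X`. Either it is in the cut, or it is in the image of `X`; then
    -- its edges stay in `X`, and the right side, which starts in `X`, has to meet the cut.
    by_cases hm : FlowNode.left ⟨π.source, hsA⟩ ∈ M '' X
    · obtain ⟨x, hx, hxh⟩ := hm
      have hhead : FlowNode.right π.head ∈ X := by
        refine hX.edge x hx _ ?_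
        rw [hxh]
        rcases π.start with h | h
        · rw [h]
          exact .left_right ⟨π.source, hsA⟩
        · exact .left_sibling ⟨π.source, hsA⟩ _ h
      obtain ⟨w, hw, hw'⟩ := exists_exit_of_isChain hX π.tail π.head π.path (ht.mapsTo hπ) hhead
      exact ⟨_, hw', Or.inr ⟨w, hw, rfl⟩⟩
    · exact ⟨_, ⟨hLX, hm⟩, Or.inl ⟨⟨π.source, hsA⟩, rfl, rfl⟩⟩
  have : Nonempty (FlowNode A) := ⟨.source⟩
  choose! u hu hu' using hcross
  have hinj : Set.InjOn u S := by
    intro π hπ ρ hρ hpr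
    by_contra hne
    obtain ⟨h₁, h₂⟩ := hns π hπ ρ hρ hne
    rw [← Set.disjoint_iff_inter_eq_empty, Set.disjoint_left] at h₁ h₂
    rcases hu' π hπ with ⟨a, ha, e⟩ | ⟨w, hw, e⟩ <;> rcases hu' ρ hρ with ⟨b, hb, e'⟩ | ⟨w', hw', e'⟩ <;>
      rw [e, e'] at hpr <;> cases hpr
    · exact h₁ ha hb
    · exact h₂ hw hw'
  have hXm : ∀ x, M x = .source → x ∈ X := by
    intro x hx
    rcases hM.step x with h | h
    · rw [← h, hx]
      exact hX.source
    · exact hX.edge _ hX.source _ (by rwa [hM.source, ← hx])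
  have hcard := hM.card_sdiff_image X.toFinset (by simpa using hXm) (by simpa using hX.mate)
  rw [← hcard, ← ht.image_eq, Set.InjOn.ncard_image ht.injOn, ← Set.ncard_coe_finset]
  refine Set.ncard_le_ncard_of_injOn u ?_ hinj (Set.toFinite _)
  intro π hπ
  simpa using hu π hπ

/-- A maximum linking has the size `|pa(v)|` if and only if the half-trek criterion can be
satisfied within `A`. -/
theorem linkingSize_eq_iff [Finite V] (hA : A ⊆ (insert v (G.sib v))ᶜ)
    {M : FlowNode A → FlowNode A} (hM : IsLinking (G.FlowEdge v A) .source .sink M)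
    {X : Set (FlowNode A)} (hX : IsAlternatingClosed (G.FlowEdge v A) .source .sink M X) :
    linkingSize .source M = (G.pa v).ncard ↔ ∃ Y ⊆ A, G.HalfTrekCriterion Y v := by
  refine ⟨halfTrekCriterion_of_isLinking hA hM, ?_⟩
  rintro ⟨Y, hY, hv⟩
  refine le_antisymm ?_ (ncard_pa_le_of_isAlternatingClosed hM hX hY hv)
  rw [← hM.card_exits]
  have hinj : Function.Injective (FlowNode.right : V → FlowNode A) := fun x y h => by
    cases h; rfl
  rw [← Set.ncard_image_of_injective _ hinj]
  refine Set.ncard_le_ncard ?_ (Set.toFinite _)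
  intro u hu
  have := hM.exit u hu
  cases this with
  | right_sink w hw => exact ⟨w, hw, rfl⟩

/-! ### The greedy construction of an order -/

/-- The nodes of `S` can be solved one after the other. -/
def Solvable (G : MixedGraph V) (S : Set V) : Prop :=
  ∃ (Y : V → Set V) (ρ : V → ℕ), ∀ v ∈ S, G.HalfTrekCriterion (Y v) v ∧
    ∀ w ∈ Y v ∩ G.htr v, w ∈ S ∧ ρ w < ρ v

theorem solvable_of_pa_eq_empty [Finite V] {S : Set V} (hS : ∀ v ∈ S, G.pa v = ∅) :
    G.Solvable S := by
  refine ⟨fun _ => ∅, fun _ => 0, fun v hv => ⟨⟨by simp [hS v hv], by simp, ∅, ?_, ?_⟩, by simp⟩⟩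
  · rw [hS v hv]
    exact ⟨Set.bijOn_empty _, Set.bijOn_empty _⟩
  · intro π hπ
    exact absurd hπ (Set.notMem_empty _)

/-- The set of allowed nodes for `v`, if the nodes of `S` are solved. -/
def allowed (G : MixedGraph V) (S : Set V) (v : V) : Set V :=
  (S ∪ (G.htr v)ᶜ) \ insert v (G.sib v)

/-- The new node is ranked above everything. By the choice of the allowed set, the members of its
set that are half-trek reachable from it already belong to `S`. The data of old nodes refer only to
`S`, so overwriting the values at `v` does no harm. -/
theorem Solvable.insert [Finite V] {S : Set V} (hS : G.Solvable S) (hv : v ∉ S)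
    (h : ∃ Y ⊆ G.allowed S v, G.HalfTrekCriterion Y v) : G.Solvable (insert v S) := by
  classical
  obtain ⟨Y, ρ, hY⟩ := hS
  obtain ⟨Z, hZ, hZv⟩ := h
  obtain ⟨b, hb⟩ := (Set.finite_range ρ).bddAbove
  refine ⟨Function.update Y v Z, Function.update ρ v (b + 1), ?_⟩
  have hne : ∀ u ∈ S, u ≠ v := fun u hu e => hv (e ▸ hu)
  rintro u (rfl | hu)
  · rw [Function.update_self]
    refine ⟨hZv, fun w hw => ?_⟩
    have hwS : w ∈ S := (hZ hw.1).1.resolve_right (not_not.2 hw.2)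
    refine ⟨Or.inr hwS, ?_⟩
    rw [Function.update_of_ne (hne w hwS), Function.update_self]
    exact Nat.lt_succ_of_le (hb ⟨w, rfl⟩)
  · rw [Function.update_of_ne (hne u hu)]
    refine ⟨(hY u hu).1, fun w hw => ?_⟩
    obtain ⟨hwS, hlt⟩ := (hY u hu).2 w hw
    refine ⟨Or.inr hwS, ?_⟩
    rwa [Function.update_of_ne (hne w hwS), Function.update_of_ne (hne u hu)]

/-- Ranks may coincide, so ties are broken by the order of `V`: the lexicographic order is total and
refines the ranks. -/
theorem Solvable.htcIdentifiable [LinearOrder V] (h : G.Solvable Set.univ) :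
    G.HTCIdentifiable := by
  obtain ⟨Y, ρ, hY⟩ := h
  let g : V → ℕ ×ₗ V := fun v => toLex (ρ v, v)
  have hg : Function.Injective g := fun x y h => congrArg (fun p => (ofLex p).2) h
  refine ⟨Y, fun v => (hY v trivial).1, fun w v => g w < g v, ?_, ?_⟩
  · exact { irrefl := fun a => lt_irrefl (g a)
            trans := fun a b c => lt_trans
            trichotomous := fun a b h₁ h₂ =>
              hg (le_antisymm (not_lt.1 h₂) (not_lt.1 h₁)) }
  · intro v w hw
    exact Prod.Lex.toLex_lt_toLex.2 (Or.inl ((hY v trivial).2 w hw).2)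

/-- Otherwise take a minimal node `v` outside `S`. All nodes of `Y v ∩ htr v` precede it and so lie
in `S`; hence `Y v` is allowed, and `v` can be solved after all. -/
theorem HTCIdentifiable.eq_univ [Finite V] (h : G.HTCIdentifiable) {S : Set V}
    (hS : ∀ v ∉ S, ¬ ∃ Y ⊆ G.allowed S v, G.HalfTrekCriterion Y v) : S = Set.univ := by
  obtain ⟨Y, hY, prec, hprec, hlt⟩ := h
  have hwf : WellFounded prec := Finite.wellFounded_of_trans_of_irrefl prec
  by_contra hne
  obtain ⟨v, hv, hmin⟩ := hwf.has_min Sᶜ (Set.nonempty_compl.2 hne)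
  refine hS v hv ⟨Y v, fun w hw => ⟨?_, ?_⟩, hY v⟩
  · by_cases hh : w ∈ G.htr v
    · refine Or.inl ?_
      by_contra hwS
      exact hmin w hwS (hlt v w ⟨hw, hh⟩)
    · exact Or.inr hh
  · intro hw'
    have : w ∈ Y v ∩ Insert.insert v (G.sib v) := ⟨hw, hw'⟩
    rw [(hY v).2.1] at this
    exact this

end MixedGraph

/-! ### Counting reciprocal pairs. -/

/-- A reciprocal pair yields one ascending and one descending edge. The linear order serves only to
tell them apart. -/
theorem two_mul_reciprocalPairs_le {V : Type*} [Finite V] [LinearOrder V] {E : V → V → Prop} :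
    2 * reciprocalPairs E ≤ Set.ncard {e : V × V | E e.1 e.2} := by
  set P := {e : Sym2 V | ∃ v w, e = s(v, w) ∧ v ≠ w ∧ E v w ∧ E w v} with hP
  have hlt : ∀ e ∈ P, e.inf < e.sup ∧ E e.inf e.sup ∧ E e.sup e.inf := by
    rintro _ ⟨v, w, rfl, hne, h₁, h₂⟩
    rcases lt_or_gt_of_ne hne with h | h
    · simp [h.le, h, h₁, h₂]
    · simp [h.le, h, h₁, h₂]
  have hinj : ∀ e ∈ P, ∀ e' ∈ P, e.inf = e'.inf → e.sup = e'.sup → e = e' :=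
    fun e _ e' _ h₁ h₂ => Sym2.inf_eq_inf_and_sup_eq_sup.1 ⟨h₁, h₂⟩
  have h₁ : ((fun e : Sym2 V => (e.inf, e.sup)) '' P).ncard = reciprocalPairs E :=
    Set.InjOn.ncard_image fun e he e' he' h =>
      hinj e he e' he' (congrArg Prod.fst h) (congrArg Prod.snd h)
  have h₂ : ((fun e : Sym2 V => (e.sup, e.inf)) '' P).ncard = reciprocalPairs E :=
    Set.InjOn.ncard_image fun e he e' he' h =>
      hinj e he e' he' (congrArg Prod.snd h) (congrArg Prod.fst h)
  have hd : Disjoint ((fun e : Sym2 V => (e.inf, e.sup)) '' P)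
      ((fun e : Sym2 V => (e.sup, e.inf)) '' P) := by
    rw [Set.disjoint_left]
    rintro _ ⟨e, he, rfl⟩ ⟨e', he', h⟩
    obtain ⟨h₃, h₄⟩ := Prod.mk.inj h
    have h₅ := (hlt e he).1
    have h₆ := (hlt e' he').1
    rw [h₃, h₄] at h₆
    exact lt_asymm h₅ h₆
  rw [two_mul]
  nth_rw 1 [← h₁]
  rw [← h₂, ← Set.ncard_union_eq hd (Set.toFinite _) (Set.toFinite _)]
  refine Set.ncard_le_ncard ?_ (Set.toFinite _)
  rintro _ (⟨e, he, rfl⟩ | ⟨e, he, rfl⟩)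
  · exact (hlt e he).2.1
  · exact (hlt e he).2.2

/-! ## A maximum flow procedure

The procedure keeps a linking, given by its predecessor map, and improves it along alternating
paths, which are found by breadth-first search. -/

namespace RAM

/-- `M` is a linking with `k` paths on the rows below `N`. -/
structure IsRowLinking (N : ℕ) (E : ℕ → ℕ → Prop) (s t : ℕ) (M : ℕ → ℕ) (k : ℕ) : Prop where
  range : ∀ x < N, M x < N
  source : M s = s
  sink : M t = t
  step : ∀ x < N, M x = x ∨ E (M x) x
  inj : ∀ x < N, ∀ y < N, M x = M y → M x ≠ s → x = y
  exit : ∀ u < N, (∀ x < N, M x ≠ u) → E u t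
  card : ((Finset.range N).filter fun x => x ≠ s ∧ M x = s).card = k

/-- A linking that is being changed along an alternating path: the value at `h` is to be
disregarded. -/
structure IsOpenLinking (N : ℕ) (E : ℕ → ℕ → Prop) (s t : ℕ) (M : ℕ → ℕ) (h k : ℕ) : Prop where
  range : ∀ x < N, M x < N
  source : M s = s
  step : ∀ x < N, x ≠ h → M x = x ∨ E (M x) x
  inj : ∀ x < N, ∀ y < N, x ≠ h → y ≠ h → M x = M y → M x ≠ s → x = y
  exit : ∀ u < N, u ≠ t → (∀ x < N, x ≠ h → M x ≠ u) → E u t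
  card : ((Finset.range N).filter fun x => x ≠ h ∧ M x = s).card = k + 1

variable {N s t : ℕ} {E : ℕ → ℕ → Prop} {M : ℕ → ℕ} {k : ℕ}

/-- The source is a row that is never counted. This bounds the number of augmentations. -/
theorem IsRowLinking.size_lt (h : IsRowLinking N E s t M k) (hs : s < N) : k < N := by
  rw [← h.card]
  refine (Finset.card_lt_card (t := Finset.range N) ?_).trans_eq (Finset.card_range N)
  refine Finset.filter_ssubset.2 ⟨s, by simpa using hs, by simp⟩

theorem isRowLinking_of_eq_self (hM : ∀ x < N, M x = x) (hs : s < N)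
    (ht : t < N) : IsRowLinking N E s t M 0 where
  range x hx := by rwa [hM x hx]
  source := hM s hs
  sink := hM t ht
  step x hx := Or.inl (hM x hx)
  inj x hx y hy hxy _ := by rwa [hM x hx, hM y hy] at hxy
  exit u hu h := absurd (hM u hu) (h u hu)
  card := by
    rw [Finset.card_eq_zero, Finset.filter_eq_empty_iff]
    rintro x hx ⟨h₁, h₂⟩
    exact h₁ ((hM x (Finset.mem_range.1 hx)).symm.trans h₂)

/-- The change starts at the sink. The open count includes `s` itself, which is why it is one
larger. -/
theorem IsRowLinking.isOpenLinking (h : IsRowLinking N E s t M k) (hst : s ≠ t) (hs : s < N) :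
    IsOpenLinking N E s t M t k where
  range := h.range
  source := h.source
  step x hx _ := h.step x hx
  inj x hx y hy _ _ := h.inj x hx y hy
  exit u hu hut hx := h.exit u hu fun x hxN => by
    by_cases hxt : x = t
    · rw [hxt, h.sink]
      exact hut.symm
    · exact hx x hxN hxt
  card := by
    rw [← h.card, ← Finset.card_insert_of_notMem (a := s) (by simp)]
    congr 1
    ext x
    simp only [Finset.mem_filter, Finset.mem_range, Finset.mem_insert]
    constructor
    · rintro ⟨h₁, h₂, h₃⟩
      by_cases hx : x = s
      · exact Or.inl hx
      · exact Or.inr ⟨h₁, hx, h₃⟩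
    · rintro (rfl | ⟨h₁, h₂, h₃⟩)
      · exact ⟨hs, hst, h.source⟩
      · refine ⟨h₁, ?_, h₃⟩
        rintro rfl
        exact hst (h₃.symm.trans h.sink)

/-- One step back along the alternating path: `h` takes over the predecessor of `p`, and `p` becomes
the disregarded node. The values that count are the same as before, only with `p` replaced by `h` as
the argument. So injectivity, the exit condition and the count survive, the last one by means of the
transposition of `h` and `p`. -/
theorem IsOpenLinking.move {h p : ℕ} (hM : IsOpenLinking N E s t M h k) (hh : h < N)
    (hp : p < N) (hhs : h ≠ s) (hph : p ≠ h) (he : E (M p) h ∨ M p = h) :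
    IsOpenLinking N E s t (Function.update M h (M p)) p k where
  range x hx := by
    by_cases hxh : x = h
    · rw [hxh, Function.update_self]
      exact hM.range p hp
    · rw [Function.update_of_ne hxh]
      exact hM.range x hx
  source := by rw [Function.update_of_ne hhs.symm, hM.source]
  step x hx hxp := by
    by_cases hxh : x = h
    · rw [hxh, Function.update_self]
      exact he.symm
    · rw [Function.update_of_ne hxh]
      exact hM.step x hx hxh
  inj x hx y hy hxp hyp := by
    by_cases hxh : x = h <;> by_cases hyh : y = h
    · exact fun _ _ => hxh.trans hyh.symm
    · rw [hxh, Function.update_self, Function.update_of_ne hyh]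
      exact fun h₁ h₂ => absurd (hM.inj p hp y hy hph hyh h₁ h₂) (Ne.symm hyp)
    · rw [hyh, Function.update_self, Function.update_of_ne hxh]
      exact fun h₁ h₂ => absurd (hM.inj x hx p hp hxh hph h₁ h₂) hxp
    · rw [Function.update_of_ne hxh, Function.update_of_ne hyh]
      exact hM.inj x hx y hy hxh hyh
  exit u hu hut hx := hM.exit u hu hut fun x hxN hxh => by
    by_cases hxp : x = p
    · have := hx h hh hph.symm
      rwa [Function.update_self, ← hxp] at this
    · have := hx x hxN hxp
      rwa [Function.update_of_ne hxh] at this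
  card := by
    rw [← hM.card]
    refine Finset.card_bij' (fun x _ => Equiv.swap h p x) (fun x _ => Equiv.swap h p x)
      ?_ ?_ (by simp) (by simp)
    · intro x hx
      simp only [Finset.mem_filter, Finset.mem_range] at hx ⊢
      obtain ⟨h₁, h₂, h₃⟩ := hx
      by_cases hxh : x = h
      · rw [hxh, Function.update_self] at h₃
        rw [hxh, Equiv.swap_apply_left]
        exact ⟨hp, hph, h₃⟩
      · rw [Function.update_of_ne hxh] at h₃
        rw [Equiv.swap_apply_of_ne_of_ne hxh h₂]
        exact ⟨h₁, hxh, h₃⟩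
    · intro x hx
      simp only [Finset.mem_filter, Finset.mem_range] at hx ⊢
      obtain ⟨h₁, h₂, h₃⟩ := hx
      by_cases hxp : x = p
      · rw [hxp, Equiv.swap_apply_right, Function.update_self]
        exact ⟨hh, hph.symm, hxp ▸ h₃⟩
      · rw [Equiv.swap_apply_of_ne_of_ne h₂ hxp, Function.update_of_ne h₂]
        exact ⟨h₁, hxp, h₃⟩

/-- Once `s` is the disregarded node it drops out of the count, so `k + 1` genuine first nodes
remain. Resetting `t` frees its predecessor, which becomes the last node of a path. As `s → t` is
not an edge, no first node is lost; as `t` has no outgoing edges, no other node has `t` as its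
predecessor. -/
theorem IsOpenLinking.close (hM : IsOpenLinking N E s t M s k) (hst : s ≠ t) (ht : t < N)
    (hE : ¬ E s t) (hEt : ∀ x, ¬ E t x) :
    IsRowLinking N E s t (Function.update M t t) (k + 1) where
  range x hx := by
    by_cases hxt : x = t
    · rw [hxt, Function.update_self]
      exact ht
    · rw [Function.update_of_ne hxt]
      exact hM.range x hx
  source := by rw [Function.update_of_ne hst, hM.source]
  sink := Function.update_self ..
  step x hx := by
    by_cases hxt : x = t
    · rw [hxt, Function.update_self]
      exact Or.inl rfl
    · rw [Function.update_of_ne hxt]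
      by_cases hxs : x = s
      · rw [hxs, hM.source]
        exact Or.inl rfl
      · exact hM.step x hx hxs
  inj x hx y hy := by
    have key : ∀ z < N, z ≠ t → M z ≠ t := by
      intro z hz hzt hMz
      by_cases hzs : z = s
      · rw [hzs, hM.source] at hMz
        exact hst hMz
      · rcases hM.step z hz hzs with h | h
        · exact hzt (h.symm.trans hMz)
        · rw [hMz] at h
          exact hEt _ h
    by_cases hxt : x = t <;> by_cases hyt : y = t
    · exact fun _ _ => hxt.trans hyt.symm
    · rw [hxt, Function.update_self, Function.update_of_ne hyt]
      exact fun h _ => absurd h.symm (key y hy hyt)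
    · rw [hyt, Function.update_self, Function.update_of_ne hxt]
      exact fun h _ => absurd h (key x hx hxt)
    · rw [Function.update_of_ne hxt, Function.update_of_ne hyt]
      intro h hne
      have hxs : x ≠ s := fun e => hne (by rw [e, hM.source])
      have hys : y ≠ s := fun e => hne (by rw [h, e, hM.source])
      exact hM.inj x hx y hy hxs hys h hne
  exit u hu hx := by
    have hut : u ≠ t := by
      rintro rfl
      exact hx u ht (Function.update_self ..)
    by_cases hMt : M t = u
    · rcases hM.step t ht hst.symm with h | h
      · exact absurd (hMt.symm.trans h) hut
      · rwa [hMt] at h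
    · refine hM.exit u hu hut fun x hxN _ => ?_
      by_cases hxt : x = t
      · rwa [hxt]
      · have := hx x hxN
        rwa [Function.update_of_ne hxt] at this
  card := by
    rw [← hM.card]
    congr 1
    ext x
    simp only [Finset.mem_filter, Finset.mem_range]
    refine and_congr_right fun hx => and_congr_right fun hxs => ?_
    by_cases hxt : x = t
    · rw [hxt, Function.update_self]
      refine ⟨fun h => absurd h.symm hst, fun h => ?_⟩
      rcases hM.step t ht hst.symm with h' | h'
      · exact absurd (h.symm.trans h') hst
      · rw [h] at h'
        exact absurd h' hE
    · rw [Function.update_of_ne hxt]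

/-- The state of the search for an alternating path: `q` lists the `n` nodes found so far,
`pos x - 1` is the place of `x` in this list, and `link i` is the place of the predecessor of
`q i` in the search tree. -/
structure IsSearch (N : ℕ) (E : ℕ → ℕ → Prop) (s : ℕ) (M pos q link : ℕ → ℕ) (n : ℕ) : Prop where
  nonempty : 0 < n
  source : q 0 = s
  mem : ∀ i < n, q i < N ∧ pos (q i) = i + 1
  pos : ∀ x < N, pos x ≠ 0 → pos x ≤ n ∧ q (pos x - 1) = x
  link : ∀ i < n, 0 < i → link i < i ∧ (E (M (q (link i))) (q i) ∨ M (q (link i)) = q i)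

variable {pos q link : ℕ → ℕ} {n : ℕ}

/-- The stored positions invert the queue, so it has no repetitions. -/
theorem IsSearch.le (h : IsSearch N E s M pos q link n) : n ≤ N := by
  have := Finset.card_le_card_of_injOn (s := Finset.range n) (t := Finset.range N) q
    (fun i hi => by simpa using (h.mem i (by simpa using hi)).1) (by
      intro i hi j hj hij
      have h₁ := (h.mem i (by simpa using hi)).2
      have h₂ := (h.mem j (by simpa using hj)).2
      rw [hij] at h₁
      omega)
  simpa using this

theorem isSearch_init (hs : s < N) (hpos : ∀ x < N, x ≠ s → pos x = 0) (hpos' : pos s = 1)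
    (hq : q 0 = s) : IsSearch N E s M pos q link 1 where
  nonempty := one_pos
  source := hq
  mem i hi := by
    obtain rfl : i = 0 := by omega
    rw [hq]
    exact ⟨hs, hpos'⟩
  pos x hx h := by
    by_cases hxs : x = s
    · rw [hxs, hpos']
      exact ⟨le_rfl, hq⟩
    · exact absurd (hpos x hx hxs) h
  link i hi h := by omega

theorem IsSearch.push {pos' q' link' : ℕ → ℕ} {x i : ℕ} (h : IsSearch N E s M pos q link n)
    (hx : x < N) (hxp : pos x = 0) (hi : i < n) (he : E (M (q i)) x ∨ M (q i) = x)
    (hpos : pos' = Function.update pos x (n + 1)) (hq : q' = Function.update q n x)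
    (hlink : link' = Function.update link n i) : IsSearch N E s M pos' q' link' (n + 1) := by
  have hne : ∀ j < n, q j ≠ x := by
    rintro j hj rfl
    have := (h.mem j hj).2
    omega
  have hq' : ∀ j < n, q' j = q j := fun j hj => by
    rw [hq, Function.update_of_ne (by omega)]
  have hqn : q' n = x := by rw [hq, Function.update_self]
  refine ⟨by omega, by rw [hq' 0 h.nonempty, h.source], fun j hj => ?_, fun y hy hyp => ?_,
    fun j hj hj0 => ?_⟩
  · rcases Nat.lt_succ_iff_lt_or_eq.1 hj with hj | rfl
    · rw [hq' j hj, hpos, Function.update_of_ne (hne j hj)]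
      exact h.mem j hj
    · rw [hqn, hpos, Function.update_self]
      exact ⟨hx, rfl⟩
  · by_cases hyx : y = x
    · rw [hyx, hpos, Function.update_self]
      exact ⟨le_rfl, hqn⟩
    · rw [hpos, Function.update_of_ne hyx] at hyp ⊢
      obtain ⟨h₁, h₂⟩ := h.pos y hy hyp
      refine ⟨by omega, ?_⟩
      rw [hq' _ (by omega), h₂]
  · rcases Nat.lt_succ_iff_lt_or_eq.1 hj with hj | rfl
    · rw [hlink, Function.update_of_ne (by omega), hq' j hj]
      obtain ⟨h₁, h₂⟩ := h.link j hj hj0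
      rw [hq' _ (by omega)]
      exact ⟨h₁, h₂⟩
    · rw [hlink, Function.update_self, hqn, hq' i hi]
      exact ⟨hi, he⟩

end RAM

/-! ### The flow procedure as a program, and its breadth-first search. -/

namespace HTCAlgorithm

open RAM RAM.Cmd

/-- The place in the queue of the node that is being scanned. -/
abbrev rHead : ℕ := 12
/-- A row of the flow network. -/
abbrev rNode : ℕ := 13
/-- The length of the queue. -/
abbrev rTail : ℕ := 14
/-- The place in the queue of the current node of the alternating path. -/
abbrev rPlace : ℕ := 15
/-- A counter. -/
abbrev rStep : ℕ := 16
/-- Whether an alternating path has been found. -/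
abbrev rFound : ℕ := 17
/-- The predecessor of the node that is being scanned. -/
abbrev rMate : ℕ := 18
/-- The predecessor map of the linking. -/
abbrev aMate : ℕ := 6
/-- The places in the queue, increased by `1`, of the nodes. -/
abbrev aPos : ℕ := 7
/-- The queue. -/
abbrev aQueue : ℕ := 8
/-- The predecessors in the search tree, as places in the queue. -/
abbrev aLink : ℕ := 9

/-- Append the node in `rNode` to the queue. -/
def pushNode : Cmd :=
  .block [setMem aQueue rTail (.reg rNode), setMem aLink rTail (.reg rHead),
    .assign rTail (.add (.reg rTail) (.lit 1)), setMem aPos rNode (.reg rTail)]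

/-- Visit the neighbours of the node in place `rHead`. -/
def scanNode : Cmd :=
  .block [.assign rMate (.get aMate (.lit 0) (mem aQueue rHead)),
    .forBelow rNode rSize (.when (.eq (mem aPos rNode) (.lit 0))
      (.when (.add (.get aNet (.reg rMate) (.reg rNode)) (.eq (.reg rMate) (.reg rNode)))
        pushNode))]

/-- Find all nodes that can be reached by alternating paths. -/
def searchPath : Cmd :=
  .block [
    .forBelow rNode rSize (setMem aPos rNode (.lit 0)),
    .put aQueue (.lit 0) (.lit 0) (.reg rSource),
    setMem aPos rSource (.lit 1),
    .assign rTail (.lit 1),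
    .forBelow rHead rSize (.when (.lt (.reg rHead) (.reg rTail)) scanNode)]

/-- Change the linking at the node in place `rPlace`, and go to its predecessor in the search
tree. -/
def moveBack : Cmd :=
  .block [
    .put aMate (.lit 0) (mem aQueue rPlace)
      (.get aMate (.lit 0) (.get aQueue (.lit 0) (mem aLink rPlace))),
    .assign rPlace (mem aLink rPlace)]

/-- Change the linking along the alternating path to the sink, if there is one. -/
def augment : Cmd :=
  .block [
    .assign rPlace (.sub (mem aPos rSink) (.lit 1)),
    .forBelow rStep rSize (.when (.lt (.lit 0) (.reg rPlace)) moveBack),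
    setMem aMate rSink (.reg rSink)]

/-- A maximum flow procedure for networks with node capacities `1`. -/
def unitMaxFlow : Cmd :=
  .block [
    .assign rFlow (.lit 0),
    .forBelow rNode rSize (setMem aMate rNode (.reg rNode)),
    .assign rFound (.lit 1),
    .loop (.reg rFound) (.block [
      searchPath,
      augment,
      .assign rFlow (.add (.reg rFlow) (.lt (.lit 0) (mem aPos rSink))),
      .assign rFound (mem aPos rSink)])]

/-- The memory holds a network with `N` rows and the edges `E`. -/
structure HoldsRows (N : ℕ) (E : ℕ → ℕ → Prop) (s t : ℕ) (σ : Memory) : Prop where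
  size : σ.reg rSize = N
  source : σ.reg rSource = s
  sink : σ.reg rSink = t
  edge : ∀ i < N, ∀ j < N, σ.arr aNet i j ≠ 0 ↔ E i j

theorem HoldsRows.congr {N s t : ℕ} {E : ℕ → ℕ → Prop} {σ τ : Memory} (h : HoldsRows N E s t σ)
    (h₁ : τ.reg rSize = σ.reg rSize) (h₂ : τ.reg rSource = σ.reg rSource)
    (h₃ : τ.reg rSink = σ.reg rSink) (h₄ : τ.arr aNet = σ.arr aNet) : HoldsRows N E s t τ := by
  refine ⟨h₁.trans h.size, h₂.trans h.source, h₃.trans h.sink, ?_⟩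
  rw [h₄]
  exact h.edge

variable {N s t : ℕ} {E : ℕ → ℕ → Prop}

/-- The length is raised before the position is written, so positions are shifted by `1` and `0`
keeps meaning "not found". -/
theorem wp_pushNode {σ : Memory} {Q : ℕ → Memory → Prop}
    (h : ∀ τ : Memory, τ.reg rTail = σ.reg rTail + 1 →
      τ.arr aPos 0 = Function.update (σ.arr aPos 0) (σ.reg rNode) (σ.reg rTail + 1) →
      τ.arr aQueue 0 = Function.update (σ.arr aQueue 0) (σ.reg rTail) (σ.reg rNode) →
      τ.arr aLink 0 = Function.update (σ.arr aLink 0) (σ.reg rTail) (σ.reg rHead) →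
      Q 17 τ) : wp pushNode σ Q := by
  simp only [pushNode, wp_block_cons, wp_block_nil, wp_put, wp_assign, Expr.cost, Expr.eval]
  refine h _ (by simp) ?_ ?_ ?_ <;> · funext l; simp [Function.update_apply]

/-- From `x` an alternating path goes on to a successor of `M x` or to `M x` itself, the two closure
conditions of `IsAlternatingClosed`. Found nodes stay found and the queue up to place `h` is
untouched, so what is known of earlier places persists. -/
theorem wp_scanNode {σ : Memory} (hσ : HoldsRows N E s t σ) {h : ℕ} (hh : σ.reg rHead = h)
    (hM : ∀ x < N, σ.arr aMate 0 x < N) (hlt : h < σ.reg rTail)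
    (hS : IsSearch N E s (σ.arr aMate 0) (σ.arr aPos 0) (σ.arr aQueue 0) (σ.arr aLink 0)
      (σ.reg rTail)) :
    wp scanNode σ fun T τ => T ≤ N * 100 + 20 ∧ Frame scanNode σ τ ∧ h < τ.reg rTail ∧
      IsSearch N E s (σ.arr aMate 0) (τ.arr aPos 0) (τ.arr aQueue 0) (τ.arr aLink 0)
        (τ.reg rTail) ∧
      (∀ x < N, σ.arr aPos 0 x ≠ 0 → τ.arr aPos 0 x ≠ 0) ∧
      (∀ i ≤ h, τ.arr aQueue 0 i = σ.arr aQueue 0 i) ∧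
      ∀ x < N, E (σ.arr aMate 0 (σ.arr aQueue 0 h)) x ∨ σ.arr aMate 0 (σ.arr aQueue 0 h) = x →
        τ.arr aPos 0 x ≠ 0 := by
  have hu := hM _ (hS.mem h hlt).1
  suffices H : wp scanNode σ fun T τ => T ≤ N * 100 + 20 ∧ h < τ.reg rTail ∧
      IsSearch N E s (σ.arr aMate 0) (τ.arr aPos 0) (τ.arr aQueue 0) (τ.arr aLink 0)
        (τ.reg rTail) ∧
      (∀ x < N, σ.arr aPos 0 x ≠ 0 → τ.arr aPos 0 x ≠ 0) ∧
      (∀ i ≤ h, τ.arr aQueue 0 i = σ.arr aQueue 0 i) ∧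
      ∀ x < N, E (σ.arr aMate 0 (σ.arr aQueue 0 h)) x ∨ σ.arr aMate 0 (σ.arr aQueue 0 h) = x →
        τ.arr aPos 0 x ≠ 0 by
    exact H.frame.mono fun T τ ⟨⟨h₁, h₂⟩, h₃⟩ => ⟨h₁, h₃, h₂⟩
  generalize hMe : σ.arr aMate 0 = M at *
  generalize hQe : σ.arr aQueue 0 = Q at *
  generalize hPe : σ.arr aPos 0 = P at *
  simp only [scanNode, wp_block_cons, wp_block_nil, wp_assign, Expr.cost, Expr.eval, hh, hMe, hQe]
  refine wp.mono (wp_forBelow_frame N 60 (fun k τ => h < τ.reg rTail ∧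
    IsSearch N E s M (τ.arr aPos 0) (τ.arr aQueue 0) (τ.arr aLink 0) (τ.reg rTail) ∧
    (∀ x < N, P x ≠ 0 → τ.arr aPos 0 x ≠ 0) ∧ (∀ i ≤ h, τ.arr aQueue 0 i = Q i) ∧
    ∀ x < k, E (M (Q h)) x ∨ M (Q h) = x → τ.arr aPos 0 x ≠ 0) (by decide) (by rfl) (by rfl)
    hσ.size ⟨hlt, by simpa [hPe, hQe] using hS, by simp [hPe], by simp [hQe], by simp⟩ ?_) ?_
  · rintro k hk τ hτk hF ⟨h₁, h₂, h₃, h₄, h₅⟩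
    have hmate : τ.reg rMate = M (Q h) := hF.1 rMate rfl
    have hhead : τ.reg rHead = h := (hF.1 rHead rfl).trans hh
    have hnet : τ.arr aNet = σ.arr aNet := hF.2 aNet rfl
    have hE : τ.arr aNet (M (Q h)) k ≠ 0 ↔ E (M (Q h)) k := by
      rw [hnet]
      exact hσ.edge _ hu k hk
    simp only [wp_when, Expr.eval, Expr.cost, hτk, hmate]
    have hsucc : ∀ (p : ℕ → ℕ), (∀ x < k, E (M (Q h)) x ∨ M (Q h) = x → p x ≠ 0) →
        (E (M (Q h)) k ∨ M (Q h) = k → p k ≠ 0) →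
        ∀ x < k + 1, E (M (Q h)) x ∨ M (Q h) = x → p x ≠ 0 := by
      intro p hp hp' x hx
      rcases Nat.lt_succ_iff_lt_or_eq.1 hx with hx | rfl
      · exact hp x hx
      · exact hp'
    refine ⟨fun hb => ⟨fun hb' => ?_, fun hb' => ⟨by omega, h₁, h₂, h₃, h₄,
      hsucc _ h₅ fun he => ?_⟩⟩, fun hb => ⟨by omega, h₁, h₂, h₃, h₄, hsucc _ h₅ fun _ => ?_⟩⟩
    · have hp0 : τ.arr aPos 0 k = 0 := by
        by_contra hne
        simp [hne] at hb
      have he : E (M (Q h)) k ∨ M (Q h) = k := by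
        by_contra hne
        push Not at hne
        have hz : τ.arr aNet (M (Q h)) k = 0 := not_not.1 (mt hE.1 hne.1)
        simp [hz, hne.2] at hb'
      refine wp_pushNode fun ρ hρ₁ hρ₂ hρ₃ hρ₄ => ⟨by omega, ?_⟩
      rw [hτk] at hρ₂ hρ₃
      rw [hhead] at hρ₄
      have hS' := h₂.push hk hp0 h₁ (by rwa [h₄ h le_rfl]) hρ₂ hρ₃ hρ₄
      have hmono : ∀ x, τ.arr aPos 0 x ≠ 0 → ρ.arr aPos 0 x ≠ 0 := by
        intro x hx
        rw [hρ₂]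
        by_cases hxk : x = k
        · simp [hxk]
        · rwa [Function.update_of_ne hxk]
      have hρ₁' : Function.update ρ.reg rNode (k + 1) rTail = τ.reg rTail + 1 := hρ₁
      refine ⟨?_, ?_, fun x hx hx' => hmono x (h₃ x hx hx'), fun i hi => ?_,
        hsucc _ (fun x hx hx' => hmono x (h₅ x hx hx')) fun _ => ?_⟩
      · rw [hρ₁']
        omega
      · rw [hρ₁']
        exact hS'
      · have : i ≠ τ.reg rTail := by omega
        simp only [hρ₃, Function.update_of_ne this]
        exact h₄ i hi
      · simp [hρ₂]
    · have h₀ : τ.arr aNet (M (Q h)) k = 0 ∧ M (Q h) ≠ k := by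
        by_cases hc : M (Q h) = k
        · simp [hc] at hb'
        · simpa [hc] using hb'
      rcases he with he | he
      · exact absurd h₀.1 (hE.2 he)
      · exact absurd he h₀.2
    · intro hne
      simp [hne] at hb
  · rintro T τ ⟨hT, ⟨h₁, h₂, h₃, h₄, h₅⟩, _⟩
    exact ⟨by omega, h₁, h₂, h₃, h₄, h₅⟩

/-- A `for` loop over all `N` places replaces the usual loop until the queue is empty: rounds beyond
its end do nothing, and the queue never has more than `N` entries. So in the end every found node
has been scanned, and the found nodes form a closed set. -/
theorem wp_searchPath {σ : Memory} (hσ : HoldsRows N E s t σ) (hs : s < N)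
    (hM : ∀ x < N, σ.arr aMate 0 x < N) :
    wp searchPath σ fun T τ => T ≤ N * (N * 100 + 100) + 50 ∧ Frame searchPath σ τ ∧
      IsSearch N E s (σ.arr aMate 0) (τ.arr aPos 0) (τ.arr aQueue 0) (τ.arr aLink 0)
        (τ.reg rTail) ∧
      ∀ x < N, τ.arr aPos 0 x ≠ 0 → ∀ y < N, E (σ.arr aMate 0 x) y ∨ σ.arr aMate 0 x = y →
        τ.arr aPos 0 y ≠ 0 := by
  suffices H : wp searchPath σ fun T τ => T ≤ N * (N * 100 + 100) + 50 ∧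
      IsSearch N E s (σ.arr aMate 0) (τ.arr aPos 0) (τ.arr aQueue 0) (τ.arr aLink 0)
        (τ.reg rTail) ∧
      ∀ x < N, τ.arr aPos 0 x ≠ 0 → ∀ y < N, E (σ.arr aMate 0 x) y ∨ σ.arr aMate 0 x = y →
        τ.arr aPos 0 y ≠ 0 by
    exact H.frame.mono fun T τ ⟨⟨h₁, h₂⟩, h₃⟩ => ⟨h₁, h₃, h₂⟩
  generalize hMe : σ.arr aMate 0 = M at *
  simp only [searchPath, wp_block_cons, wp_block_nil, wp_assign, wp_put, Expr.cost, Expr.eval]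
  refine wp.mono (wp_forBelow_frame N 4 (fun k τ => ∀ x < k, τ.arr aPos 0 x = 0) (by decide)
    (by rfl) (by rfl) hσ.size (by simp) ?_) ?_
  · rintro k hk τ hτk - hI
    simp only [wp_put, Expr.cost, Expr.eval, hτk]
    refine ⟨by omega, fun x hx => ?_⟩
    rcases Nat.lt_succ_iff_lt_or_eq.1 hx with hx | rfl
    · simp [hI x hx]
    · simp
  rintro T₀ τ₀ ⟨hT₀, hpos, hF₀⟩
  have hsrc : τ₀.reg rSource = s := (hF₀.1 _ rfl).trans hσ.source
  refine wp.mono (wp_forBelow_frame N (N * 100 + 25) (fun h τ =>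
    IsSearch N E s M (τ.arr aPos 0) (τ.arr aQueue 0) (τ.arr aLink 0) (τ.reg rTail) ∧
    ∀ i < h, i < τ.reg rTail → ∀ y < N, E (M (τ.arr aQueue 0 i)) y ∨ M (τ.arr aQueue 0 i) = y →
        τ.arr aPos 0 y ≠ 0) (by decide) (by rfl) (by rfl) ?_ ⟨?_, by simp⟩ ?_) ?_
  · exact (hF₀.1 rSize rfl).trans hσ.size
  · refine isSearch_init hs (fun x hx hxs => ?_) ?_ ?_
    · simp [hsrc, hxs, hpos x hx]
    · simp [hsrc]
    · simp [hsrc]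
  · rintro h hh τ hτh hF ⟨hS, hcl⟩
    have hτ : HoldsRows N E s t τ := hσ.congr
      ((hF.1 rSize rfl).trans (hF₀.1 rSize rfl)) ((hF.1 rSource rfl).trans (hF₀.1 rSource rfl))
      ((hF.1 rSink rfl).trans (hF₀.1 rSink rfl)) ((hF.2 aNet rfl).trans (hF₀.2 aNet rfl))
    have hτM : τ.arr aMate 0 = M := by
      rw [← hMe, ← hF₀.2 aMate rfl]
      exact congrFun (hF.2 aMate rfl) 0
    simp only [wp_when, Expr.cost, Expr.eval, hτh]
    refine ⟨fun hb => ?_, fun hb => ⟨by omega, hS, fun i hi hi' => ?_⟩⟩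
    · have hlt : h < τ.reg rTail := by
        by_contra hlt
        simp [hlt] at hb
      refine (wp_scanNode hτ hτh (by rwa [hτM]) hlt (by rwa [hτM])).mono ?_
      rintro T ρ ⟨hT, -, h₁, h₂, h₃, h₄, h₅⟩
      rw [hτM] at h₂ h₅
      refine ⟨by omega, h₂, fun i hi _ => ?_⟩
      rw [h₄ i (by omega)]
      rcases Nat.lt_succ_iff_lt_or_eq.1 hi with hi | rfl
      · exact fun y hy he => h₃ y hy (hcl i hi (by omega) y hy he)
      · exact h₅
    · have hlt : ¬ h < τ.reg rTail := by
        intro hlt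
        simp [hlt] at hb
      have hi'' : i < τ.reg rTail := hi'
      exact hcl i (by omega) hi''
  · rintro T τ ⟨hT, ⟨hS, hcl⟩, -⟩
    refine ⟨?_, hS, fun x hx hxp y hy he => ?_⟩
    · have : N * (N * 100 + 25 + 9) + N * 13 ≤ N * (N * 100 + 100) := by
        rw [← Nat.mul_add]
        exact Nat.mul_le_mul_left _ (by omega)
      omega
    · obtain ⟨h₁, h₂⟩ := hS.pos x hx hxp
      have := hS.le
      have h₃ := hcl (τ.arr aPos 0 x - 1) (by omega) (by omega) y hy
      rw [h₂] at h₃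
      exact h₃ he

end HTCAlgorithm

namespace RAM

variable {N s t : ℕ} {E : ℕ → ℕ → Prop} {M pos q link : ℕ → ℕ} {n : ℕ}

theorem IsSearch.queue_ne (h : IsSearch N E s M pos q link n) {i j : ℕ} (hi : i < n) (hj : j < n)
    (hij : i ≠ j) : q i ≠ q j := by
  intro he
  have h₁ := (h.mem i hi).2
  have h₂ := (h.mem j hj).2
  rw [he] at h₁
  omega

end RAM

/-! ### Augmentation along the search tree. -/

namespace HTCAlgorithm

open RAM RAM.Cmd

variable {N s t : ℕ} {E : ℕ → ℕ → Prop}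

theorem wp_moveBack {σ : Memory} {Q : ℕ → Memory → Prop}
    (h : ∀ τ : Memory, τ.reg rPlace = σ.arr aLink 0 (σ.reg rPlace) →
      τ.arr aMate 0 = Function.update (σ.arr aMate 0) (σ.arr aQueue 0 (σ.reg rPlace))
        (σ.arr aMate 0 (σ.arr aQueue 0 (σ.arr aLink 0 (σ.reg rPlace)))) →
      Q 17 τ) : wp moveBack σ Q := by
  simp only [moveBack, wp_block_cons, wp_block_nil, wp_put, wp_assign, Expr.cost, Expr.eval]
  refine h _ (by simp) ?_
  funext l
  simp [Function.update_apply]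

/-- The tree path is followed from the sink back to place `0`, the source, by one
`IsOpenLinking.move` per step. If the sink was not found, truncated subtraction yields place `0`,
the loop is idle, and the final assignment writes a value that is already there. -/
theorem wp_augment {σ : Memory} (hσ : HoldsRows N E s t σ) {k n : ℕ} (hst : s ≠ t) (ht : t < N)
    (hEst : ¬ E s t) (hEt : ∀ x, ¬ E t x)
    (hS : IsSearch N E s (σ.arr aMate 0) (σ.arr aPos 0) (σ.arr aQueue 0) (σ.arr aLink 0) n)
    (hM : IsRowLinking N E s t (σ.arr aMate 0) k) :
    wp augment σ fun T τ => T ≤ N * 40 + 30 ∧ Frame augment σ τ ∧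
      (σ.arr aPos 0 t = 0 → τ.arr aMate 0 = σ.arr aMate 0) ∧
      (σ.arr aPos 0 t ≠ 0 → IsRowLinking N E s t (τ.arr aMate 0) (k + 1)) := by
  suffices H : wp augment σ fun T τ => T ≤ N * 40 + 30 ∧
      (σ.arr aPos 0 t = 0 → τ.arr aMate 0 = σ.arr aMate 0) ∧
      (σ.arr aPos 0 t ≠ 0 → IsRowLinking N E s t (τ.arr aMate 0) (k + 1)) by
    exact H.frame.mono fun T τ ⟨⟨h₁, h₂⟩, h₃⟩ => ⟨h₁, h₃, h₂⟩
  generalize hMe : σ.arr aMate 0 = M at *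
  generalize hQe : σ.arr aQueue 0 = Q at *
  generalize hPe : σ.arr aPos 0 = P at *
  generalize hLe : σ.arr aLink 0 = L at *
  simp only [augment, wp_block_cons, wp_block_nil, wp_assign, wp_put, Expr.cost, Expr.eval, hPe,
    hσ.sink]
  -- Links go to strictly smaller places, so `N` rounds are enough. Places up to the current one
  -- still carry the original predecessors, hence the tree conditions, which refer to the original
  -- linking, remain applicable.
  refine wp.mono (wp_forBelow_frame N 25 (fun j τ =>
    (P t = 0 → τ.reg rPlace = 0 ∧ τ.arr aMate 0 = M) ∧
    (P t ≠ 0 → (τ.reg rPlace = 0 ∨ τ.reg rPlace + j < N) ∧ τ.reg rPlace < n ∧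
      IsOpenLinking N E s t (τ.arr aMate 0) (Q (τ.reg rPlace)) k ∧
      ∀ l ≤ τ.reg rPlace, τ.arr aMate 0 (Q l) = M (Q l))) (by decide) (by rfl) (by rfl)
    hσ.size ⟨fun h => ?_, fun h => ?_⟩ ?_) ?_
  · simp [h, hMe]
  · obtain ⟨h₁, h₂⟩ := hS.pos t ht h
    have := hS.le
    refine ⟨Or.inr ?_, ?_, ?_, fun l _ => by rw [hMe]⟩
    · simp; omega
    · simp; omega
    · have e : Function.update (Function.update σ.reg rPlace (P t - 1)) rStep 0 rPlace
          = P t - 1 := rfl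
      simp only [e, hMe, h₂]
      exact hM.isOpenLinking hst (hS.source ▸ (hS.mem 0 hS.nonempty).1)
  · rintro j hj τ hτj hF ⟨hI₁, hI₂⟩
    have hτL : τ.arr aLink 0 = L := by rw [← hLe]; exact congrFun (hF.2 aLink rfl) 0
    have hτQ : τ.arr aQueue 0 = Q := by rw [← hQe]; exact congrFun (hF.2 aQueue rfl) 0
    simp only [wp_when, Expr.cost, Expr.eval]
    refine ⟨fun hb => wp_moveBack fun ρ hρ₁ hρ₂ => ⟨by omega, fun h => ?_, fun h => ?_⟩,
      fun hb => ⟨by omega, hI₁, fun h => ?_⟩⟩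
    · simp [(hI₁ h).1] at hb
    · obtain ⟨h₁, h₂, h₃, h₄⟩ := hI₂ h
      have h0 : 0 < τ.reg rPlace := by
        by_contra h0
        simp [h0] at hb
      rw [hτL] at hρ₁ hρ₂
      rw [hτQ] at hρ₂
      have hρ₁' : Function.update ρ.reg rStep (j + 1) rPlace = L (τ.reg rPlace) := hρ₁
      obtain ⟨hl, he⟩ := hS.link _ h₂ h0
      have hlt : L (τ.reg rPlace) < n := hl.trans h₂
      simp only [hρ₁', hρ₂]
      refine ⟨by omega, hlt, h₃.move (hS.mem _ h₂).1 (hS.mem _ hlt).1 ?_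
        (hS.queue_ne hlt h₂ hl.ne) (by rwa [h₄ _ hl.le]), fun l hl' => ?_⟩
      · rw [← hS.source]
        exact hS.queue_ne h₂ hS.nonempty h0.ne'
      · rw [Function.update_of_ne (hS.queue_ne (by omega) h₂ (by omega))]
        exact h₄ l (by omega)
    · obtain ⟨h₁, h₂, h₃, h₄⟩ := hI₂ h
      have h0 : τ.reg rPlace = 0 := by
        by_contra h0
        simp [Nat.pos_of_ne_zero h0] at hb
      exact ⟨Or.inl h0, h₂, h₃, h₄⟩
  · rintro T τ ⟨hT, ⟨h₁, h₂⟩, hF⟩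
    have hsink : τ.reg rSink = t := (hF.1 rSink rfl).trans hσ.sink
    have e : (fun l => if True ∧ True ∧ l = t then t else τ.arr aMate 0 l) =
        Function.update (τ.arr aMate 0) t t := by
      funext l
      simp [Function.update_apply]
    simp only [hsink]
    rw [e]
    refine ⟨by omega, fun h => ?_, fun h => ?_⟩
    · rw [(h₁ h).2]
      conv_rhs => rw [← Function.update_eq_self t M, hM.sink]
    · obtain ⟨h₃, h₄, h₅, -⟩ := h₂ h
      have h0 : τ.reg rPlace = 0 := by omega
      rw [h0, hS.source] at h₅
      exact h₅.close hst ht hEst hEt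

end HTCAlgorithm

/-! ### Correctness and running time of the flow procedure. -/

namespace HTCAlgorithm

open RAM RAM.Cmd

variable {N s t : ℕ} {E : ℕ → ℕ → Prop}

/-- Each search either reaches the sink, and then the linking grows, or its found nodes are the set
`X` that certifies maximality. A linking has fewer than `N` paths, so there are at most `N + 1`
searches. -/
theorem wp_unitMaxFlow {σ : Memory} (hσ : HoldsRows N E s t σ) (hst : s ≠ t) (hs : s < N)
    (ht : t < N) (hEst : ¬ E s t) (hEt : ∀ x, ¬ E t x) :
    wp unitMaxFlow σ fun T τ => T ≤ 1000 * (N + 1) ^ 3 ∧ Frame unitMaxFlow σ τ ∧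
      ∃ (M : ℕ → ℕ) (X : Set ℕ), IsRowLinking N E s t M (τ.reg rFlow) ∧ s ∈ X ∧ t ∉ X ∧
        ∀ x < N, x ∈ X → ∀ y < N, E (M x) y ∨ M x = y → y ∈ X := by
  suffices H : wp unitMaxFlow σ fun T τ => T ≤ 1000 * (N + 1) ^ 3 ∧
      ∃ (M : ℕ → ℕ) (X : Set ℕ), IsRowLinking N E s t M (τ.reg rFlow) ∧ s ∈ X ∧ t ∉ X ∧
        ∀ x < N, x ∈ X → ∀ y < N, E (M x) y ∨ M x = y → y ∈ X by
    exact H.frame.mono fun T τ ⟨⟨h₁, h₂⟩, h₃⟩ => ⟨h₁, h₃, h₂⟩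
  simp only [unitMaxFlow, wp_block_cons, wp_block_nil, wp_assign, Expr.cost, Expr.eval]
  refine wp.mono (wp_forBelow_frame N 4 (fun k τ => ∀ x < k, τ.arr aMate 0 x = x) (by decide)
    (by rfl) (by rfl) hσ.size (by simp) ?_) ?_
  · rintro k hk τ hτk - hI
    simp only [wp_put, Expr.cost, Expr.eval, hτk]
    refine ⟨by omega, fun x hx => ?_⟩
    rcases Nat.lt_succ_iff_lt_or_eq.1 hx with hx | rfl
    · simp only [hI x hx, ite_eq_right_iff]
      exact fun h => h.2.2.symm
    · simp
  rintro T₀ τ₀ ⟨hT₀, hmate, hF₀⟩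
  have hτ₀ : HoldsRows N E s t τ₀ :=
    hσ.congr (hF₀.1 rSize rfl) (hF₀.1 rSource rfl) (hF₀.1 rSink rfl) (hF₀.2 aNet rfl)
  refine wp.mono (wp_loop (B := True) (fun n τ => HoldsRows N E s t τ ∧
      IsRowLinking N E s t (τ.arr aMate 0) (τ.reg rFlow) ∧
      -- The extra `1` while a path was found lets the variant drop in the last, unsuccessful search
      -- too.
      n = N - τ.reg rFlow + (if τ.reg rFound = 0 then 0 else 1) ∧
      (τ.reg rFound = 0 → τ.arr aPos 0 s ≠ 0 ∧ τ.arr aPos 0 t = 0 ∧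
        ∀ x < N, τ.arr aPos 0 x ≠ 0 → ∀ y < N, E (τ.arr aMate 0 x) y ∨ τ.arr aMate 0 x = y →
          τ.arr aPos 0 y ≠ 0)) (N * (N * 100 + 140) + 100) ?_ (N + 1) _ ⟨?_, ?_, ?_, ?_⟩) ?_
  · rintro n τ ⟨h₁, h₂, h₃, -⟩ hb
    have hb' : τ.reg rFound ≠ 0 := hb
    simp only [hb', if_false] at h₃
    have hk := h₂.size_lt hs
    simp only [wp_block_cons, wp_block_nil, wp_assign, Expr.cost, Expr.eval]
    refine (wp_searchPath h₁ hs h₂.range).mono ?_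
    rintro T₁ τ₁ ⟨hT₁, hF₁, hS, hcl⟩
    have hτ₁ : HoldsRows N E s t τ₁ :=
      h₁.congr (hF₁.1 rSize rfl) (hF₁.1 rSource rfl) (hF₁.1 rSink rfl) (hF₁.2 aNet rfl)
    rw [← hF₁.2 aMate rfl] at hS hcl
    have h₂' := h₂
    rw [← hF₁.2 aMate rfl] at h₂'
    refine (wp_augment hτ₁ hst ht hEst hEt hS h₂').mono ?_
    rintro T₂ τ₂ ⟨hT₂, hF₂, hno, hyes⟩
    have hτ₂ : HoldsRows N E s t τ₂ :=
      hτ₁.congr (hF₂.1 rSize rfl) (hF₂.1 rSource rfl) (hF₂.1 rSink rfl) (hF₂.2 aNet rfl)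
    have hpos : τ₂.arr aPos 0 = τ₁.arr aPos 0 := congrFun (hF₂.2 aPos rfl) 0
    have hflow : τ₂.reg rFlow = τ.reg rFlow := (hF₂.1 rFlow rfl).trans (hF₁.1 rFlow rfl)
    simp only [hτ₂.sink, hpos, hflow]
    refine ⟨fun _ => ?_, ?_⟩
    · have : N * (N * 100 + 100) + N * 40 = N * (N * 100 + 140) := by ring
      omega
    by_cases hpt : τ₁.arr aPos 0 t = 0
    · refine ⟨N - τ.reg rFlow, by omega, hτ₂.congr rfl rfl rfl rfl, ?_, ?_, fun _ => ?_⟩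
      · simpa [hno hpt, hpt] using h₂'
      · simp [hτ₂.sink, hpt]
      · simp only [hno hpt]
        refine ⟨?_, hpt, hcl⟩
        have := (hS.mem 0 hS.nonempty).2
        rw [hS.source] at this
        omega
    · refine ⟨N - (τ.reg rFlow + 1) + 1, by omega, hτ₂.congr rfl rfl rfl rfl, ?_, ?_, ?_⟩
      · simpa [Nat.pos_of_ne_zero hpt] using hyes hpt
      · simp [hτ₂.sink, hpt, Nat.pos_of_ne_zero hpt]
      · intro h
        simp [hτ₂.sink, hpt] at h
  · exact hτ₀.congr rfl rfl rfl rfl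
  · have : Function.update τ₀.reg rFound 1 rFlow = 0 := hF₀.1 rFlow rfl
    simp only [this]
    exact isRowLinking_of_eq_self hmate hs ht
  · have : τ₀.reg rFlow = 0 := hF₀.1 rFlow rfl
    simp [this]
  · intro h
    simp at h
  · rintro T τ ⟨hT, ⟨n, hn, -, h₂, -, h₄⟩, hb⟩
    obtain ⟨h₅, h₆, h₇⟩ := h₄ hb
    refine ⟨?_, τ.arr aMate 0, {x | τ.arr aPos 0 x ≠ 0}, h₂, h₅, by simp [h₆], h₇⟩
    have := hT trivial
    simp only [Expr.cost] at this
    nlinarith [this]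

/-! ### Networks of half-treks as networks on rows -/

theorem row_injective {m : ℕ} {A : Set (Fin m)} : Function.Injective (row (A := A)) := by
  rintro (_ | _ | ⟨⟨a, _⟩, _⟩ | ⟨w, _⟩) (_ | _ | ⟨⟨b, _⟩, _⟩ | ⟨u, _⟩) h <;> simp [row] at h ⊢ <;> omega

theorem row_lt {m : ℕ} {A : Set (Fin m)} (x : FlowNode A) : row x < 2 * m + 2 := by
  rcases x with _ | _ | ⟨⟨a, _⟩, _⟩ | ⟨w, _⟩ <;> simp [row] <;> omega

/-- The edges of `G_flow(v, A)` as a relation between rows. -/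
def RowEdge {m : ℕ} (G : MixedGraph (Fin m)) (v : Fin m) (A : Set (Fin m)) (i j : ℕ) : Prop :=
  ∃ x y : FlowNode A, i = row x ∧ j = row y ∧ G.FlowEdge v A x y

variable {m : ℕ} {G : MixedGraph (Fin m)} {v : Fin m} {A : Set (Fin m)}

theorem rowEdge_row {x y : FlowNode A} : RowEdge G v A (row x) (row y) ↔ G.FlowEdge v A x y := by
  constructor
  · rintro ⟨x', y', hx, hy, h⟩
    rwa [row_injective hx, row_injective hy]
  · exact fun h => ⟨x, y, rfl, rfl, h⟩

theorem HoldsNetwork.holdsRows {σ : Memory} (h : HoldsNetwork G v A σ) :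
    HoldsRows (2 * m + 2) (RowEdge G v A) (2 * m) (2 * m + 1) σ := by
  obtain ⟨h₁, h₂, h₃, h₄⟩ := h
  refine ⟨h₁, h₂, h₃, fun i hi j hj => ?_⟩
  rw [h₄ i hi j hj, matrixOf]
  split_ifs with he
  · exact iff_of_true one_ne_zero he
  · exact iff_of_false (by simp) he

/-- A linking on rows, with a set that is closed under alternating paths, gives such data on the
nodes of the network. -/
theorem exists_isLinking_of_isRowLinking {M : ℕ → ℕ} {X : Set ℕ} {k : ℕ}
    (hM : IsRowLinking (2 * m + 2) (RowEdge G v A) (2 * m) (2 * m + 1) M k) (hs : 2 * m ∈ X)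
    (ht : 2 * m + 1 ∉ X) (hX : ∀ x < 2 * m + 2, x ∈ X → ∀ y < 2 * m + 2,
      RowEdge G v A (M x) y ∨ M x = y → y ∈ X) :
    ∃ (M' : FlowNode A → FlowNode A) (X' : Set (FlowNode A)),
      IsLinking (G.FlowEdge v A) .source .sink M' ∧
      IsAlternatingClosed (G.FlowEdge v A) .source .sink M' X' ∧
      linkingSize .source M' = k := by
  -- Rows of nodes outside `A` represent nothing in the network. Still, `M` maps rows of network
  -- nodes to such rows, since a changed value is the initial node of an edge.
  have hrow : ∀ x : FlowNode A, ∃ y : FlowNode A, row y = M (row x) := by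
    intro x
    rcases hM.step _ (row_lt x) with h | ⟨y, _, hy, _⟩
    · exact ⟨x, h.symm⟩
    · exact ⟨y, hy.symm⟩
  choose M' hM' using hrow
  have hL : IsLinking (G.FlowEdge v A) .source .sink M' := by
    refine ⟨row_injective ((hM' _).trans hM.source), row_injective ((hM' _).trans hM.sink),
      fun x => ?_, fun x y hxy hne => ?_, fun u hu => ?_⟩
    · refine (hM.step _ (row_lt x)).imp (fun h => row_injective ((hM' _).trans h)) fun h => ?_
      rw [← hM'] at h
      exact rowEdge_row.1 h
    · refine row_injective (hM.inj _ (row_lt x) _ (row_lt y) ?_ ?_)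
      · rw [← hM', ← hM', hxy]
      · rw [← hM']
        exact fun h => hne (row_injective h)
    · refine rowEdge_row.1 (hM.exit _ (row_lt u) fun i hi h => ?_)
      -- A row moved by `M` is the end of an edge, hence the row of a network node; a fixed row
      -- mapped to `row u` is `row u`.
      have : ∃ x : FlowNode A, i = row x := by
        rcases hM.step i hi with h' | ⟨_, x, _, hx, _⟩
        · exact ⟨u, h'.symm.trans h⟩
        · exact ⟨x, hx⟩
      obtain ⟨x, rfl⟩ := this
      exact hu x (row_injective ((hM' x).trans h))
  refine ⟨M', {x | row x ∈ X}, hL, ⟨hs, ht, fun x hx y hxy => ?_, fun x hx => ?_⟩, ?_⟩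
  · refine hX _ (row_lt x) hx _ (row_lt y) (Or.inl ?_)
    rw [← hM']
    exact rowEdge_row.2 hxy
  · exact hX _ (row_lt x) hx _ (row_lt _) (Or.inr (hM' x).symm)
  · rw [← hM.card, linkingSize, ← Set.ncard_image_of_injective _ row_injective,
      ← Set.ncard_coe_finset]
    congr 1
    ext i
    simp only [Set.mem_image, Set.mem_ofPred_eq, Finset.coe_filter, Finset.mem_range]
    constructor
    · rintro ⟨x, ⟨hx, hx'⟩, rfl⟩
      refine ⟨row_lt x, fun h => hx (row_injective h), ?_⟩
      rw [← hM', hx']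
      rfl
    · rintro ⟨hi, his, h⟩
      rcases hM.step i hi with h' | ⟨_, x, _, rfl, _⟩
      · exact absurd (h'.symm.trans h) his
      · refine ⟨x, ⟨?_, row_injective ((hM' x).trans h)⟩, rfl⟩
        rintro rfl
        exact his rfl

theorem wp_unitMaxFlow_flowNetwork {σ : Memory} (hσ : HoldsNetwork G v A σ) :
    wp unitMaxFlow σ fun T τ => T ≤ 1000 * (2 * m + 3) ^ 3 ∧ Frame unitMaxFlow σ τ ∧
      ∃ (M : FlowNode A → FlowNode A) (X : Set (FlowNode A)),
        IsLinking (G.FlowEdge v A) .source .sink M ∧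
        IsAlternatingClosed (G.FlowEdge v A) .source .sink M X ∧
        linkingSize .source M = τ.reg rFlow := by
  refine (wp_unitMaxFlow hσ.holdsRows (by omega) (by omega) (by omega) ?_ ?_).mono ?_
  · intro h
    exact nomatch (rowEdge_row (x := .source) (y := .sink)).1 h
  · rintro x ⟨y, _, hy, _, h⟩
    obtain rfl : FlowNode.sink = y := row_injective hy
    exact nomatch h
  · rintro T τ ⟨hT, hF, M, X, hM, hs, ht, hX⟩
    exact ⟨hT, hF, exists_isLinking_of_isRowLinking hM hs ht hX⟩

theorem isMaxFlowProcedure_unitMaxFlow : IsMaxFlowProcedure unitMaxFlow := by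
  intro m G v A _ σ hσ
  obtain ⟨T, τ, h, -, hF, M, X, hM, hX, hk⟩ := wp_unitMaxFlow_flowNetwork hσ
  refine ⟨T, τ, h, ?_, fun x hx hne => hF.1 x ?_, fun a ha => hF.2 a ?_⟩
  · rw [← hk]
    exact FlowNetwork.isMaxFlow_of_isAlternatingClosed MixedGraph.isUnit_flowNetwork hM hX
  · revert hne
    interval_cases x <;> intro hne <;> first | rfl | exact absurd rfl hne
  · interval_cases a <;> rfl

theorem card_flowNode_le {m : ℕ} (A : Set (Fin m)) :
    m + 2 ≤ Fintype.card (FlowNode A) ∧ Fintype.card (FlowNode A) ≤ 2 * m + 2 := by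
  classical
  have := Fintype.card_congr (FlowNode.equivSum A)
  have h := set_fintype_card_le_univ A
  simp only [Fintype.card_sum, Fintype.card_bool, Fintype.card_fin] at this h
  omega

theorem runsInCubicTime_unitMaxFlow : RunsInCubicTime unitMaxFlow := by
  -- `8000 = 1000 * 2 ^ 3`: the network has at least `m + 2` nodes, so `2 * m + 3` is at most twice
  -- their number.
  refine ⟨8000, fun m G v A _ σ hσ t τ h => ?_⟩
  obtain ⟨T, τ', h', hT, -⟩ := wp_unitMaxFlow_flowNetwork hσ
  rw [(h'.deterministic h).1]
  have hc := (card_flowNode_le A).1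
  calc T ≤ 1000 * (2 * m + 3) ^ 3 := hT
    _ ≤ 1000 * (2 * (Fintype.card (FlowNode A) +
          reciprocalPairs (G.flowNetwork v A).edge)) ^ 3 := by gcongr; omega
    _ = _ := by ring

/-- Every network `G_flow(v, A)` has a maximum linking. -/
theorem exists_isLinking (G : MixedGraph (Fin m)) (v : Fin m) (A : Set (Fin m)) :
    ∃ (M : FlowNode A → FlowNode A) (X : Set (FlowNode A)),
      IsLinking (G.FlowEdge v A) .source .sink M ∧
      IsAlternatingClosed (G.FlowEdge v A) .source .sink M X := by
  -- Running the procedure on an artificial memory proves a purely combinatorial existence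
  -- statement.
  have hσ : HoldsNetwork G v A
      ⟨fun r => if r = rSize then 2 * m + 2 else if r = rSource then 2 * m else 2 * m + 1,
        fun _ => matrixOf fun i j => ∃ x y : FlowNode A,
          i = row x ∧ j = row y ∧ (G.flowNetwork v A).edge x y⟩ :=
    ⟨rfl, rfl, rfl, fun i _ j _ => rfl⟩
  obtain ⟨T, τ, -, -, -, M, X, hM, hX, -⟩ := wp_unitMaxFlow_flowNetwork hσ
  exact ⟨M, X, hM, hX⟩

/-- The maximum flow size of `G_flow(v, A)` is `|pa(v)|` if and only if the half-trek criterion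
can be satisfied within `A`. -/
theorem eq_ncard_pa_iff (hA : A ⊆ (insert v (G.sib v))ᶜ) {k : ℕ}
    (hk : (G.flowNetwork v A).IsMaxFlow (k : ℝ≥0)) :
    k = (G.pa v).ncard ↔ ∃ Y ⊆ A, G.HalfTrekCriterion Y v := by
  obtain ⟨M, X, hM, hX⟩ := exists_isLinking G v A
  rw [← MixedGraph.linkingSize_eq_iff hA hM hX]
  -- A greatest element is unique, so `k` is the size of this linking, whichever procedure computed
  -- it.
  have := hk.unique
    (FlowNetwork.isMaxFlow_of_isAlternatingClosed MixedGraph.isUnit_flowNetwork hM hX)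
  have h' : k = linkingSize FlowNode.source M := by exact_mod_cast this
  rw [h']

end HTCAlgorithm

/-! ### Half-trek reachability as a closure. -/

namespace MixedGraph

variable {V : Type*} (G : MixedGraph V)

/-- The nodes that can be reached by a half-trek from `v`. -/
def reach (v : V) : Set V := {w | ∃ x, (x = v ∨ G.bi v x) ∧ Relation.ReflTransGen G.dir x w}

variable {G}

theorem htr_eq (v : V) : G.htr v = G.reach v \ insert v (G.sib v) := by
  ext w
  constructor
  · rintro ⟨h, π, rfl, rfl⟩
    refine ⟨⟨π.head, π.start, ?_⟩, h⟩
    exact List.relationReflTransGen_of_exists_isChain_cons _ π.path rfl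
  · rintro ⟨⟨x, hx, hxw⟩, h⟩
    obtain ⟨l, hl, hl'⟩ := List.exists_isChain_cons_of_relationReflTransGen hxw
    exact ⟨h, ⟨v, x, l, hx, hl⟩, rfl, hl'⟩

theorem reach_subset {v : V} {H : Set V} (h₀ : ∀ x, x = v ∨ G.bi v x → x ∈ H)
    (h : ∀ x ∈ H, ∀ y, G.dir x y → y ∈ H) : G.reach v ⊆ H := by
  rintro w ⟨x, hx, hxw⟩
  induction hxw with
  | refl => exact h₀ x hx
  | tail _ hd ih => exact h _ ih _ hd

theorem reach_of_dir {v x y : V} (hx : x ∈ G.reach v) (h : G.dir x y) : y ∈ G.reach v := by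
  obtain ⟨z, hz, hzx⟩ := hx
  exact ⟨z, hz, hzx.tail h⟩

theorem mem_insert_sib {v x : V} : x ∈ insert v (G.sib v) ↔ x = v ∨ G.bi v x :=
  or_congr_right ⟨G.bi_symm _ _, G.bi_symm _ _⟩

theorem allowed_subset {S : Set V} {v : V} : G.allowed S v ⊆ (insert v (G.sib v))ᶜ :=
  fun _ h => h.2

end MixedGraph

/-! ### Computing parents, half-trek reachable nodes and allowed nodes. -/

namespace HTCAlgorithm

open RAM RAM.Cmd

variable {m : ℕ} {G : MixedGraph (Fin m)} {v : Fin m}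

/-- The memory holds the adjacency matrices of `G`. -/
structure HoldsGraph (G : MixedGraph (Fin m)) (σ : Memory) : Prop where
  size : σ.reg rM = m
  dir : ∀ v w : Fin m, σ.arr aDir v w ≠ 0 ↔ G.dir v w
  bi : ∀ v w : Fin m, σ.arr aBi v w ≠ 0 ↔ G.bi v w

theorem HoldsGraph.congr {σ τ : Memory} (h : HoldsGraph G σ) (h₁ : τ.reg rM = σ.reg rM)
    (h₂ : τ.arr aDir = σ.arr aDir) (h₃ : τ.arr aBi = σ.arr aBi) : HoldsGraph G τ := by
  refine ⟨h₁.trans h.size, ?_, ?_⟩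
  · rw [h₂]
    exact h.dir
  · rw [h₃]
    exact h.bi

/-- The row `0` of an array holds the set `S`. -/
def HoldsSet (S : Set (Fin m)) (f : ℕ → ℕ) : Prop := ∀ i : Fin m, f i ≠ 0 ↔ i ∈ S

theorem wp_countParents {σ : Memory} (hσ : HoldsGraph G σ) (hv : σ.reg rV = v) :
    wp countParents σ fun T τ => T ≤ m * 30 + 20 ∧ Frame countParents σ τ ∧
      τ.reg rParents = (G.pa v).ncard := by
  suffices H : wp countParents σ fun T τ => T ≤ m * 30 + 20 ∧
      τ.reg rParents = (G.pa v).ncard by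
    exact H.frame.mono fun T τ ⟨⟨h₁, h₂⟩, h₃⟩ => ⟨h₁, h₃, h₂⟩
  simp only [countParents, wp_block_cons, wp_block_nil, wp_assign, Expr.cost, Expr.eval]
  refine wp.mono (wp_forBelow_frame m 20 (fun k τ => τ.reg rParents =
    ((Finset.range k).filter fun i => σ.arr aDir i v ≠ 0).card) (by decide) (by rfl) (by rfl)
    hσ.size (by simp) ?_) ?_
  · rintro k hk τ hτk hF hI
    have hτv : τ.reg rV = v := (hF.1 rV rfl).trans hv
    have hdir : τ.arr aDir = σ.arr aDir := hF.2 aDir rfl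
    simp only [wp_when, wp_assign, Expr.cost, Expr.eval, hτk, hτv, hdir]
    refine ⟨fun h => ⟨by omega, ?_⟩, fun h => ⟨by omega, ?_⟩⟩
    · rw [Finset.range_add_one, Finset.filter_insert, if_pos h,
        Finset.card_insert_of_notMem (by simp), ← hI]
      rfl
    · rw [Finset.range_add_one, Finset.filter_insert, if_neg (by simpa using h), ← hI]
      rfl
  · rintro T τ ⟨hT, hI, -⟩
    refine ⟨by omega, ?_⟩
    rw [hI, ← Set.ncard_coe_finset, ← Set.ncard_image_of_injective _ Fin.val_injective]
    congr 1
    ext i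
    simp only [Finset.coe_filter, Finset.mem_range, Set.mem_ofPred_eq, Set.mem_image]
    constructor
    · rintro ⟨hi, h⟩
      exact ⟨⟨i, hi⟩, (hσ.dir ⟨i, hi⟩ v).1 h, rfl⟩
    · rintro ⟨w, hw, rfl⟩
      exact ⟨w.2, (hσ.dir w v).2 hw⟩

theorem isSelfOrSib_eval {σ : Memory} (hσ : HoldsGraph G σ) (hv : σ.reg rV = v) {x : ℕ}
    {w : Fin m} (hx : σ.reg x = w) :
    (isSelfOrSib x).eval σ ≠ 0 ↔ w ∈ insert v (G.sib v) := by
  rw [MixedGraph.mem_insert_sib, ← hσ.bi]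
  simp only [Expr.eval, hv, hx, ne_eq, Nat.add_eq_zero_iff, not_and_or]
  refine or_congr ?_ Iff.rfl
  simp [Fin.ext_iff]

/-- One round of closing the set in `aHtr` under children. -/
theorem wp_closeHtr {σ : Memory} (hσ : HoldsGraph G σ) {R H₀ : Set (Fin m)}
    (hR : ∀ i ∈ R, ∀ j, G.dir i j → j ∈ R) (hH₀ : HoldsSet H₀ (σ.arr aHtr 0)) (hHR : H₀ ⊆ R) :
    wp (.forBelow rI rM (.forBelow rJ rM
      (.when (mem aHtr rI) (.when (.get aDir (.reg rI) (.reg rJ))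
        (setMem aHtr rJ (.lit 1)))))) σ fun T τ => T ≤ m * (m * 40 + 20) + 10 ∧
      ∃ H, HoldsSet H (τ.arr aHtr 0) ∧ H₀ ⊆ H ∧ H ⊆ R ∧
        ∀ i ∈ H₀, ∀ j, G.dir i j → j ∈ H := by
  -- The set grows in place, so a node entered in this round may already pass on to its children.
  -- The result is therefore only kept between `H₀` and `R`, and asked to contain the children of
  -- the members of `H₀` treated so far.
  refine wp.mono (wp_forBelow_frame m (m * 40 + 10) (fun k τ => ∃ H, HoldsSet H (τ.arr aHtr 0) ∧
    H₀ ⊆ H ∧ H ⊆ R ∧ ∀ i ∈ H₀, (i : ℕ) < k → ∀ j, G.dir i j → j ∈ H) (by decide) (by rfl) (by rfl)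
    hσ.size ⟨H₀, hH₀, subset_rfl, hHR, by simp⟩ ?_) ?_
  · rintro k hk τ hτk hF ⟨H, hH, h₁, h₂, h₃⟩
    have hτ : HoldsGraph G τ := hσ.congr (hF.1 rM rfl) (hF.2 aDir rfl) (hF.2 aBi rfl)
    refine wp.mono (wp_forBelow_frame m 25 (fun l τ => ∃ H, HoldsSet H (τ.arr aHtr 0) ∧
      H₀ ⊆ H ∧ H ⊆ R ∧ (∀ i ∈ H₀, (i : ℕ) < k → ∀ j, G.dir i j → j ∈ H) ∧
      (∀ i ∈ H₀, (i : ℕ) = k → ∀ j : Fin m, (j : ℕ) < l → G.dir i j → j ∈ H)) (by decide) (by rfl)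
      (by rfl) hτ.size ⟨H, hH, h₁, h₂, h₃, by simp⟩ ?_) ?_
    · rintro l hl ρ hρl hF' ⟨H, hH, h₁, h₂, h₃, h₄⟩
      have hρk : ρ.reg rI = k := (hF'.1 rI rfl).trans hτk
      have hρ : HoldsGraph G ρ := hτ.congr (hF'.1 rM rfl) (hF'.2 aDir rfl) (hF'.2 aBi rfl)
      have hk' := hH ⟨k, hk⟩
      have hd := hρ.dir ⟨k, hk⟩ ⟨l, hl⟩
      simp only at hk' hd
      simp only [wp_when, wp_put, Expr.cost, Expr.eval, hρk, hρl]
      refine ⟨fun hb => ⟨fun hb' => ⟨by omega, ?_⟩, fun hb' => ⟨by omega, H, hH, h₁, h₂, h₃, ?_⟩⟩,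
        fun hb => ⟨by omega, H, hH, h₁, h₂, h₃, ?_⟩⟩
      · have hlR : (⟨l, hl⟩ : Fin m) ∈ R := hR _ (h₂ (hk'.1 hb)) _ (hd.1 hb')
        refine ⟨insert ⟨l, hl⟩ H, fun i => ?_, fun i hi => Or.inr (h₁ hi),
          Set.insert_subset hlR h₂, fun i hi hik j hij => Or.inr (h₃ i hi hik j hij), ?_⟩
        · by_cases hil : (i : ℕ) = l
          · have : i = ⟨l, hl⟩ := Fin.ext hil
            simp [this]
          · have : i ≠ ⟨l, hl⟩ := fun e => hil (congrArg Fin.val e)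
            have h' := hH i
            simp only [ne_eq] at h'
            simp [hil, this, h']
        · intro i hi hik j hj hij
          rcases Nat.lt_succ_iff_lt_or_eq.1 hj with hj | hj
          · exact Or.inr (h₄ i hi hik j hj hij)
          · exact Or.inl (Fin.ext hj)
      · intro i hi hik j hj hij
        rcases Nat.lt_succ_iff_lt_or_eq.1 hj with hj | hj
        · exact h₄ i hi hik j hj hij
        · have hi' : i = ⟨k, hk⟩ := Fin.ext hik
          have hj' : j = ⟨l, hl⟩ := Fin.ext hj
          rw [hi', hj'] at hij
          exact absurd hb' (hd.2 hij)
      · intro i hi hik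
        have hi' : i = ⟨k, hk⟩ := Fin.ext hik
        rw [hi'] at hi
        exact absurd hb (hk'.2 (h₁ hi))
    · rintro T ρ ⟨hT, ⟨H, hH, h₁, h₂, h₃, h₄⟩, -⟩
      refine ⟨by omega, H, hH, h₁, h₂, fun i hi hik => ?_⟩
      rcases Nat.lt_succ_iff_lt_or_eq.1 hik with hik | hik
      · exact h₃ i hi hik
      · exact fun j => h₄ i hi hik j j.2
  · rintro T τ ⟨hT, ⟨H, hH, h₁, h₂, h₃⟩, -⟩
    refine ⟨?_, H, hH, h₁, h₂, fun i hi => h₃ i hi i.2⟩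
    have : m * (m * 40 + 10 + 9) ≤ m * (m * 40 + 20) := Nat.mul_le_mul_left _ (by omega)
    omega

/-- A round that adds nothing has found a set closed under children, which is all of `reach v`.
Otherwise the set grows; starting with at least one node, it cannot grow in all `m` rounds. -/
theorem wp_computeHtr {σ : Memory} (hσ : HoldsGraph G σ) (hv : σ.reg rV = v) :
    wp computeHtr σ fun T τ => T ≤ 200 * (m + 1) ^ 3 ∧ Frame computeHtr σ τ ∧
      HoldsSet (G.htr v) (τ.arr aHtr 0) := by
  suffices H : wp computeHtr σ fun T τ => T ≤ 200 * (m + 1) ^ 3 ∧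
      HoldsSet (G.htr v) (τ.arr aHtr 0) by
    exact H.frame.mono fun T τ ⟨⟨h₁, h₂⟩, h₃⟩ => ⟨h₁, h₃, h₂⟩
  simp only [computeHtr, wp_block_cons, wp_block_nil]
  refine wp.mono (wp_forBelow_frame m 25 (fun k τ => ∀ i : Fin m, (i : ℕ) < k →
    (τ.arr aHtr 0 i ≠ 0 ↔ i ∈ insert v (G.sib v))) (by decide) (by rfl) (by rfl)
    hσ.size (by simp) ?_) ?_
  · rintro k hk τ hτk hF hI
    have hτ : HoldsGraph G τ := hσ.congr (hF.1 rM rfl) (hF.2 aDir rfl) (hF.2 aBi rfl)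
    have hb := isSelfOrSib_eval (x := rI) (w := ⟨k, hk⟩) hτ ((hF.1 rV rfl).trans hv) hτk
    rw [wp_cond]
    refine ⟨fun h => ?_, fun h => ?_⟩ <;> simp only [wp_put, Expr.cost, Expr.eval, hτk] <;>
      refine ⟨by omega, fun i hi => ?_⟩ <;>
      rcases Nat.lt_succ_iff_lt_or_eq.1 hi with hi | hi
    · have : ¬ (i : ℕ) = k := by omega
      simpa [this] using hI i hi
    · have hi' : i = ⟨k, hk⟩ := Fin.ext hi
      rw [hi']
      simpa using hb.1 h
    · have : ¬ (i : ℕ) = k := by omega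
      simpa [this] using hI i hi
    · have hi' : i = ⟨k, hk⟩ := Fin.ext hi
      rw [hi']
      simpa using mt hb.2 (not_not.2 h)
  rintro T₁ τ₁ ⟨hT₁, h₁, hF₁⟩
  have hτ₁ : HoldsGraph G τ₁ := hσ.congr (hF₁.1 rM rfl) (hF₁.2 aDir rfl) (hF₁.2 aBi rfl)
  have hR : ∀ i ∈ G.reach v, ∀ j, G.dir i j → j ∈ G.reach v :=
    fun i hi j hij => MixedGraph.reach_of_dir hi hij
  have hS : ∀ x, x = v ∨ G.bi v x → x ∈ insert v (G.sib v) :=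
    fun x => MixedGraph.mem_insert_sib.2
  have hSR : insert v (G.sib v) ⊆ G.reach v :=
    fun x hx => ⟨x, MixedGraph.mem_insert_sib.1 hx, .refl⟩
  refine wp.mono (wp_forBelow_frame m (m * (m * 40 + 20) + 10) (fun k τ =>
    ∃ H, HoldsSet H (τ.arr aHtr 0) ∧ insert v (G.sib v) ⊆ H ∧ H ⊆ G.reach v ∧
      (G.reach v ⊆ H ∨ k + 1 ≤ H.ncard)) (by decide) (by rfl) (by rfl)
    hτ₁.size ⟨insert v (G.sib v), fun i => h₁ i i.2, subset_rfl, hSR, Or.inr ?_⟩ ?_) ?_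
  · rw [zero_add]
    exact (Set.ncard_pos (Set.toFinite _)).2 ⟨v, Or.inl rfl⟩
  · rintro k hk τ hτk hF ⟨H₀, hH₀, h₂, h₃, h₄⟩
    have hτ : HoldsGraph G τ := hτ₁.congr (hF.1 rM rfl) (hF.2 aDir rfl) (hF.2 aBi rfl)
    refine (wp_closeHtr hτ hR hH₀ h₃).mono ?_
    rintro T ρ ⟨hT, H, hH, h₅, h₆, h₇⟩
    refine ⟨hT, H, hH, h₂.trans h₅, h₆, ?_⟩
    rcases h₄ with h₄ | h₄
    · exact Or.inl (h₄.trans h₅)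
    · by_cases hHH : H ⊆ H₀
      · exact Or.inl ((MixedGraph.reach_subset (fun x hx => h₂ (hS x hx))
          fun x hx y hxy => hHH (h₇ x hx y hxy)).trans h₅)
      · have := Set.ncard_lt_ncard (ssubset_of_subset_not_subset h₅ hHH) (Set.toFinite _)
        exact Or.inr (by omega)
  · rintro T₂ τ₂ ⟨hT₂, ⟨H, hH, h₂, h₃, h₄⟩, hF₂⟩
    have hτ₂ : HoldsGraph G τ₂ := hτ₁.congr (hF₂.1 rM rfl) (hF₂.2 aDir rfl) (hF₂.2 aBi rfl)
    have hHR : H = G.reach v := by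
      refine Set.Subset.antisymm h₃ (h₄.resolve_right fun h => ?_)
      have := Set.ncard_le_ncard (Set.subset_univ H) (Set.toFinite _)
      rw [Set.ncard_univ, Nat.card_eq_fintype_card, Fintype.card_fin] at this
      omega
    subst hHR
    refine wp.mono (wp_forBelow_frame m 25 (fun k τ => ∀ i : Fin m, τ.arr aHtr 0 i ≠ 0 ↔
      i ∈ G.reach v ∧ ((i : ℕ) < k → i ∉ insert v (G.sib v))) (by decide) (by rfl) (by rfl)
      hτ₂.size (fun i => by simpa using hH i) ?_) ?_
    · rintro k hk τ hτk hF hI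
      have hτ : HoldsGraph G τ := hτ₂.congr (hF.1 rM rfl) (hF.2 aDir rfl) (hF.2 aBi rfl)
      have hb := isSelfOrSib_eval (x := rI) (w := ⟨k, hk⟩) hτ
        ((hF.1 rV rfl).trans ((hF₂.1 rV rfl).trans ((hF₁.1 rV rfl).trans hv))) hτk
      rw [wp_when]
      refine ⟨fun h => ?_, fun h => ?_⟩
      · simp only [wp_put, Expr.cost, Expr.eval, hτk]
        refine ⟨by omega, fun i => ?_⟩
        by_cases hik : (i : ℕ) = k
        · have hi' : i = ⟨k, hk⟩ := Fin.ext hik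
          have := hb.1 h
          rw [hi']
          simpa using fun _ => (Set.mem_insert_iff.1 this).resolve_left
        · have e : (i : ℕ) < k + 1 ↔ (i : ℕ) < k := by omega
          rw [e]
          simpa [hik] using hI i
      · refine ⟨by simp only [Expr.cost]; omega, fun i => ?_⟩
        by_cases hik : (i : ℕ) = k
        · have hi' : i = ⟨k, hk⟩ := Fin.ext hik
          have h' := mt hb.2 (not_not.2 h)
          have := hI i
          rw [hi'] at this ⊢
          simpa [h'] using this
        · have e : (i : ℕ) < k + 1 ↔ (i : ℕ) < k := by omega
          rw [e]
          exact hI i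
    · rintro T₃ τ₃ ⟨hT₃, hI, -⟩
      refine ⟨?_, fun i => ?_⟩
      · have e : m * (m * (m * 40 + 20) + 10 + 9) + m * (25 + 9) + m * (25 + 9) + 30 ≤
            200 * (m + 1) ^ 3 := by
          nlinarith [Nat.zero_le (m ^ 3), Nat.zero_le (m ^ 2)]
        omega
      · rw [hI i, MixedGraph.htr_eq]
        exact and_congr_right fun _ => ⟨fun h => h i.2, fun h _ => h⟩

theorem wp_computeAllowed {σ : Memory} (hσ : HoldsGraph G σ) (hv : σ.reg rV = v)
    {S : Set (Fin m)} (hS : HoldsSet S (σ.arr aSolved 0))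
    (hH : HoldsSet (G.htr v) (σ.arr aHtr 0)) :
    wp computeAllowed σ fun T τ => T ≤ m * 50 + 10 ∧ Frame computeAllowed σ τ ∧
      HoldsSet (G.allowed S v) (τ.arr aAllowed 0) := by
  refine wp.mono (wp_forBelow_frame m 40 (fun k τ => ∀ i : Fin m, (i : ℕ) < k →
    (τ.arr aAllowed 0 i ≠ 0 ↔ i ∈ G.allowed S v)) (by decide) (by rfl) (by rfl)
    hσ.size (by simp) ?_) ?_
  · rintro k hk τ hτk hF hI
    have hτ : HoldsGraph G τ := hσ.congr (hF.1 rM rfl) (hF.2 aDir rfl) (hF.2 aBi rfl)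
    have hb := isSelfOrSib_eval (x := rI) (w := ⟨k, hk⟩) hτ ((hF.1 rV rfl).trans hv) hτk
    have hs := hS ⟨k, hk⟩
    have hh := hH ⟨k, hk⟩
    have hc : (Expr.add (mem aSolved rI) (not (mem aHtr rI))).eval τ ≠ 0 ↔
        (⟨k, hk⟩ : Fin m) ∈ S ∪ (G.htr v)ᶜ := by
      have e₁ : τ.arr aSolved = σ.arr aSolved := hF.2 aSolved rfl
      have e₂ : τ.arr aHtr = σ.arr aHtr := hF.2 aHtr rfl
      rw [Set.mem_union, Set.mem_compl_iff, ← hs, ← hh]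
      simp only [Expr.eval, hτk, e₁, e₂, ne_eq, Nat.add_eq_zero_iff, not_and_or]
      refine or_congr Iff.rfl ?_
      simp
    have step : ∀ b : ℕ, (b ≠ 0 ↔ (⟨k, hk⟩ : Fin m) ∈ G.allowed S v) → ∀ i : Fin m,
        (i : ℕ) < k + 1 → ((if True ∧ True ∧ (i : ℕ) = k then b
          else τ.arr aAllowed 0 i) ≠ 0 ↔ i ∈ G.allowed S v) := by
      intro b hb i hi
      rcases Nat.lt_succ_iff_lt_or_eq.1 hi with hi | hi
      · have : ¬ (i : ℕ) = k := by omega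
        simpa [this] using hI i hi
      · have hi' : i = ⟨k, hk⟩ := Fin.ext hi
        rw [hi']
        simpa using hb
    simp only [wp_cond]
    refine ⟨fun h => ?_, fun h => ⟨fun h' => ?_, fun h' => ?_⟩⟩ <;>
      simp only [wp_put, Expr.cost, Expr.eval, hτk] <;> refine ⟨by omega, step _ ?_⟩
    · exact iff_of_false (by simp) fun hm => hm.2 (hb.1 h)
    · exact iff_of_true (by simp) ⟨hc.1 h', mt hb.2 (not_not.2 h)⟩
    · exact iff_of_false (by simp) fun hm => hc.2 hm.1 h'
  · rintro T τ ⟨hT, hI, hF⟩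
    exact ⟨by omega, hF, fun i => hI i i.2⟩

end HTCAlgorithm

/-! ### Writing down the flow network. -/

namespace HTCAlgorithm

open RAM RAM.Cmd

variable {m : ℕ} {G : MixedGraph (Fin m)} {v : Fin m}

/-- The matrix `f` is, on the rows and columns below `N`, the matrix of the relation `R`. -/
def IsMatrixBelow (N : ℕ) (R : ℕ → ℕ → Prop) (f : ℕ → ℕ → ℕ) : Prop :=
  ∀ i < N, ∀ j < N, f i j = matrixOf R i j

theorem IsMatrixBelow.congr {N : ℕ} {R R' : ℕ → ℕ → Prop} {f : ℕ → ℕ → ℕ}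
    (h : IsMatrixBelow N R f) (hR : ∀ i j, R i j ↔ R' i j) : IsMatrixBelow N R' f := by
  have : R = R' := by
    funext i j
    exact propext (hR i j)
  rwa [← this]

theorem IsMatrixBelow.put {N a b : ℕ} {R R' : ℕ → ℕ → Prop} {f f' : ℕ → ℕ → ℕ}
    (h : IsMatrixBelow N R f) (hf : ∀ i j, f' i j = if i = a ∧ j = b then 1 else f i j)
    (hR : ∀ i j, R' i j ↔ R i j ∨ (i = a ∧ j = b)) : IsMatrixBelow N R' f' := by
  intro i hi j hj
  rw [hf, h i hi j hj, matrixOf, matrixOf]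
  by_cases h₁ : i = a ∧ j = b
  · rw [if_pos h₁, if_pos ((hR i j).2 (Or.inr h₁))]
  · rw [if_neg h₁]
    congr 1
    rw [hR]
    simp [h₁]

/-- A loop that enters the pairs `(p k, q k)`, for the numbers `k` with the property `c`, into the
adjacency matrix. -/
theorem wp_enterEdges {N n x bound : ℕ} {b i j : Expr} {c : ℕ → Prop} {p q : ℕ → ℕ}
    {R : ℕ → ℕ → Prop} {σ : Memory} (hx : bound ≠ x) (hn : σ.reg bound = n)
    (hR : IsMatrixBelow N R (σ.arr aNet))
    (h : ∀ k < n, ∀ τ : Memory, τ.reg x = k → (∀ r, r ≠ x → τ.reg r = σ.reg r) →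
      (∀ a, a ≠ aNet → τ.arr a = σ.arr a) →
      (b.eval τ ≠ 0 ↔ c k) ∧ i.eval τ = p k ∧ j.eval τ = q k) :
    wp (.forBelow x bound (.when b (.put aNet i j (.lit 1)))) σ fun T τ =>
      T ≤ n * (b.cost + i.cost + j.cost + 20) + 7 ∧
      IsMatrixBelow N (fun y z => R y z ∨ ∃ k < n, c k ∧ y = p k ∧ z = q k) (τ.arr aNet) ∧
      Frame (.forBelow x bound (.when b (.put aNet i j (.lit 1)))) σ τ := by
  refine wp.mono (wp_forBelow_frame n (b.cost + i.cost + j.cost + 10) (fun k τ =>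
    IsMatrixBelow N (fun y z => R y z ∨ ∃ l < k, c l ∧ y = p l ∧ z = q l) (τ.arr aNet)) hx
    (by rfl) (by rfl) hn (hR.congr (by simp)) ?_) ?_
  · rintro k hk τ hτk hF hI
    obtain ⟨h₁, h₂, h₃⟩ := h k hk τ hτk
      (fun r hr => hF.1 r (by simpa [forBelow, block, when, Cmd.writesReg] using hr))
      (fun a ha => hF.2 a (by simpa [forBelow, block, when, Cmd.writesArr] using ha))
    simp only [wp_when, wp_put, Expr.cost, h₁, h₂, h₃, Expr.eval]
    refine ⟨fun hc => ⟨by omega, hI.put (a := p k) (b := q k) (by simp) fun y z => ?_⟩,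
      fun hb => ⟨by omega, hI.congr fun y z => ?_⟩⟩
    · rw [or_assoc]
      refine or_congr_right ⟨?_, ?_⟩
      · rintro ⟨l, hl, hcl, h⟩
        rcases Nat.lt_succ_iff_lt_or_eq.1 hl with hl | rfl
        · exact Or.inl ⟨l, hl, hcl, h⟩
        · exact Or.inr h
      · rintro (⟨l, hl, h⟩ | h)
        · exact ⟨l, by omega, h⟩
        · exact ⟨k, by omega, hc, h⟩
    · refine or_congr_right ⟨?_, ?_⟩
      · rintro ⟨l, hl, h⟩
        exact ⟨l, by omega, h⟩
      · rintro ⟨l, hl, hcl, h⟩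
        rcases Nat.lt_succ_iff_lt_or_eq.1 hl with hl | rfl
        · exact ⟨l, hl, hcl, h⟩
        · exact absurd hb (h₁.2 hcl)
  · rintro T τ ⟨hT, hI, hF⟩
    refine ⟨?_, hI, hF⟩
    have e : b.cost + i.cost + j.cost + 10 + 9 ≤ b.cost + i.cost + j.cost + 20 := by omega
    have := Nat.mul_le_mul_left n e
    omega

/-- The edges of the network from the source and from the left-hand nodes below `k`. -/
def LeftEdge (G : MixedGraph (Fin m)) (A : Set (Fin m)) (k i j : ℕ) : Prop :=
  ∃ a ∈ A, (a : ℕ) < k ∧ ((i = 2 * m ∧ j = a) ∨ (i = a ∧ j = m + a) ∨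
    ∃ w, G.bi a w ∧ i = a ∧ j = m + w)

/-- The edges of the network between the right-hand nodes, with initial nodes below `k`. -/
def RightEdge (G : MixedGraph (Fin m)) (k i j : ℕ) : Prop :=
  ∃ w u : Fin m, (w : ℕ) < k ∧ G.dir w u ∧ i = m + w ∧ j = m + u

/-- The edges are grouped in the way the program enters them: by left-hand node, by right-hand node,
and into the sink. -/
theorem rowEdge_iff {A : Set (Fin m)} {i j : ℕ} : RowEdge G v A i j ↔
    (LeftEdge G A m i j ∨ RightEdge G m i j) ∨
      ∃ w : Fin m, G.dir w v ∧ i = m + w ∧ j = 2 * m + 1 := by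
  constructor
  · rintro ⟨x, y, rfl, rfl, h⟩
    cases h with
    | source_left a => exact Or.inl (Or.inl ⟨a, a.2, a.1.2, Or.inl ⟨rfl, rfl⟩⟩)
    | left_right a => exact Or.inl (Or.inl ⟨a, a.2, a.1.2, Or.inr (Or.inl ⟨rfl, rfl⟩)⟩)
    | left_sibling a w h =>
      exact Or.inl (Or.inl ⟨a, a.2, a.1.2, Or.inr (Or.inr ⟨w, h, rfl, rfl⟩)⟩)
    | right_right w u h => exact Or.inl (Or.inr ⟨w, u, w.2, h, rfl, rfl⟩)
    | right_sink w h => exact Or.inr ⟨w, h, rfl, rfl⟩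
  · rintro ((⟨a, ha, _, ⟨rfl, rfl⟩ | ⟨rfl, rfl⟩ | ⟨w, h, rfl, rfl⟩⟩ | ⟨w, u, _, h, rfl, rfl⟩) |
      ⟨w, h, rfl, rfl⟩)
    · exact ⟨.source, .left ⟨a, ha⟩, rfl, rfl, .source_left _⟩
    · exact ⟨.left ⟨a, ha⟩, .right a, rfl, rfl, .left_right ⟨a, ha⟩⟩
    · exact ⟨.left ⟨a, ha⟩, .right w, rfl, rfl, .left_sibling ⟨a, ha⟩ w h⟩
    · exact ⟨.right w, .right u, rfl, rfl, .right_right w u h⟩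
    · exact ⟨.right w, .sink, rfl, rfl, .right_sink w h⟩

theorem wp_enterLeftEdges {σ : Memory} (hσ : HoldsGraph G σ) {A : Set (Fin m)}
    (hA : HoldsSet A (σ.arr aAllowed 0)) (hs : σ.reg rSource = 2 * m) {N : ℕ}
    (hnet : IsMatrixBelow N (fun _ _ => False) (σ.arr aNet)) :
    wp (.forBelow rI rM (.when (mem aAllowed rI) (.block [
      .put aNet (.reg rSource) (.reg rI) (.lit 1),
      .put aNet (.reg rI) (.add (.reg rM) (.reg rI)) (.lit 1),
      .forBelow rJ rM (.when (.get aBi (.reg rI) (.reg rJ))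
        (.put aNet (.reg rI) (.add (.reg rM) (.reg rJ)) (.lit 1)))]))) σ fun T τ =>
      T ≤ m * (m * 50 + 50) + 10 ∧ IsMatrixBelow N (LeftEdge G A m) (τ.arr aNet) := by
  refine wp.mono (wp_forBelow_frame m (m * 50 + 35) (fun k τ =>
    IsMatrixBelow N (LeftEdge G A k) (τ.arr aNet)) (by decide)
    (by rfl) (by rfl) hσ.size (hnet.congr (by simp [LeftEdge])) ?_) ?_
  · rintro k hk τ hτk hF hI
    have hτ : HoldsGraph G τ := hσ.congr (hF.1 rM rfl) (hF.2 aDir rfl) (hF.2 aBi rfl)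
    have hτs : τ.reg rSource = 2 * m := (hF.1 rSource rfl).trans hs
    have hτA : τ.arr aAllowed = σ.arr aAllowed := hF.2 aAllowed rfl
    have hAk := hA ⟨k, hk⟩
    simp only at hAk
    simp only [wp_when, wp_block_cons, wp_block_nil, wp_put, Expr.cost, Expr.eval, hτk, hτA, hτs,
      hτ.size]
    refine ⟨fun hb => ?_, fun hb => ⟨by omega, hI.congr fun y z => ?_⟩⟩
    · refine wp.mono (wp_enterEdges (n := m) (N := N)
        (c := fun l => ∃ w : Fin m, (w : ℕ) = l ∧ G.bi ⟨k, hk⟩ w)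
        (p := fun _ => k) (q := fun l => m + l) (by decide) hτ.size
        (R := fun y z => (LeftEdge G A k y z ∨ (y = 2 * m ∧ z = k)) ∨ (y = k ∧ z = m + k)) ?_ ?_) ?_
      · exact (hI.put (a := 2 * m) (b := k) (f' := fun y z => if y = 2 * m ∧ z = k then 1 else
          τ.arr aNet y z) (fun _ _ => rfl) fun _ _ => Iff.rfl).put (by simp) fun _ _ => Iff.rfl
      · rintro l hl ρ hρl hF₁ hF₂
        have e₁ : ρ.reg rI = k := (hF₁ rI (by decide)).trans hτk
        have e₂ : ρ.reg rM = m := (hF₁ rM (by decide)).trans hτ.size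
        have e₃ : ρ.arr aBi = τ.arr aBi := hF₂ aBi (by decide)
        simp only [Expr.eval, e₁, e₂, hρl, e₃, and_true]
        refine (hτ.bi ⟨k, hk⟩ ⟨l, hl⟩).trans ⟨fun h => ⟨_, rfl, h⟩, ?_⟩
        rintro ⟨w, rfl, h⟩
        exact h
      · rintro T ρ ⟨hT, hI', -⟩
        simp only [Expr.cost] at hT
        refine ⟨by omega, hI'.congr fun y z => ?_⟩
        constructor
        · rintro (((⟨a, ha, hak, h⟩ | h) | h) | ⟨_, _, ⟨w, rfl, hw⟩, h⟩)
          · exact ⟨a, ha, by omega, h⟩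
          · exact ⟨⟨k, hk⟩, hAk.1 hb, Nat.lt_succ_self k, Or.inl h⟩
          · exact ⟨⟨k, hk⟩, hAk.1 hb, Nat.lt_succ_self k, Or.inr (Or.inl h)⟩
          · exact ⟨⟨k, hk⟩, hAk.1 hb, Nat.lt_succ_self k, Or.inr (Or.inr ⟨w, hw, h⟩)⟩
        · rintro ⟨a, ha, hak, h⟩
          rcases Nat.lt_succ_iff_lt_or_eq.1 hak with hak | rfl
          · exact Or.inl (Or.inl (Or.inl ⟨a, ha, hak, h⟩))
          · rcases h with h | h | ⟨w, hw, h⟩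
            · exact Or.inl (Or.inl (Or.inr h))
            · exact Or.inl (Or.inr h)
            · exact Or.inr ⟨w, w.2, ⟨w, rfl, hw⟩, h⟩
    · constructor
      · rintro ⟨a, ha, hak, h⟩
        exact ⟨a, ha, by omega, h⟩
      · rintro ⟨a, ha, hak, h⟩
        rcases Nat.lt_succ_iff_lt_or_eq.1 hak with hak | rfl
        · exact ⟨a, ha, hak, h⟩
        · exact absurd hb (hAk.2 ha)
  · rintro T τ ⟨hT, hI, hF⟩
    refine ⟨?_, hI⟩
    have := Nat.mul_le_mul_left m (show m * 50 + 35 + 9 ≤ m * 50 + 50 by omega)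
    omega

theorem wp_enterRightEdges {σ : Memory} (hσ : HoldsGraph G σ) {N : ℕ} {R : ℕ → ℕ → Prop}
    (hnet : IsMatrixBelow N R (σ.arr aNet)) :
    wp (.forBelow rI rM (.forBelow rJ rM (.when (.get aDir (.reg rI) (.reg rJ))
      (.put aNet (.add (.reg rM) (.reg rI)) (.add (.reg rM) (.reg rJ)) (.lit 1))))) σ fun T τ =>
      T ≤ m * (m * 50 + 50) + 10 ∧
      IsMatrixBelow N (fun i j => R i j ∨ RightEdge G m i j) (τ.arr aNet) := by
  refine wp.mono (wp_forBelow_frame m (m * 50 + 35) (fun k τ =>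
    IsMatrixBelow N (fun i j => R i j ∨ RightEdge G k i j) (τ.arr aNet)) (by decide)
    (by rfl) (by rfl) hσ.size (hnet.congr (by simp [RightEdge])) ?_) ?_
  · rintro k hk τ hτk hF hI
    have hτ : HoldsGraph G τ := hσ.congr (hF.1 rM rfl) (hF.2 aDir rfl) (hF.2 aBi rfl)
    refine wp.mono (wp_enterEdges (n := m) (N := N)
      (c := fun l => ∃ w : Fin m, (w : ℕ) = l ∧ G.dir ⟨k, hk⟩ w)
      (p := fun _ => m + k) (q := fun l => m + l) (by decide) hτ.size hI ?_) ?_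
    · rintro l hl ρ hρl hF₁ hF₂
      have e₁ : ρ.reg rI = k := (hF₁ rI (by decide)).trans hτk
      have e₂ : ρ.reg rM = m := (hF₁ rM (by decide)).trans hτ.size
      have e₃ : ρ.arr aDir = τ.arr aDir := hF₂ aDir (by decide)
      simp only [Expr.eval, e₁, e₂, hρl, e₃, and_true]
      refine (hτ.dir ⟨k, hk⟩ ⟨l, hl⟩).trans ⟨fun h => ⟨_, rfl, h⟩, ?_⟩
      rintro ⟨w, rfl, h⟩
      exact h
    · rintro T ρ ⟨hT, hI', -⟩
      simp only [Expr.cost] at hT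
      refine ⟨by omega, hI'.congr fun y z => ?_⟩
      rw [or_assoc]
      refine or_congr_right ⟨?_, ?_⟩
      · rintro (⟨w, u, hw, h⟩ | ⟨_, _, ⟨u, rfl, hu⟩, h⟩)
        · exact ⟨w, u, by omega, h⟩
        · exact ⟨⟨k, hk⟩, u, Nat.lt_succ_self k, hu, h⟩
      · rintro ⟨w, u, hw, hwu, h⟩
        rcases Nat.lt_succ_iff_lt_or_eq.1 hw with hw | rfl
        · exact Or.inl ⟨w, u, hw, hwu, h⟩
        · exact Or.inr ⟨u, u.2, ⟨u, rfl, hwu⟩, h⟩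
  · rintro T τ ⟨hT, hI, hF⟩
    refine ⟨?_, hI⟩
    have := Nat.mul_le_mul_left m (show m * 50 + 35 + 9 ≤ m * 50 + 50 by omega)
    omega

/-- Needed because the matrix may still contain the network of a node treated before, or whatever
the flow procedure left there. -/
theorem wp_clearNetwork {σ : Memory} {N : ℕ} (hσ : σ.reg rSize = N) :
    wp (.forBelow rI rSize (.forBelow rJ rSize (.put aNet (.reg rI) (.reg rJ) (.lit 0)))) σ
      fun T τ => T ≤ N * (N * 20 + 20) + 10 ∧
        IsMatrixBelow N (fun _ _ => False) (τ.arr aNet) := by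
  refine wp.mono (wp_forBelow_frame N (N * 20 + 10) (fun k τ =>
    ∀ i < k, ∀ j < N, τ.arr aNet i j = 0) (by decide)
    (by rfl) (by rfl) hσ (by simp) ?_) ?_
  · rintro k hk τ hτk hF hI
    refine wp.mono (wp_forBelow_frame N 4 (fun l τ =>
      (∀ i < k, ∀ j < N, τ.arr aNet i j = 0) ∧ ∀ j < l, τ.arr aNet k j = 0) (by decide)
      (by rfl) (by rfl) ((hF.1 rSize rfl).trans hσ) ⟨hI, by simp⟩ ?_) ?_
    · rintro l hl ρ hρl hF' ⟨h₁, h₂⟩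
      have e₁ : ρ.reg rI = k := (hF'.1 rI rfl).trans hτk
      simp only [wp_put, Expr.cost, Expr.eval, e₁, hρl]
      refine ⟨by omega, fun i hi j hj => ?_, fun j hj => ?_⟩
      · simp [h₁ i hi j hj]
      · rcases Nat.lt_succ_iff_lt_or_eq.1 hj with hj | rfl
        · simp [h₂ j hj]
        · simp
    · rintro T ρ ⟨hT, ⟨h₁, h₂⟩, -⟩
      refine ⟨by omega, fun i hi => ?_⟩
      rcases Nat.lt_succ_iff_lt_or_eq.1 hi with hi | rfl
      · exact h₁ i hi
      · exact h₂
  · rintro T τ ⟨hT, hI, -⟩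
    refine ⟨?_, fun i hi j hj => ?_⟩
    · have := Nat.mul_le_mul_left N (show N * 20 + 10 + 9 ≤ N * 20 + 20 by omega)
      omega
    · rw [hI i hi j hj, matrixOf, if_neg not_false]

theorem wp_buildNetwork {σ : Memory} (hσ : HoldsGraph G σ) (hv : σ.reg rV = v)
    {A : Set (Fin m)} (hA : HoldsSet A (σ.arr aAllowed 0)) :
    wp buildNetwork σ fun T τ => T ≤ 1000 * (m + 1) ^ 2 ∧ Frame buildNetwork σ τ ∧
      HoldsNetwork G v A τ := by
  suffices H : wp buildNetwork σ fun T τ => T ≤ 1000 * (m + 1) ^ 2 ∧ HoldsNetwork G v A τ by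
    exact H.frame.mono fun T τ ⟨⟨h₁, h₂⟩, h₃⟩ => ⟨h₁, h₃, h₂⟩
  simp only [buildNetwork, wp_block_cons, wp_block_nil, wp_assign, Expr.cost, Expr.eval]
  refine wp.mono (wp_clearNetwork (N := 2 * m + 2) ?_).frame ?_
  · simp [hσ.size]
    omega
  rintro T₁ τ₁ ⟨⟨hT₁, h₁⟩, hF₁⟩
  have hτ₁ : HoldsGraph G τ₁ := hσ.congr (hF₁.1 rM rfl) (hF₁.2 aDir rfl) (hF₁.2 aBi rfl)
  have hv₁ : τ₁.reg rV = v := (hF₁.1 rV rfl).trans hv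
  have hA₁ : HoldsSet A (τ₁.arr aAllowed 0) := by
    rw [hF₁.2 aAllowed rfl]
    exact hA
  have hs₁ : τ₁.reg rSource = 2 * m := by
    refine (hF₁.1 rSource rfl).trans ?_
    simp [hσ.size]
    omega
  have ht₁ : τ₁.reg rSink = 2 * m + 1 := by
    refine (hF₁.1 rSink rfl).trans ?_
    simp [hσ.size]
    omega
  have hz₁ : τ₁.reg rSize = 2 * m + 2 := by
    refine (hF₁.1 rSize rfl).trans ?_
    simp [hσ.size]
    omega
  refine wp.mono (wp_enterLeftEdges hτ₁ hA₁ hs₁ h₁).frame ?_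
  rintro T₂ τ₂ ⟨⟨hT₂, h₂⟩, hF₂⟩
  have hτ₂ : HoldsGraph G τ₂ := hτ₁.congr (hF₂.1 rM rfl) (hF₂.2 aDir rfl) (hF₂.2 aBi rfl)
  refine wp.mono (wp_enterRightEdges hτ₂ h₂).frame ?_
  rintro T₃ τ₃ ⟨⟨hT₃, h₃⟩, hF₃⟩
  have hτ₃ : HoldsGraph G τ₃ := hτ₂.congr (hF₃.1 rM rfl) (hF₃.2 aDir rfl) (hF₃.2 aBi rfl)
  have hv₃ : τ₃.reg rV = v := (hF₃.1 rV rfl).trans ((hF₂.1 rV rfl).trans hv₁)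
  have hs₃ : τ₃.reg rSource = 2 * m := (hF₃.1 rSource rfl).trans ((hF₂.1 rSource rfl).trans hs₁)
  have ht₃ : τ₃.reg rSink = 2 * m + 1 := (hF₃.1 rSink rfl).trans ((hF₂.1 rSink rfl).trans ht₁)
  have hz₃ : τ₃.reg rSize = 2 * m + 2 := (hF₃.1 rSize rfl).trans ((hF₂.1 rSize rfl).trans hz₁)
  refine wp.mono (wp_enterEdges (n := m) (N := 2 * m + 2)
      (c := fun l => ∃ w : Fin m, (w : ℕ) = l ∧ G.dir w v)
      (p := fun l => m + l) (q := fun _ => 2 * m + 1) (by decide) hτ₃.size h₃ ?_) ?_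
  · rintro l hl ρ hρl hF hF'
    have e₁ : ρ.reg rV = v := (hF rV (by decide)).trans hv₃
    have e₂ : ρ.reg rM = m := (hF rM (by decide)).trans hτ₃.size
    have e₃ : ρ.arr aDir = τ₃.arr aDir := hF' aDir (by decide)
    have e₄ : ρ.reg rSink = 2 * m + 1 := (hF rSink (by decide)).trans ht₃
    simp only [Expr.eval, e₁, e₂, hρl, e₃, e₄, and_true]
    refine (hτ₃.dir ⟨l, hl⟩ v).trans ⟨fun h => ⟨_, rfl, h⟩, ?_⟩
    rintro ⟨w, rfl, h⟩
    exact h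
  · rintro T₄ τ₄ ⟨hT₄, h₄, hF₄⟩
    simp only [Expr.cost] at hT₄
    refine ⟨?_, (hF₄.1 rSize rfl).trans hz₃, (hF₄.1 rSource rfl).trans hs₃,
      (hF₄.1 rSink rfl).trans ht₃, h₄.congr fun i j => ?_⟩
    · have : (2 * m + 2) * ((2 * m + 2) * 20 + 20) + m * (m * 50 + 50) + m * (m * 50 + 50)
          + m * 40 + 100 ≤ 1000 * (m + 1) ^ 2 := by nlinarith
      omega
    · refine Iff.trans ?_ (rowEdge_iff (v := v)).symm
      refine or_congr_right ⟨?_, ?_⟩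
      · rintro ⟨_, _, ⟨w, rfl, hw⟩, h⟩
        exact ⟨w, hw, h⟩
      · rintro ⟨w, hw, h⟩
        exact ⟨w, w.2, ⟨w, rfl, hw⟩, h⟩

end HTCAlgorithm

/-! ### The main loop. -/

namespace HTCAlgorithm

open RAM RAM.Cmd

/-- The treatment of the node in `rV` in an iteration of the algorithm. -/
def processNode (maxFlow : Cmd) : Cmd :=
  .when (not (mem aSolved rV)) (.block [
    computeHtr,
    computeAllowed,
    buildNetwork,
    maxFlow,
    countParents,
    .when (.eq (.reg rFlow) (.reg rParents)) (.block [
      setMem aSolved rV (.lit 1),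
      .assign rChanged (.lit 1)])])

/-- An iteration of the algorithm. -/
def iteration (maxFlow : Cmd) : Cmd :=
  .block [.assign rChanged (.lit 0), .forBelow rV rM (processNode maxFlow), checkAllSolved]

/-- The initialization of the algorithm. -/
def initSolved : Cmd :=
  .forBelow rV rM (.block [countParents, setMem aSolved rV (not (.reg rParents))])

variable {m : ℕ} {G : MixedGraph (Fin m)}

/-- The half-trek criterion for `v` can be satisfied if the nodes in `S` are solved. -/
def CanSolve (G : MixedGraph (Fin m)) (S : Set (Fin m)) (v : Fin m) : Prop :=
  ∃ Y ⊆ G.allowed S v, G.HalfTrekCriterion Y v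

/-- The running time of `P` on the networks of `G` is at most `TP`. -/
def RunsWithin (P : Cmd) (G : MixedGraph (Fin m)) (TP : ℕ) : Prop :=
  ∀ (v : Fin m) (A : Set (Fin m)), A ⊆ (insert v (G.sib v))ᶜ → ∀ σ : Memory,
    HoldsNetwork G v A σ → ∀ (t : ℕ) (τ : Memory), Exec P σ t τ → t ≤ TP

theorem wp_initSolved {σ : Memory} (hσ : HoldsGraph G σ) :
    wp initSolved σ fun T τ => T ≤ m * (m * 30 + 50) + 10 ∧ HoldsGraph G τ ∧
      HoldsSet {v | G.pa v = ∅} (τ.arr aSolved 0) := by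
  refine wp.mono (wp_forBelow_frame m (m * 30 + 30) (fun k τ => ∀ i : Fin m, (i : ℕ) < k →
    (τ.arr aSolved 0 i ≠ 0 ↔ G.pa i = ∅)) (by decide) (by rfl) (by rfl) hσ.size (by simp) ?_) ?_
  · rintro k hk τ hτk hF hI
    have hτ : HoldsGraph G τ := hσ.congr (hF.1 rM rfl) (hF.2 aDir rfl) (hF.2 aBi rfl)
    simp only [wp_block_cons, wp_block_nil]
    refine (wp_countParents (v := ⟨k, hk⟩) hτ hτk).mono ?_
    rintro T ρ ⟨hT, hF', hp⟩
    have e₁ : ρ.reg rV = k := (hF'.1 rV rfl).trans hτk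
    have e₂ : ρ.arr aSolved = τ.arr aSolved := hF'.2 aSolved rfl
    simp only [wp_put, Expr.cost, Expr.eval, e₁, e₂, hp]
    refine ⟨by omega, fun i hi => ?_⟩
    rcases Nat.lt_succ_iff_lt_or_eq.1 hi with hi | hi
    · have : ¬ (i : ℕ) = k := by omega
      simpa [this] using hI i hi
    · have hi' : i = ⟨k, hk⟩ := Fin.ext hi
      rw [hi']
      simp [Set.ncard_eq_zero (Set.toFinite _)]
  · rintro T τ ⟨hT, hI, hF⟩
    refine ⟨?_, hσ.congr (hF.1 rM rfl) (hF.2 aDir rfl) (hF.2 aBi rfl), fun i => hI i i.2⟩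
    have := Nat.mul_le_mul_left m (show m * 30 + 30 + 9 ≤ m * 30 + 50 by omega)
    omega

/-- The flow procedure enters only through its specification: it preserves the data of the caller,
and by `eq_ncard_pa_iff` comparing its value with `|pa(v)|` decides whether `v` can be solved. -/
theorem wp_processNode {P : Cmd} (hP : IsMaxFlowProcedure P) {B : Prop} {TP : ℕ}
    (hT : B → RunsWithin P G TP) {v : Fin m} {S : Set (Fin m)} {σ : Memory}
    (hσ : HoldsGraph G σ) (hv : σ.reg rV = v) (hS : HoldsSet S (σ.arr aSolved 0)) :
    wp (processNode P) σ fun T τ => (B → T ≤ TP + 2000 * (m + 1) ^ 3) ∧ τ.reg rV = v ∧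
      HoldsGraph G τ ∧
      ((HoldsSet S (τ.arr aSolved 0) ∧ τ.reg rChanged = σ.reg rChanged ∧
          (v ∈ S ∨ ¬ CanSolve G S v)) ∨
        (HoldsSet (insert v S) (τ.arr aSolved 0) ∧ τ.reg rChanged = 1 ∧ v ∉ S ∧
          CanSolve G S v)) := by
  have hm : 0 < m := v.pos
  have hpow : m + 1 ≤ (m + 1) ^ 2 ∧ (m + 1) ^ 2 ≤ (m + 1) ^ 3 :=
    ⟨Nat.le_self_pow (by norm_num) _, Nat.pow_le_pow_right (by omega) (by norm_num)⟩
  have hb : (not (mem aSolved rV)).eval σ ≠ 0 ↔ v ∉ S := by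
    rw [← hS v]
    simp [Expr.eval, hv]
  rw [processNode, wp_when]
  refine ⟨fun h => ?_, fun h => ⟨fun _ => ?_, hv, hσ, Or.inl ⟨hS, rfl, Or.inl ?_⟩⟩⟩
  · have hvS := hb.1 h
    simp only [wp_block_cons, wp_block_nil]
    refine (wp_computeHtr hσ hv).mono ?_
    rintro T₁ τ₁ ⟨hT₁, hF₁, hH₁⟩
    have hτ₁ : HoldsGraph G τ₁ := hσ.congr (hF₁.1 rM rfl) (hF₁.2 aDir rfl) (hF₁.2 aBi rfl)
    have hS₁ : HoldsSet S (τ₁.arr aSolved 0) := by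
      rw [hF₁.2 aSolved rfl]
      exact hS
    refine (wp_computeAllowed hτ₁ ((hF₁.1 rV rfl).trans hv) hS₁ hH₁).mono ?_
    rintro T₂ τ₂ ⟨hT₂, hF₂, hA₂⟩
    have hτ₂ : HoldsGraph G τ₂ := hτ₁.congr (hF₂.1 rM rfl) (hF₂.2 aDir rfl) (hF₂.2 aBi rfl)
    have hv₂ : τ₂.reg rV = v := (hF₂.1 rV rfl).trans ((hF₁.1 rV rfl).trans hv)
    refine (wp_buildNetwork hτ₂ hv₂ hA₂).mono ?_
    rintro T₃ τ₃ ⟨hT₃, hF₃, hN₃⟩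
    have hτ₃ : HoldsGraph G τ₃ := hτ₂.congr (hF₃.1 rM rfl) (hF₃.2 aDir rfl) (hF₃.2 aBi rfl)
    obtain ⟨T₄, τ₄, hexec, hmax, hreg, harr⟩ :=
      hP m G v _ MixedGraph.allowed_subset τ₃ hN₃
    have hτ₄ : HoldsGraph G τ₄ := hτ₃.congr (hreg rM (by decide) (by decide))
      (harr aDir (by decide)) (harr aBi (by decide))
    have hv₄ : τ₄.reg rV = v := (hreg rV (by decide) (by decide)).trans ((hF₃.1 rV rfl).trans hv₂)
    refine ⟨T₄, τ₄, hexec, ?_⟩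
    refine (wp_countParents hτ₄ hv₄).mono ?_
    rintro T₅ τ₅ ⟨hT₅, hF₅, hp⟩
    have hτ₅ : HoldsGraph G τ₅ := hτ₄.congr (hF₅.1 rM rfl) (hF₅.2 aDir rfl) (hF₅.2 aBi rfl)
    have hv₅ : τ₅.reg rV = v := (hF₅.1 rV rfl).trans hv₄
    have hc₅ : τ₅.reg rChanged = σ.reg rChanged :=
      (hF₅.1 rChanged rfl).trans ((hreg rChanged (by decide) (by decide)).trans
        ((hF₃.1 rChanged rfl).trans ((hF₂.1 rChanged rfl).trans (hF₁.1 rChanged rfl))))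
    have hS₅ : HoldsSet S (τ₅.arr aSolved 0) := by
      rw [hF₅.2 aSolved rfl, harr aSolved (by decide), hF₃.2 aSolved rfl, hF₂.2 aSolved rfl]
      exact hS₁
    have hiff : τ₅.reg rFlow = τ₅.reg rParents ↔ CanSolve G S v := by
      rw [hp, hF₅.1 rFlow rfl]
      exact eq_ncard_pa_iff MixedGraph.allowed_subset hmax
    have htime : B → T₁ + T₂ + T₃ + T₄ + T₅ + 100 ≤ TP + 2000 * (m + 1) ^ 3 := by
      intro hB
      have := hT hB v _ MixedGraph.allowed_subset τ₃ hN₃ T₄ τ₄ hexec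
      omega
    simp only [wp_when, wp_block_cons, wp_block_nil, wp_assign, wp_put, Expr.cost, Expr.eval, hv₅]
    refine ⟨fun hq => ⟨fun hB => ?_, ?_, hτ₅.congr rfl rfl rfl, Or.inr ⟨fun i => ?_, ?_, hvS, ?_⟩⟩,
      fun hq => ⟨fun hB => ?_, trivial, hτ₅, Or.inl ⟨hS₅, hc₅, Or.inr ?_⟩⟩⟩
    · have := htime hB
      omega
    · simpa using hv₅
    · by_cases hi : i = v
      · simp [hi]
      · have : ¬ (i : ℕ) = v := fun h => hi (Fin.ext h)
        simpa [this, hi] using hS₅ i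
    · simp
    · refine hiff.1 ?_
      by_contra hne
      simp [hne] at hq
    · have := htime hB
      omega
    · rw [← hiff]
      intro he
      simp [he] at hq
  · simp only [Expr.cost]
    omega
  · by_contra hvS
    exact hb.2 hvS h

theorem wp_checkAllSolved {S : Set (Fin m)} {σ : Memory} (hσ : HoldsGraph G σ)
    (hS : HoldsSet S (σ.arr aSolved 0)) :
    wp checkAllSolved σ fun T τ => T ≤ m * 30 + 20 ∧ Frame checkAllSolved σ τ ∧
      ((τ.reg rAnswer = 1 ∧ S = Set.univ) ∨ (τ.reg rAnswer = 0 ∧ S ≠ Set.univ)) := by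
  suffices H : wp checkAllSolved σ fun T τ => T ≤ m * 30 + 20 ∧
      ((τ.reg rAnswer = 1 ∧ S = Set.univ) ∨ (τ.reg rAnswer = 0 ∧ S ≠ Set.univ)) by
    exact H.frame.mono fun T τ ⟨⟨h₁, h₂⟩, h₃⟩ => ⟨h₁, h₃, h₂⟩
  simp only [checkAllSolved, wp_block_cons, wp_block_nil, wp_assign, Expr.cost, Expr.eval]
  refine wp.mono (wp_forBelow_frame m 20 (fun k τ =>
    (τ.reg rAnswer = 1 ∧ ∀ i : Fin m, (i : ℕ) < k → i ∈ S) ∨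
    (τ.reg rAnswer = 0 ∧ S ≠ Set.univ)) (by decide) (by rfl) (by rfl) hσ.size
    (Or.inl ⟨rfl, by simp⟩) ?_) ?_
  · rintro k hk τ hτk hF hI
    have e : τ.arr aSolved = σ.arr aSolved := hF.2 aSolved rfl
    have hSk := hS ⟨k, hk⟩
    simp only at hSk
    simp only [wp_when, wp_assign, Expr.cost, Expr.eval, hτk, e]
    refine ⟨fun hb => ⟨by omega, Or.inr ⟨rfl, fun h => ?_⟩⟩, fun hb => ⟨by omega, ?_⟩⟩
    · have := hSk.2 (h ▸ Set.mem_univ _)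
      simp [this] at hb
    · refine hI.imp (fun ⟨h₁, h₂⟩ => ⟨h₁, fun i hi => ?_⟩) id
      rcases Nat.lt_succ_iff_lt_or_eq.1 hi with hi | hi
      · exact h₂ i hi
      · have hi' : i = ⟨k, hk⟩ := Fin.ext hi
        rw [hi']
        refine hSk.1 fun h => ?_
        simp [h] at hb
  · rintro T τ ⟨hT, hI, -⟩
    refine ⟨by omega, hI.imp (fun ⟨h₁, h₂⟩ => ⟨h₁, ?_⟩) id⟩
    exact Set.eq_univ_of_forall fun i => h₂ i i.2

/-- If nothing was added during the pass, all tests were made against one and the same `S`, so no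
node outside `S` can be solved. Tests made before a change refer to smaller sets, but then only the
growth of `S` matters. -/
theorem wp_iteration {P : Cmd} (hP : IsMaxFlowProcedure P) {B : Prop} {TP : ℕ}
    (hT : B → RunsWithin P G TP) {S : Set (Fin m)} {σ : Memory}
    (hσ : HoldsGraph G σ) (hS : HoldsSet S (σ.arr aSolved 0)) (hsol : G.Solvable S) :
    wp (iteration P) σ fun T τ => (B → T ≤ m * (TP + 2000 * (m + 1) ^ 3 + 50) + 50) ∧
      HoldsGraph G τ ∧ ∃ S' : Set (Fin m), HoldsSet S' (τ.arr aSolved 0) ∧ G.Solvable S' ∧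
        ((τ.reg rAnswer = 1 ∧ S' = Set.univ) ∨ (τ.reg rAnswer = 0 ∧ S' ≠ Set.univ)) ∧
        ((τ.reg rChanged = 0 ∧ S' = S ∧ ∀ v ∉ S, ¬ CanSolve G S v) ∨
          (τ.reg rChanged = 1 ∧ S.ncard < S'.ncard)) := by
  simp only [iteration, wp_block_cons, wp_block_nil, wp_assign, Expr.cost, Expr.eval]
  refine wp.mono (wp_forBelow (B := B) m (TP + 2000 * (m + 1) ^ 3) (fun k τ =>
    HoldsGraph G τ ∧ ∃ S' : Set (Fin m), HoldsSet S' (τ.arr aSolved 0) ∧ G.Solvable S' ∧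
      ((τ.reg rChanged = 0 ∧ S' = S ∧ ∀ v : Fin m, (v : ℕ) < k → v ∉ S → ¬ CanSolve G S v) ∨
        (τ.reg rChanged = 1 ∧ S.ncard < S'.ncard))) (by decide) hσ.size
    ⟨hσ.congr rfl rfl rfl, S, hS, hsol, Or.inl ⟨rfl, rfl, by simp⟩⟩ ?_) ?_
  · rintro k hk τ hτk hτm ⟨hτ, S', hS', hsol', hI⟩
    refine (wp_processNode (v := ⟨k, hk⟩) hP hT hτ hτk hS').mono ?_
    rintro T ρ ⟨hT, hρv, hρ, hres⟩
    refine ⟨hT, hρv, hρ.size, hρ.congr rfl rfl rfl, ?_⟩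
    have hchg : Function.update ρ.reg rV (k + 1) rChanged = ρ.reg rChanged := rfl
    simp only [hchg]
    rcases hres with ⟨h₁, h₂, h₃⟩ | ⟨h₁, h₂, h₃, h₄⟩
    · refine ⟨S', h₁, hsol', ?_⟩
      rw [h₂]
      refine hI.imp (fun ⟨h₄, h₅, h₆⟩ => ⟨h₄, h₅, fun v hvk hvS => ?_⟩) id
      rcases Nat.lt_succ_iff_lt_or_eq.1 hvk with hvk | hvk
      · exact h₆ v hvk hvS
      · have hv' : v = ⟨k, hk⟩ := Fin.ext hvk
        rw [hv'] at hvS ⊢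
        rw [h₅] at h₃
        exact h₃.resolve_left hvS
    · refine ⟨insert ⟨k, hk⟩ S', h₁, hsol'.insert (v := (⟨k, hk⟩ : Fin m)) h₃ h₄, Or.inr ⟨h₂, ?_⟩⟩
      rw [Set.ncard_insert_of_notMem h₃ (Set.toFinite _)]
      rcases hI with ⟨_, h, _⟩ | ⟨_, h⟩
      · rw [h]
        exact Nat.lt_succ_self _
      · omega
  · rintro T τ ⟨hT, -, -, hτ, S', hS', hsol', hI⟩
    refine (wp_checkAllSolved hτ hS').mono ?_
    rintro T' ρ ⟨hT', hF, hans⟩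
    refine ⟨fun hB => ?_, hτ.congr (hF.1 rM rfl) (hF.2 aDir rfl) (hF.2 aBi rfl), S', ?_, hsol',
      hans, ?_⟩
    · have h₁ := hT hB
      have h₂ : m * (TP + 2000 * (m + 1) ^ 3 + 9) + m * 30 ≤
          m * (TP + 2000 * (m + 1) ^ 3 + 50) := by
        rw [← Nat.mul_add]
        exact Nat.mul_le_mul_left _ (by omega)
      omega
    · rw [hF.2 aSolved rfl]
      exact hS'
    · rw [hF.1 rChanged rfl]
      exact hI.imp (fun ⟨h₁, h₂, h₃⟩ => ⟨h₁, h₂, fun v => h₃ v v.2⟩) id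

theorem holdsGraph_input (G : MixedGraph (Fin m)) : HoldsGraph G (input G) := by
  refine ⟨rfl, fun v w => ?_, fun v w => ?_⟩
  · have : (input G).arr aDir v w =
        matrixOf (fun i j => ∃ v w : Fin m, i = v ∧ j = w ∧ G.dir v w) v w := rfl
    rw [this, matrixOf]
    simp [← Fin.ext_iff]
  · have : (input G).arr aBi v w =
        matrixOf (fun i j => ∃ v w : Fin m, i = v ∧ j = w ∧ G.bi v w) v w := rfl
    rw [this, matrixOf]
    simp [← Fin.ext_iff]

/-- The loop ends either with all nodes solved, where `Solvable.htcIdentifiable` applies, or after a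
pass without change, where `HTCIdentifiable.eq_univ` excludes identifiability unless everything is
solved. -/
theorem wp_testHTC {P : Cmd} (hP : IsMaxFlowProcedure P) {B : Prop} {TP : ℕ}
    (hT : B → RunsWithin P G TP) :
    wp (testHTC P) (input G) fun T τ =>
      (B → T ≤ (m + 2) * (m * (TP + 2000 * (m + 1) ^ 3 + 50) + 100) + m * (m * 30 + 50) + 50) ∧
      ((τ.reg rAnswer = 1 ∧ G.HTCIdentifiable) ∨
        (τ.reg rAnswer = 0 ∧ ¬ G.HTCIdentifiable)) := by
  have e : testHTC P = .block [initSolved, .seq (iteration P)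
    (.loop (.eq (.add (.reg rAnswer) (not (.reg rChanged))) (.lit 0)) (iteration P))] := rfl
  simp only [e, wp_block_cons, wp_block_nil, wp_seq]
  refine (wp_initSolved (holdsGraph_input G)).mono ?_
  rintro T₁ τ₁ ⟨hT₁, hτ₁, hS₁⟩
  refine (wp_iteration hP hT hτ₁ hS₁ (MixedGraph.solvable_of_pa_eq_empty fun v hv => hv)).mono ?_
  rintro T₂ τ₂ ⟨hT₂, hτ₂, S, hS, hsol, hans, hchg⟩
  have hcard : ∀ S : Set (Fin m), S.ncard ≤ m := fun S => by
    have := Set.ncard_le_ncard (Set.subset_univ S) (Set.toFinite _)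
    rwa [Set.ncard_univ, Nat.card_eq_fintype_card, Fintype.card_fin] at this
  refine wp.mono (wp_loop (B := B) (fun n τ => HoldsGraph G τ ∧ ∃ S : Set (Fin m),
      HoldsSet S (τ.arr aSolved 0) ∧ G.Solvable S ∧
      ((τ.reg rAnswer = 1 ∧ S = Set.univ) ∨ (τ.reg rAnswer = 0 ∧ S ≠ Set.univ)) ∧
      -- The variant is the number of unsolved nodes, plus `1` as long as changes occur, so that the
      -- final pass without change decreases it as well.
      ((τ.reg rChanged = 0 ∧ (∀ v ∉ S, ¬ CanSolve G S v) ∧ n = m - S.ncard) ∨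
        (τ.reg rChanged = 1 ∧ n = m - S.ncard + 1)))
    (m * (TP + 2000 * (m + 1) ^ 3 + 50) + 50) ?_
    (m - S.ncard + if τ₂.reg rChanged = 0 then 0 else 1) τ₂ ⟨hτ₂, S, hS, hsol, hans, ?_⟩) ?_
  · rintro n τ ⟨hτ, S, hS, hsol, hans, hchg⟩ hb
    have hn : n = m - S.ncard + 1 := by
      rcases hchg with ⟨h, -, -⟩ | ⟨_, h⟩
      · simp [Expr.eval, h] at hb
      · exact h
    refine (wp_iteration hP hT hτ hS hsol).mono ?_
    rintro T ρ ⟨hT, hρ, S', hS', hsol', hans', hchg'⟩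
    refine ⟨hT, ?_⟩
    rcases hchg' with ⟨h₁, h₂, h₃⟩ | ⟨h₁, h₂⟩
    · refine ⟨m - S.ncard, by omega, hρ, S', hS', hsol', hans', Or.inl ⟨h₁, ?_, by rw [h₂]⟩⟩
      rwa [h₂]
    · have := hcard S'
      exact ⟨m - S'.ncard + 1, by omega, hρ, S', hS', hsol', hans', Or.inr ⟨h₁, rfl⟩⟩
  · rcases hchg with ⟨h₁, h₂, h₃⟩ | ⟨h₁, _⟩
    · exact Or.inl ⟨h₁, by rwa [h₂], by simp [h₁]⟩
    · exact Or.inr ⟨h₁, by simp [h₁]⟩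
  · rintro T₃ τ₃ ⟨hT₃, ⟨n, _, _, S', _, hsol', hans', hchg'⟩, hb⟩
    refine ⟨fun hB => ?_, ?_⟩
    · have h₂ := hT₂ hB
      have h₃ := hT₃ hB
      simp only [Expr.cost] at h₃
      have h₄ : (m - S.ncard + if τ₂.reg rChanged = 0 then 0 else 1) ≤ m + 1 := by
        split_ifs <;> omega
      have h₅ := Nat.mul_le_mul_right (1 + (1 + (1 + 1 + (1 + 1 + 1)) + 1) +
        (m * (TP + 2000 * (m + 1) ^ 3 + 50) + 50)) h₄
      have h₆ : (m + 1) * (1 + (1 + (1 + 1 + (1 + 1 + 1)) + 1) +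
          (m * (TP + 2000 * (m + 1) ^ 3 + 50) + 50)) ≤
          (m + 1) * (m * (TP + 2000 * (m + 1) ^ 3 + 50) + 100) :=
        Nat.mul_le_mul_left _ (by omega)
      have h₇ : (m + 2) * (m * (TP + 2000 * (m + 1) ^ 3 + 50) + 100) =
          (m + 1) * (m * (TP + 2000 * (m + 1) ^ 3 + 50) + 100) +
          (m * (TP + 2000 * (m + 1) ^ 3 + 50) + 100) := by ring
      omega
    · rcases hans' with ⟨h₁, h₂⟩ | ⟨h₁, h₂⟩
      · subst h₂
        exact Or.inl ⟨h₁, hsol'.htcIdentifiable⟩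
      · refine Or.inr ⟨h₁, fun hid => h₂ ?_⟩
        rcases hchg' with ⟨_, h₃, _⟩ | ⟨h₃, _⟩
        · exact hid.eq_univ h₃
        · simp [Expr.eval, h₁, h₃] at hb

/-- Apart from the edges between right-hand copies, every edge leads to a later layer in the order
source, left, right, sink, and no edge leads back. -/
theorem reciprocalPairs_flowNetwork_le (G : MixedGraph (Fin m)) (v : Fin m) (A : Set (Fin m)) :
    reciprocalPairs (G.flowNetwork v A).edge ≤ reciprocalPairs G.dir := by
  have hinj : Function.Injective (FlowNode.right : Fin m → FlowNode A) := fun x y h => by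
    cases h; rfl
  rw [reciprocalPairs, reciprocalPairs,
    ← Set.ncard_image_of_injective _ (Sym2.map.injective hinj)]
  refine Set.ncard_le_ncard ?_ (Set.toFinite _)
  rintro _ ⟨x, y, rfl, hne, hxy, hyx⟩
  cases hxy with
  | right_right w u h =>
    cases hyx with
    | right_right _ _ h' => exact ⟨s(w, u), ⟨w, u, rfl, fun e => hne (e ▸ rfl), h, h'⟩, rfl⟩
  | _ => cases hyx

theorem testHTC_time {P : Cmd} (hP : IsMaxFlowProcedure P) (hcubic : RunsInCubicTime P) :
    ∃ C : ℕ, ∀ (m : ℕ) (G : MixedGraph (Fin m)), 0 < m →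
      ∀ (t : ℕ) (τ : RAM.Memory), Exec (testHTC P) (input G) t τ →
        t ≤ C * (m ^ 2 * (m + reciprocalPairs G.dir) ^ 3) := by
  obtain ⟨K, hK⟩ := hcubic
  -- For `m ≥ 1`: `3` comes from `m + 2 ≤ 3 * m`, `64` from `2 * m + 2 + r ≤ 4 * (m + r)`, `16150`
  -- is `2000 * 8 + 50 + 100`, and `130` is `30 + 50 + 50`. For `m = 0` the claimed bound would be
  -- `0`, but the program takes some steps.
  refine ⟨3 * (64 * K + 16150) + 130, fun m G hm t τ h => ?_⟩
  set r := reciprocalPairs G.dir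
  have hT : True → RunsWithin P G (K * (2 * m + 2 + r) ^ 3) := by
    intro _ v A hA σ hσ t τ h
    refine (hK m G v A hA σ hσ t τ h).trans ?_
    have h₁ := (card_flowNode_le A).2
    have h₂ := reciprocalPairs_flowNetwork_le G v A
    gcongr
  obtain ⟨T, τ', h', hle, -⟩ := wp_testHTC hP hT
  rw [(h'.deterministic h).1]
  refine (hle trivial).trans ?_
  set X := (m + r) ^ 3 with hX
  have hX1 : 1 ≤ X := Nat.one_le_pow _ _ (by omega)
  have h₁ : (2 * m + 2 + r) ^ 3 ≤ 64 * X := by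
    calc (2 * m + 2 + r) ^ 3 ≤ (4 * (m + r)) ^ 3 := by gcongr; omega
      _ = 64 * X := by ring
  have h₂ : (m + 1) ^ 3 ≤ 8 * X := by
    calc (m + 1) ^ 3 ≤ (2 * (m + r)) ^ 3 := by gcongr; omega
      _ = 8 * X := by ring
  have hmX : m ^ 2 ≤ m ^ 2 * X := Nat.le_mul_of_pos_right _ hX1
  have hm2 : m ≤ m ^ 2 := Nat.le_self_pow two_ne_zero _
  calc (m + 2) * (m * (K * (2 * m + 2 + r) ^ 3 + 2000 * (m + 1) ^ 3 + 50) + 100)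
        + m * (m * 30 + 50) + 50
      ≤ (3 * m) * (m * (K * (64 * X) + 2000 * (8 * X) + 50 * X) + 100 * (m * X))
        + m * (m * 30 + 50 * m) + 50 * m ^ 2 := by
        gcongr
        · omega
        · omega
        · calc 100 = 100 * (1 * 1) := by norm_num
            _ ≤ 100 * (m * X) := by gcongr; omega
        · omega
        · nlinarith
    _ = (3 * (64 * K + 16150)) * (m ^ 2 * X) + 130 * m ^ 2 := by ring
    _ ≤ (3 * (64 * K + 16150)) * (m ^ 2 * X) + 130 * (m ^ 2 * X) := by gcongr
    _ = (3 * (64 * K + 16150) + 130) * (m ^ 2 * X) := by ring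

end HTCAlgorithm

theorem theorem7 :
    -- the algorithm halts and returns "yes" if and only if the graph is HTC-identifiable,
    -- whatever correct maximum flow procedure it calls
    (∀ P : RAM.Cmd, HTCAlgorithm.IsMaxFlowProcedure P →
      ∀ (m : ℕ) (G : MixedGraph (Fin m)), ∃ (t : ℕ) (τ : RAM.Memory),
        RAM.Exec (HTCAlgorithm.testHTC P) (HTCAlgorithm.input G) t τ ∧
        (τ.reg HTCAlgorithm.rAnswer = 1 ↔ G.HTCIdentifiable) ∧
        (τ.reg HTCAlgorithm.rAnswer = 0 ↔ ¬ G.HTCIdentifiable)) ∧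
    -- with a cubic-time maximum flow procedure, its running time is `O(|V|^2 (|V| + r)^3)`
    (∀ P : RAM.Cmd, HTCAlgorithm.IsMaxFlowProcedure P → HTCAlgorithm.RunsInCubicTime P →
      ∃ C : ℕ, ∀ (m : ℕ) (G : MixedGraph (Fin m)), 0 < m →
        ∀ (t : ℕ) (τ : RAM.Memory),
          RAM.Exec (HTCAlgorithm.testHTC P) (HTCAlgorithm.input G) t τ →
          t ≤ C * (m ^ 2 * (m + reciprocalPairs G.dir) ^ 3)) ∧
    -- and such a maximum flow procedure exists
    (∃ P : RAM.Cmd, HTCAlgorithm.IsMaxFlowProcedure P ∧ HTCAlgorithm.RunsInCubicTime P) ∧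
    -- the number of reciprocal edge pairs is at most half the number of directed edges
    (∀ (m : ℕ) (G : MixedGraph (Fin m)),
      2 * reciprocalPairs G.dir ≤ Set.ncard {e : Fin m × Fin m | G.dir e.1 e.2}) := by
  refine ⟨fun P hP m G => ?_, fun P => HTCAlgorithm.testHTC_time,
    ⟨_, HTCAlgorithm.isMaxFlowProcedure_unitMaxFlow, HTCAlgorithm.runsInCubicTime_unitMaxFlow⟩,
    fun m G => two_mul_reciprocalPairs_le⟩
  obtain ⟨t, τ, h, -, hans⟩ :=
    -- Nothing is known here about the running time of `P`; with `B := False` the time bound is void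
    -- and only halting and correctness are used.
    HTCAlgorithm.wp_testHTC (G := G) (B := False) (TP := 0) hP False.elim
  refine ⟨t, τ, h, ?_⟩
  rcases hans with ⟨h₁, h₂⟩ | ⟨h₁, h₂⟩ <;> simp [h₁, h₂]
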